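/- Let $d\ge 1$ be an integer. Write $B(x,r)$ for the open ball in $\mathbb R^{d+1}$, $\operatorname{supp}$ for closed supports (of measures and of functions), $K_\delta(x)=\frac{x}{\max(\delta,|x|)^{d+1}}$ for $\delta>0$, and, for a linear hyperplane $H\subset\mathbb R^{d+1}$ with orthogonal projection $\pi_H$, $K^H_\delta=\pi_H K_\delta$. For a positive Borel measure $\mu$ on $\mathbb R^{d+1}$ put $R_{\mu,\delta}f(x)=\int K_\delta(x-y)f(y)\,d\mu(y)$ and $R^H_{\mu,\delta}f(x)=\int K^H_\delta(x-y)f(y)\,d\mu(y)$. The measure $\mu$ is called $C$-nice if $\mu(B(x,r))\le Cr^d$ for all $x$ and all $r>0$, and $C$-good if, in addition, $\|R_{\mu,\delta}\|_{L^2(\mu)\to L^2(\mu)}\le C$ for all $\delta>0$. For good $\mu$, $R^H_\mu$ denotes the weak limit of $R^H_{\mu,\delta}$ in $L^2(\mu)$ as $\delta\to0+$, so that $\langle R^H_\mu f,g\rangle_\mu=\lim_{\delta\to0+}\int\langle R^H_{\mu,\delta}f,g\rangle\,d\mu$. A nice (i.e. $C$-nice for some $C$) measure $\mu$ is AD regular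 in an open set $U$ with lower regularity constant $c>0$ if $\mu(B(x,r))\ge cr^d$ whenever $x\in U\cap\operatorname{supp}\mu$, $r>0$ and $B(x,r)\subset U$. For $z\in\mathbb R^{d+1}$ let $L=z+H$ and let $m_L$ be the $d$-dimensional Lebesgue measure on $L$. For $A,\alpha,\ell>0$, $\mu$ is geometrically $(H,A,\alpha)$-flat at $z$ on scale $\ell$ if every point of $\operatorname{supp}\mu\cap B(z,A\ell)$ lies within distance $\alpha\ell$ from $L$ and every point of $L\cap B(z,A\ell)$ lies within distance $\alpha\ell$ from $\operatorname{supp}\mu$. It is $(H,A,\alpha)$-flat at $z$ on scale $\ell$ if, in addition, $\left|\int f\,d\mu\right|\le\alpha\ell^d$ for every Lipschitz $f:\mathbb R^{d+1}\to\mathbb R$ with $\operatorname{supp}f\subset B(z,A\ell)$, $\|f\|_{\mathrm{Lip}}\le\ell^{-1}$ and $\int f\,dm_L=0$. **Flattening Lemma.** For all $A,\alpha,\tilde c,\tilde C>0$ there exist $A',\alpha'>0$, depending only on $A,\alpha,\tilde c,\tilde C$ and $d$, such that the following holds. Let $H\subset\mathbb R^{d+1}$ be a linear hyperplane, $z\in\mathbb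 R^{d+1}$, $\ell>0$, and let $\mu$ be a finite $\tilde C$-good measure on $\mathbb R^{d+1}$ that is AD regular in $B(z,5A'\ell)$ with lower regularity constant $\tilde c$. Suppose that $\mu$ is geometrically $(H,5A',\alpha')$-flat at $z$ on scale $\ell$, and that $$|\langle R^H_\mu 1,g\rangle_\mu|\le\alpha'\ell^d$$ for every Lipschitz $g:\mathbb R^{d+1}\to\mathbb R^{d+1}$ with $\operatorname{supp}g\subset B(z,5A'\ell)$, $\|g\|_{\mathrm{Lip}}\le\ell^{-1}$ and $\int g\,d\mu=0$. Then $\mu$ is $(H,A,\alpha)$-flat at $z$ on scale $\ell$. -/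

import Mathlib

open MeasureTheory Metric Filter Topology

noncomputable section

/-- The ambient space `ℝ^{d+1}` with its Euclidean norm. -/
abbrev Sp (d : ℕ) : Type := EuclideanSpace ℝ (Fin (d + 1))

/-- The regularized `d`-dimensional Riesz kernel `K_δ(x) = x / max(δ, |x|)^{d+1}`. -/
def rieszKernel {d : ℕ} (δ : ℝ) (x : Sp d) : Sp d :=
  (max δ ‖x‖ ^ (d + 1))⁻¹ • x

/-- The regularized Riesz transform `R_{μ,δ} f = R_δ(f μ)`, that is
`(R_{μ,δ} f)(x) = ∫ K_δ(x - y) f(y) dμ(y)`, of a scalar function `f`. -/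
def rieszReg {d : ℕ} (μ : Measure (Sp d)) (δ : ℝ) (f : Sp d → ℝ) (x : Sp d) : Sp d :=
  ∫ y, f y • rieszKernel δ (x - y) ∂μ

/-- `μ` is `C`-nice: `μ(B(x,r)) ≤ C r^d` for all balls. -/
def IsNice {d : ℕ} (C : ℝ) (μ : Measure (Sp d)) : Prop :=
  ∀ (x : Sp d) (r : ℝ), 0 < r → μ (ball x r) ≤ ENNReal.ofReal (C * r ^ d)

/-- `μ` is `C`-good: it is `C`-nice and `‖R_{μ,δ}‖_{L²(μ) → L²(μ)} ≤ C` for every `δ > 0`. -/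
def IsGood {d : ℕ} (C : ℝ) (μ : Measure (Sp d)) : Prop :=
  IsNice C μ ∧ ∀ δ : ℝ, 0 < δ → ∀ f : Sp d → ℝ, MemLp f 2 μ →
    eLpNorm (rieszReg μ δ f) 2 μ ≤ ENNReal.ofReal C * eLpNorm f 2 μ

/-- `μ` is (nice and) AD regular in the open set `U` with lower regularity constant `c`. -/
def IsADRegularIn {d : ℕ} (U : Set (Sp d)) (c : ℝ) (μ : Measure (Sp d)) : Prop :=
  (∃ C : ℝ, IsNice C μ) ∧
    ∀ x ∈ μ.support ∩ U, ∀ r : ℝ, 0 < r → ball x r ⊆ U → ENNReal.ofReal (c * r ^ d) ≤ μ (ball x r)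

/-- The affine subspace `z + H` through `z` parallel to the linear subspace `H`, as a set. -/
def parallelThrough {d : ℕ} (H : Submodule ℝ (Sp d)) (z : Sp d) : Set (Sp d) :=
  {x | x - z ∈ H}

/-- Lebesgue measure on `z + H` (of the dimension of `H`), as a measure on `ℝ^{d+1}`: the image
under `h ↦ z + h` of the Lebesgue measure of the Euclidean space `H`. -/
def planeMeasure {d : ℕ} (H : Submodule ℝ (Sp d)) (z : Sp d) : Measure (Sp d) :=
  Measure.map (fun h : H => z + (h : Sp d)) volume

/-- `μ` is geometrically `(H, A, α)`-flat at the point `z` on the scale `ℓ`. As `supp μ` and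
`z + H` are closed, "within distance `αℓ`" is expressed by a point at distance at most `αℓ`. -/
def IsGeomFlat {d : ℕ} (H : Submodule ℝ (Sp d)) (A α : ℝ) (z : Sp d) (ℓ : ℝ)
    (μ : Measure (Sp d)) : Prop :=
  (∀ x ∈ μ.support ∩ ball z (A * ℓ), ∃ y ∈ parallelThrough H z, dist x y ≤ α * ℓ) ∧
    ∀ x ∈ parallelThrough H z ∩ ball z (A * ℓ), ∃ y ∈ μ.support, dist x y ≤ α * ℓ

/-- `μ` is (fully) `(H, A, α)`-flat at the point `z` on the scale `ℓ`. -/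
def IsFlat {d : ℕ} (H : Submodule ℝ (Sp d)) (A α : ℝ) (z : Sp d) (ℓ : ℝ)
    (μ : Measure (Sp d)) : Prop :=
  IsGeomFlat H A α z ℓ μ ∧
    ∀ f : Sp d → ℝ, LipschitzWith (Real.toNNReal ℓ⁻¹) f → tsupport f ⊆ ball z (A * ℓ) →
      ∫ x, f x ∂(planeMeasure H z) = 0 → |∫ x, f x ∂μ| ≤ α * ℓ ^ d

/-- The regularized `H`-restricted kernel `K^H_δ(x) = π_H x / max(δ, |x|)^{d+1}`, where `π_H` is
the orthogonal projection onto `H`. -/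
def rieszKernelH {d : ℕ} (H : Submodule ℝ (Sp d)) (δ : ℝ) (x : Sp d) : Sp d :=
  (max δ ‖x‖ ^ (d + 1))⁻¹ • H.starProjection x

/-- The regularized `H`-restricted Riesz transform
`(R^H_{μ,δ} f)(x) = ∫ K^H_δ(x - y) f(y) dμ(y)`. -/
def rieszRegH {d : ℕ} (H : Submodule ℝ (Sp d)) (μ : Measure (Sp d)) (δ : ℝ) (f : Sp d → ℝ)
    (x : Sp d) : Sp d :=
  ∫ y, f y • rieszKernelH H δ (x - y) ∂μ

/-- The coupling `⟨R^H_μ f, g⟩_μ`, where `R^H_μ` is the weak limit of the operators `R^H_{μ,δ}` as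
`δ → 0+`, i.e. `⟨R^H_μ f, g⟩_μ = lim_{δ → 0+} ∫ ⟨R^H_{μ,δ} f, g⟩ dμ`. -/
def rieszPairingH {d : ℕ} (H : Submodule ℝ (Sp d)) (μ : Measure (Sp d)) (f : Sp d → ℝ)
    (g : Sp d → Sp d) : ℝ :=
  limUnder (𝓝[>] (0 : ℝ)) fun δ => ∫ x, inner ℝ (rieszRegH H μ δ f x) (g x) ∂μ

/-- A nice measure integrates `|x - y|^{-(d-1)}` uniformly (up to a bounded far part). -/
theorem IsNice.exists_lintegral_le {e : ℕ} {C : ℝ} {μ : Measure (Sp (e + 1))} [IsFiniteMeasure μ]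
    (hμ : IsNice C μ) :
    ∃ B : ENNReal, B ≠ ⊤ ∧ ∀ x, ∫⁻ y, ENNReal.ofReal ((‖x - y‖ ^ e)⁻¹) ∂μ ≤ B := by
  refine ⟨μ Set.univ + ∑' k : ℕ, ENNReal.ofReal (|C| * 2 ^ (2 * e + 1) * (1 / 2) ^ k),
    ENNReal.add_ne_top.2 ⟨measure_ne_top _ _, ?_⟩, fun x => ?_⟩
  · have hs : Summable fun k : ℕ => |C| * 2 ^ (2 * e + 1) * (1 / 2 : ℝ) ^ k :=
      (summable_geometric_of_lt_one (by norm_num) (by norm_num)).mul_left _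
    exact hs.tsum_ofReal_ne_top
  have hnull : μ {x} = 0 := by
    refine le_antisymm ?_ bot_le
    have h1 : Tendsto (fun r : ℝ => ENNReal.ofReal (C * r ^ (e + 1))) (𝓝[>] 0) (𝓝 0) := by
      have : Continuous (fun r : ℝ => ENNReal.ofReal (C * r ^ (e + 1))) :=
        ENNReal.continuous_ofReal.comp (by fun_prop)
      have h2 := (this.tendsto 0).mono_left (nhdsWithin_le_nhds (s := Set.Ioi 0))
      simpa using h2
    refine ge_of_tendsto h1 ?_
    filter_upwards [self_mem_nhdsWithin] with r hr
    exact (measure_mono (Set.singleton_subset_iff.2 (mem_ball_self hr))).trans (hμ x r hr)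
  have hpt : ∀ y, y ≠ x → ENNReal.ofReal ((‖x - y‖ ^ e)⁻¹) ≤
      1 + ∑' k : ℕ, (ball x (2 * (1 / 2) ^ k)).indicator
        (fun _ => ENNReal.ofReal ((2 ^ (k + 1)) ^ e)) y := by
    intro y hy
    have hpos : 0 < ‖x - y‖ := norm_pos_iff.2 (sub_ne_zero.2 hy.symm)
    rcases le_total 1 ‖x - y‖ with h | h
    · refine le_trans ?_ le_self_add
      rw [← ENNReal.ofReal_one]
      exact ENNReal.ofReal_le_ofReal (inv_le_one_of_one_le₀ (one_le_pow₀ h))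
    · obtain ⟨k, hk1, hk2⟩ := exists_nat_pow_near_of_lt_one hpos h
        (show (0 : ℝ) < 1 / 2 by norm_num) (by norm_num)
      refine le_trans ?_ le_add_self
      refine le_trans ?_ (ENNReal.le_tsum k)
      have hmem : y ∈ ball x (2 * (1 / 2) ^ k) := by
        rw [mem_ball, dist_comm, dist_eq_norm]
        have : (0 : ℝ) < (1 / 2) ^ k := by positivity
        linarith
      rw [Set.indicator_of_mem hmem]
      apply ENNReal.ofReal_le_ofReal
      rw [← inv_pow]
      apply pow_le_pow_left₀ (by positivity)
      rw [inv_le_comm₀ hpos (by positivity)]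
      simpa [one_div, inv_pow] using hk1.le
  calc ∫⁻ y, ENNReal.ofReal ((‖x - y‖ ^ e)⁻¹) ∂μ
      ≤ ∫⁻ y, (1 + ∑' k : ℕ, (ball x (2 * (1 / 2) ^ k)).indicator
        (fun _ => ENNReal.ofReal ((2 ^ (k + 1)) ^ e)) y) ∂μ := by
        refine lintegral_mono_ae ?_
        have : ∀ᵐ y ∂μ, y ≠ x := by
          rw [ae_iff]; simpa using hnull
        filter_upwards [this] with y hy using hpt y hy
    _ = μ Set.univ + ∑' k : ℕ, ENNReal.ofReal ((2 ^ (k + 1)) ^ e) *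
          μ (ball x (2 * (1 / 2) ^ k)) := by
        rw [lintegral_add_left measurable_const, lintegral_tsum
          (fun k => (measurable_const.indicator measurableSet_ball).aemeasurable)]
        simp [lintegral_indicator measurableSet_ball]
    _ ≤ _ := by
        gcongr with k
        refine (mul_le_mul_right (hμ x _ (by positivity)) _).trans ?_
        rw [← ENNReal.ofReal_mul (by positivity)]
        apply ENNReal.ofReal_le_ofReal
        have : (2 ^ (k + 1)) ^ e * (|C| * (2 * (1 / 2) ^ k) ^ (e + 1)) =
            |C| * 2 ^ (2 * e + 1) * (1 / 2 : ℝ) ^ k := by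
          have h2 : (2 : ℝ) ^ k * (1 / 2) ^ k = 1 := by rw [← mul_pow]; norm_num
          have h3 : ((2 : ℝ) ^ k) ^ e * ((1 / 2) ^ k) ^ e = 1 := by rw [← mul_pow, h2, one_pow]
          calc _ = |C| * 2 ^ (2 * e + 1) * (1 / 2 : ℝ) ^ k *
                (((2 : ℝ) ^ k) ^ e * ((1 / 2) ^ k) ^ e) := by ring
            _ = _ := by rw [h3, mul_one]
        rw [← this]
        gcongr
        exact le_abs_self C

/-- The limit that defines the coupling `⟨R^H_μ 1, g⟩_μ` exists for every finite nice measure and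
every bounded Lipschitz `g`. -/
theorem tendsto_rieszPairingH {d : ℕ} (hd : 1 ≤ d) (H : Submodule ℝ (Sp d)) {C : ℝ}
    {μ : Measure (Sp d)} [IsFiniteMeasure μ] (hμ : IsNice C μ) {K : NNReal} {g : Sp d → Sp d}
    (hg : LipschitzWith K g) {M : ℝ} (hM : ∀ x, ‖g x‖ ≤ M) :
    Tendsto (fun δ => ∫ x, inner ℝ (rieszRegH H μ δ (fun _ => 1) x) (g x) ∂μ) (𝓝[>] 0)
      (𝓝 (rieszPairingH H μ (fun _ => 1) g)) := by
  obtain ⟨e, rfl⟩ : ∃ e, d = e + 1 := ⟨d - 1, by omega⟩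
  apply tendsto_nhds_limUnder
  have hmeas : ∀ δ : ℝ, Measurable (rieszKernelH H δ) := fun δ => by
    unfold rieszKernelH
    exact (by fun_prop : Measurable fun x : Sp (e + 1) => (max δ ‖x‖ ^ (e + 1 + 1))⁻¹).smul
      (H.starProjection.continuous.measurable)
  have hgm : Measurable g := hg.continuous.measurable
  have hbd0 : ∀ (δ : ℝ) (x : Sp (e + 1)), ‖rieszKernelH H δ x‖ ≤
      |(max δ ‖x‖ ^ (e + 1 + 1))⁻¹| * ‖x‖ := fun δ x => by
    unfold rieszKernelH
    rw [norm_smul, Real.norm_eq_abs]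
    gcongr
    exact H.norm_starProjection_apply_le x
  have hbd : ∀ δ : ℝ, 0 < δ → ∀ x : Sp (e + 1), ‖rieszKernelH H δ x‖ ≤ (δ ^ (e + 1))⁻¹ := by
    intro δ hδ x
    refine (hbd0 δ x).trans ?_
    have hm : 0 < max δ ‖x‖ := lt_max_of_lt_left hδ
    rw [abs_of_pos (by positivity)]
    calc (max δ ‖x‖ ^ (e + 1 + 1))⁻¹ * ‖x‖ ≤ (max δ ‖x‖ ^ (e + 1 + 1))⁻¹ * max δ ‖x‖ := by
          gcongr; exact le_max_right _ _
      _ = (max δ ‖x‖ ^ (e + 1))⁻¹ := by field_simp; ring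
      _ ≤ _ := by gcongr; exact le_max_left _ _
  have hid : ∀ δ : ℝ, 0 < δ → ∫ x, inner ℝ (rieszRegH H μ δ (fun _ => 1) x) (g x) ∂μ =
      (1 / 2) * ∫ p, inner ℝ (rieszKernelH H δ (p.1 - p.2)) (g p.1 - g p.2) ∂(μ.prod μ) := by
    intro δ hδ
    have hint : ∀ x, Integrable (fun y => rieszKernelH H δ (x - y)) μ := fun x =>
      Integrable.of_bound ((hmeas δ).comp (measurable_const.sub measurable_id)).aestronglyMeasurable
        _ (Eventually.of_forall fun y => hbd δ hδ _)
    have hm2 : Measurable fun p : Sp (e + 1) × Sp (e + 1) => rieszKernelH H δ (p.1 - p.2) :=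
      (hmeas δ).comp (measurable_fst.sub measurable_snd)
    have hi1 : Integrable (fun p : Sp (e + 1) × Sp (e + 1) =>
        (inner ℝ (rieszKernelH H δ (p.1 - p.2)) (g p.1) : ℝ)) (μ.prod μ) := by
      refine Integrable.of_bound (hm2.inner (hgm.comp measurable_fst)).aestronglyMeasurable
        ((δ ^ (e + 1))⁻¹ * M) (Eventually.of_forall fun p => ?_)
      refine (norm_inner_le_norm _ _).trans ?_
      gcongr
      exacts [hbd δ hδ _, hM _]
    have hi2 : Integrable (fun p : Sp (e + 1) × Sp (e + 1) =>
        (inner ℝ (rieszKernelH H δ (p.1 - p.2)) (g p.2) : ℝ)) (μ.prod μ) := by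
      refine Integrable.of_bound (hm2.inner (hgm.comp measurable_snd)).aestronglyMeasurable
        ((δ ^ (e + 1))⁻¹ * M) (Eventually.of_forall fun p => ?_)
      refine (norm_inner_le_norm _ _).trans ?_
      gcongr
      exacts [hbd δ hδ _, hM _]
    have hA : ∫ x, inner ℝ (rieszRegH H μ δ (fun _ => 1) x) (g x) ∂μ =
        ∫ p, inner ℝ (rieszKernelH H δ (p.1 - p.2)) (g p.1) ∂(μ.prod μ) := by
      rw [integral_prod _ hi1]
      refine integral_congr_ae (Eventually.of_forall fun x => ?_)
      simp only [rieszRegH, one_smul]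
      rw [real_inner_comm, ← integral_inner (hint x)]
      simp only [real_inner_comm]
    have hB : ∫ p, inner ℝ (rieszKernelH H δ (p.1 - p.2)) (g p.2) ∂(μ.prod μ) =
        - ∫ p, inner ℝ (rieszKernelH H δ (p.1 - p.2)) (g p.1) ∂(μ.prod μ) := by
      rw [← integral_prod_swap, ← integral_neg]
      refine integral_congr_ae (Eventually.of_forall fun p => ?_)
      simp only [Prod.fst_swap, Prod.snd_swap, rieszKernelH]
      rw [← neg_sub p.1 p.2, norm_neg, map_neg, smul_neg, inner_neg_left]
    simp only [inner_sub_right]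
    rw [integral_sub hi1 hi2, hB, hA]
    ring
  refine ⟨(1 / 2) * ∫ p, inner ℝ (rieszKernelH H 0 (p.1 - p.2)) (g p.1 - g p.2) ∂(μ.prod μ), ?_⟩
  refine Tendsto.congr' (f₁ := fun δ => (1 / 2) * ∫ p, inner ℝ (rieszKernelH H δ (p.1 - p.2))
    (g p.1 - g p.2) ∂(μ.prod μ)) ?_ ?_
  · filter_upwards [self_mem_nhdsWithin] with δ hδ using (hid δ hδ).symm
  refine Tendsto.const_mul _ ?_
  refine tendsto_integral_filter_of_dominated_convergence
    (fun p => K * (‖p.1 - p.2‖ ^ e)⁻¹) ?_ ?_ ?_ ?_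
  · exact Eventually.of_forall fun δ => (((hmeas δ).comp (measurable_fst.sub measurable_snd)).inner
      ((hgm.comp measurable_fst).sub (hgm.comp measurable_snd))).aestronglyMeasurable
  · filter_upwards [self_mem_nhdsWithin] with δ hδ
    refine Eventually.of_forall fun p => ?_
    refine (norm_inner_le_norm _ _).trans ?_
    have hδ' : (0 : ℝ) < δ := hδ
    rcases eq_or_ne p.1 p.2 with h | h
    · rw [h]; simp only [sub_self, norm_zero, mul_zero]; positivity
    have hpos : 0 < ‖p.1 - p.2‖ := norm_pos_iff.2 (sub_ne_zero.2 h)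
    have hm : 0 < max δ ‖p.1 - p.2‖ := lt_max_of_lt_left hδ'
    have h1 := hbd0 δ (p.1 - p.2)
    rw [abs_of_pos (by positivity)] at h1
    have h2 : ‖g p.1 - g p.2‖ ≤ K * ‖p.1 - p.2‖ := by
      simpa [dist_eq_norm] using hg.dist_le_mul p.1 p.2
    calc _ ≤ ((max δ ‖p.1 - p.2‖ ^ (e + 1 + 1))⁻¹ * ‖p.1 - p.2‖) * (K * ‖p.1 - p.2‖) := by gcongr
      _ ≤ ((‖p.1 - p.2‖ ^ (e + 1 + 1))⁻¹ * ‖p.1 - p.2‖) * (K * ‖p.1 - p.2‖) := by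
          gcongr; exact le_max_right _ _
      _ = _ := by field_simp; ring
  · refine Integrable.const_mul ?_ _
    have hm : Measurable fun p : Sp (e + 1) × Sp (e + 1) => (‖p.1 - p.2‖ ^ e)⁻¹ := by fun_prop
    refine ⟨hm.aestronglyMeasurable, ?_⟩
    rw [hasFiniteIntegral_iff_ofReal (Eventually.of_forall fun p => by positivity)]
    obtain ⟨B, hB, hB'⟩ := hμ.exists_lintegral_le
    rw [lintegral_prod _ hm.ennreal_ofReal.aemeasurable]
    calc _ ≤ ∫⁻ _, B ∂μ := lintegral_mono hB'
      _ = B * μ Set.univ := lintegral_const _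
      _ < ⊤ := ENNReal.mul_lt_top hB.lt_top (measure_lt_top _ _)
  · refine Eventually.of_forall fun p => ?_
    refine Tendsto.inner ?_ tendsto_const_nhds
    rcases eq_or_ne p.1 p.2 with h | h
    · simp [h, rieszKernelH]
    have hpos : 0 < ‖p.1 - p.2‖ := norm_pos_iff.2 (sub_ne_zero.2 h)
    unfold rieszKernelH
    refine Tendsto.smul_const ?_ _
    have hc : ContinuousAt (fun δ : ℝ => (max δ ‖p.1 - p.2‖ ^ (e + 1 + 1))⁻¹) 0 := by
      refine ContinuousAt.inv₀ (by fun_prop) ?_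
      have : 0 < max (0 : ℝ) ‖p.1 - p.2‖ := lt_max_of_lt_right hpos
      positivity
    exact hc.tendsto.mono_left nhdsWithin_le_nhds

end

noncomputable section

/-! After rescaling, `z = 0` and `ℓ = 1`. Geometric flatness allows the part of `μ` in a large ball
of radius `ρ` to be replaced by its projection `σ` to `H ≅ ℝ^d`. At all scales between a tiny `β`
and `1` this shadow looks like a measure with density bounded above and, on a large ball, below. The
hypothesis on `R^H_μ 1` becomes: the truncated Riesz potential `rpot σ δ` is almost orthogonal in
`L²(σ)` to mean zero Lipschitz fields supported in a ball of radius `2D`, where `D` is much smaller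
than `ρ`.

In the model case `σ = p dx`, the Riesz potential is a multiple of `∇(-Δ)^{-1/2} p`. Pairing it with
the gradient of a Gaussian gives a multiple of `(-Δ)^{1/2}` of a Gaussian mollification of `p`, so
if these pairings vanish then `p` is constant. This is made explicit with Gaussians only.
Subordination writes the kernel as a superposition of Gaussians, and the pairing with a Gaussian
field becomes a half-order time derivative, `halfDeriv`, of the mollification `heatConv σ`
(`subConst_mul_integral_rieszAvg`). Abel inversion recovers the mollification from its half-order
derivative (`heatConv_eq_integral_halfDeriv`). Hence if the pairings are small for times in a long
interval, then `heatConv σ t` is nearly constant on a ball (`abs_heatConv_sub_le_of_halfDeriv`).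

The obstacle is that the Gaussian argument needs fields `h dx`, while the hypothesis concerns fields
`g dσ`, and `σ` need not have a density. Let `p_r = heatConv σ r`. If `r'` is much smaller than `r`
and `p_r`, `p_{r'}` are close in `L²`, then `h dx = (h / p_r) p_r dx ≈ (h / p_r) p_{r'} dx ≈ (h /
p_r) dσ`. The last step holds because `r'` is tiny compared with the Lipschitz constants of what is
tested. Such a pair exists among finitely many prescribed scales: the Gaussian energy is monotone in
time and bounded, and its decrements control `‖p_{r'} - p_r‖²`
(`exists_integral_heatConv_sub_sq_le`). The resulting estimate is `planar_estimate`, and the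
parameters are chosen in `exists_abs_integral_rieszAvg_le`: the ratio `ρ / D`, then `D`, the
closeness `η`, the scales, their number, and `β`. The flatness parameter comes last of all.

Finally, a Lipschitz `f` with zero integral over the plane is tested against `μ`. Projecting to `H`
costs a multiple of the flatness parameter, mollifying costs a multiple of `√t`, and what remains is
the oscillation of `heatConv σ t`. -/

/-- The model hyperplane `ℝ^d`. -/
abbrev Pl (d : ℕ) : Type := EuclideanSpace ℝ (Fin d)

/-- The Gaussian probability density on `ℝ^d` with variance parameter `τ / 2`. -/
def heat {d : ℕ} (τ : ℝ) (x : Pl d) : ℝ :=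
  (√(Real.pi * τ) ^ d)⁻¹ * Real.exp (-(‖x‖ ^ 2 / τ))

/-- The derivative of `heat τ x` with respect to `τ`. -/
def heatDot {d : ℕ} (τ : ℝ) (x : Pl d) : ℝ :=
  heat τ x * (‖x‖ ^ 2 / τ ^ 2 - d / (2 * τ))

theorem exists_pow_mul_exp_neg_le (n : ℕ) {b : ℝ} (hb : 0 < b) :
    ∃ K : ℝ, 0 < K ∧ ∀ y : ℝ, 0 ≤ y → y ^ n * Real.exp (-(b * y ^ 2)) ≤ K := by
  -- The witness comes from `y ^ n ≤ 1 + y ^ (2 * n)` and from one term of the exponential series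
  -- for `exp (b y²)`.
  refine ⟨1 + n.factorial / b ^ n, by positivity, fun y hy => ?_⟩
  have h1 : (b * y ^ 2) ^ n / n.factorial ≤ Real.exp (b * y ^ 2) :=
    Real.pow_div_factorial_le_exp _ (by positivity) n
  have h2 : y ^ n ≤ 1 + y ^ (2 * n) := by
    rcases le_total y 1 with h | h
    · have := pow_le_one₀ (n := n) hy h
      have : 0 ≤ y ^ (2 * n) := by positivity
      linarith
    · have := pow_le_pow_right₀ h (show n ≤ 2 * n by omega)
      linarith
  have h3 : y ^ (2 * n) ≤ n.factorial / b ^ n * Real.exp (b * y ^ 2) := by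
    rw [div_le_iff₀ (by positivity), mul_pow, ← pow_mul] at h1
    rw [div_mul_eq_mul_div, le_div_iff₀ (by positivity)]
    linarith
  have h4 : (1 : ℝ) ≤ Real.exp (b * y ^ 2) := Real.one_le_exp (by positivity)
  rw [Real.exp_neg, ← div_eq_mul_inv, div_le_iff₀ (Real.exp_pos _)]
  linarith

/-! ### Gaussian moments and the semigroup identities -/

section Gaussian

variable {d : ℕ}

theorem heat_pos {τ : ℝ} (hτ : 0 < τ) (x : Pl d) : 0 < heat τ x := by
  have := Real.pi_pos
  unfold heat; positivity

theorem heat_neg (τ : ℝ) (x : Pl d) : heat τ (-x) = heat τ x := by simp [heat]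

theorem heat_sub_comm (τ : ℝ) (x y : Pl d) : heat τ (x - y) = heat τ (y - x) := by
  rw [← neg_sub, heat_neg]

theorem heatDot_sub_comm (τ : ℝ) (x y : Pl d) : heatDot τ (x - y) = heatDot τ (y - x) := by
  rw [heatDot, heatDot, heat_sub_comm, norm_sub_rev]

@[fun_prop]
theorem continuous_heat (τ : ℝ) : Continuous (heat τ : Pl d → ℝ) := by
  unfold heat; fun_prop

@[fun_prop]
theorem continuous_heatDot (τ : ℝ) : Continuous (heatDot τ : Pl d → ℝ) := by
  unfold heatDot; fun_prop

theorem measurable_heat_uncurry : Measurable fun p : ℝ × Pl d => heat p.1 p.2 := by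
  unfold heat; fun_prop

theorem measurable_heatDot_uncurry : Measurable fun p : ℝ × Pl d => heatDot p.1 p.2 := by
  have := measurable_heat_uncurry (d := d)
  unfold heatDot; fun_prop

theorem pi_div_rpow {b : ℝ} (hb : 0 < b) :
    (Real.pi / b) ^ (Module.finrank ℝ (Pl d) / 2 : ℝ) = √(Real.pi / b) ^ d := by
  have := Real.pi_pos
  rw [finrank_euclideanSpace_fin, Real.sqrt_eq_rpow, ← Real.rpow_natCast, ← Real.rpow_mul
    (by positivity)]
  congr 1; ring

theorem integral_exp_neg_mul_sq_norm {b : ℝ} (hb : 0 < b) :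
    ∫ x : Pl d, Real.exp (-(b * ‖x‖ ^ 2)) = √(Real.pi / b) ^ d := by
  have h := GaussianFourier.integral_rexp_neg_mul_sq_norm (V := Pl d) hb
  rw [pi_div_rpow hb] at h
  simpa only [neg_mul] using h

theorem integrable_exp_neg_mul_sq_norm {b : ℝ} (hb : 0 < b) :
    Integrable fun x : Pl d => Real.exp (-(b * ‖x‖ ^ 2)) := by
  apply Integrable.of_integral_ne_zero
  rw [integral_exp_neg_mul_sq_norm hb]
  have := Real.pi_pos
  positivity

theorem integrable_pow_mul_exp_neg_mul_sq_norm (n : ℕ) {b : ℝ} (hb : 0 < b) :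
    Integrable fun x : Pl d => ‖x‖ ^ n * Real.exp (-(b * ‖x‖ ^ 2)) := by
  obtain ⟨K, hK, h⟩ := exists_pow_mul_exp_neg_le n (half_pos hb)
  refine ((integrable_exp_neg_mul_sq_norm (half_pos hb)).const_mul K).mono'
    (by fun_prop) (Eventually.of_forall fun x => ?_)
  rw [Real.norm_of_nonneg (by positivity)]
  calc _ = (‖x‖ ^ n * Real.exp (-(b / 2 * ‖x‖ ^ 2))) * Real.exp (-(b / 2 * ‖x‖ ^ 2)) := by
        rw [mul_assoc, ← Real.exp_add]; congr 2; ring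
    _ ≤ _ := by gcongr; exact h _ (norm_nonneg _)

theorem integrable_pow_mul_heat (n : ℕ) {τ : ℝ} (hτ : 0 < τ) :
    Integrable fun x : Pl d => ‖x‖ ^ n * heat τ x := by
  refine ((integrable_pow_mul_exp_neg_mul_sq_norm n (inv_pos.2 hτ)).const_mul
    (√(Real.pi * τ) ^ d)⁻¹).congr (Eventually.of_forall fun x => ?_)
  simp only [heat, div_eq_inv_mul]; ring

theorem integrable_heat {τ : ℝ} (hτ : 0 < τ) : Integrable (heat τ : Pl d → ℝ) := by
  simpa using integrable_pow_mul_heat (d := d) 0 hτ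

theorem integral_heat {τ : ℝ} (hτ : 0 < τ) : ∫ x : Pl d, heat τ x = 1 := by
  have h := integral_exp_neg_mul_sq_norm (d := d) (inv_pos.2 hτ)
  have := Real.pi_pos
  simp only [heat, integral_const_mul]
  simp only [← div_eq_inv_mul] at h
  rw [h, div_inv_eq_mul, inv_mul_cancel₀ (by positivity)]

/-- Both sides are, up to sign, the derivative in `b` of the Gaussian integral: the left by
differentiation under the integral, the right from the closed form. -/
theorem integral_sq_mul_exp_neg_mul_sq_norm {b : ℝ} (hb : 0 < b) :
    ∫ x : Pl d, ‖x‖ ^ 2 * Real.exp (-(b * ‖x‖ ^ 2)) = d / (2 * b) * √(Real.pi / b) ^ d := by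
  have hpi := Real.pi_pos
  have key := hasDerivAt_integral_of_dominated_loc_of_deriv_le (μ := (volume : Measure (Pl d)))
    (F := fun b x => Real.exp (-(b * ‖x‖ ^ 2)))
    (F' := fun b x => -(‖x‖ ^ 2 * Real.exp (-(b * ‖x‖ ^ 2)))) (x₀ := b)
    (bound := fun x => ‖x‖ ^ 2 * Real.exp (-(b / 2 * ‖x‖ ^ 2)))
    (s := Set.Ioi (b / 2)) (Ioi_mem_nhds (by linarith))
    (Eventually.of_forall fun b => by fun_prop) (integrable_exp_neg_mul_sq_norm hb) (by fun_prop)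
    (Eventually.of_forall fun x b' hb' => by
      rw [norm_neg, Real.norm_of_nonneg (by positivity)]
      have : b / 2 ≤ b' := le_of_lt hb'
      gcongr)
    (integrable_pow_mul_exp_neg_mul_sq_norm 2 (half_pos hb))
    (Eventually.of_forall fun x b' _ => by
      have := (((hasDerivAt_id b').mul_const (‖x‖ ^ 2)).neg).exp
      exact this.congr_deriv (by simp only [id, Pi.neg_apply]; ring))
  have h1 := key.2
  have h2 : HasDerivAt (fun b : ℝ => ∫ x : Pl d, Real.exp (-(b * ‖x‖ ^ 2)))
      (-(d / (2 * b) * √(Real.pi / b) ^ d)) b := by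
    have e : (fun b : ℝ => ∫ x : Pl d, Real.exp (-(b * ‖x‖ ^ 2))) =ᶠ[𝓝 b]
        fun b => √(Real.pi / b) ^ d := by
      filter_upwards [Ioi_mem_nhds hb] with b' hb' using integral_exp_neg_mul_sq_norm hb'
    refine HasDerivAt.congr_of_eventuallyEq ?_ e
    have h3 : HasDerivAt (fun b : ℝ => Real.pi / b) (-Real.pi / b ^ 2) b := by
      simpa [div_eq_mul_inv] using (hasDerivAt_inv hb.ne').const_mul Real.pi
    have h4 := (h3.sqrt (by positivity)).pow d
    refine h4.congr_deriv ?_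
    rcases Nat.eq_zero_or_pos d with rfl | hd
    · simp
    obtain ⟨e, rfl⟩ : ∃ e, d = e + 1 := ⟨d - 1, by omega⟩
    have hs : √(Real.pi / b) ≠ 0 := by positivity
    have hs2 : √(Real.pi / b) ^ 2 = Real.pi / b := Real.sq_sqrt (by positivity)
    simp only [Nat.add_sub_cancel]
    have : -Real.pi / b ^ 2 = -(√(Real.pi / b) ^ 2) / b := by rw [hs2]; field_simp
    rw [this, pow_succ]
    field_simp
    ring
  have h5 := h1.unique h2
  rw [integral_neg] at h5
  linarith

theorem integral_sq_mul_heat {τ : ℝ} (hτ : 0 < τ) : ∫ x : Pl d, ‖x‖ ^ 2 * heat τ x = d * τ / 2 := by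
  have h := integral_sq_mul_exp_neg_mul_sq_norm (d := d) (inv_pos.2 hτ)
  have := Real.pi_pos
  simp only [← div_eq_inv_mul] at h
  have e : ∀ x : Pl d, ‖x‖ ^ 2 * heat τ x =
      (√(Real.pi * τ) ^ d)⁻¹ * (‖x‖ ^ 2 * Real.exp (-(‖x‖ ^ 2 / τ))) := fun x => by
    simp only [heat]; ring
  simp only [e, integral_const_mul, h, div_inv_eq_mul]
  have : √(Real.pi * τ) ≠ 0 := by positivity
  field_simp

theorem integral_norm_mul_heat_le {τ : ℝ} (hτ : 0 < τ) :
    ∫ x : Pl d, ‖x‖ * heat τ x ≤ (1 + d) * √τ := by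
  have hs : 0 < √τ := by positivity
  have hs2 : √τ ^ 2 = τ := Real.sq_sqrt hτ.le
  have h1 := integrable_pow_mul_heat (d := d) 1 hτ
  have h2 := integrable_pow_mul_heat (d := d) 2 hτ
  simp only [pow_one] at h1
  calc _ ≤ ∫ x : Pl d, (√τ * heat τ x + (√τ)⁻¹ * (‖x‖ ^ 2 * heat τ x)) := by
        refine integral_mono h1 (((integrable_heat hτ).const_mul _).add (h2.const_mul _))
          fun x => ?_
        have := heat_pos hτ x
        have h3 : ‖x‖ ≤ √τ + (√τ)⁻¹ * ‖x‖ ^ 2 := by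
          rw [← sub_nonneg]
          have : √τ + (√τ)⁻¹ * ‖x‖ ^ 2 - ‖x‖ =
              (√τ)⁻¹ * ((√τ - ‖x‖ / 2) ^ 2 + 3 / 4 * ‖x‖ ^ 2) := by field_simp; ring
          rw [this]; positivity
        calc ‖x‖ * heat τ x ≤ (√τ + (√τ)⁻¹ * ‖x‖ ^ 2) * heat τ x := by gcongr
          _ = _ := by ring
    _ = √τ + (√τ)⁻¹ * (d * τ / 2) := by
        rw [integral_add ((integrable_heat hτ).const_mul _) (h2.const_mul _), integral_const_mul,
          integral_const_mul, integral_heat hτ, integral_sq_mul_heat hτ, mul_one]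
    _ = (1 + d / 2) * √τ := by
        rw [show d * τ / 2 = d * √τ ^ 2 / 2 by rw [hs2]]; field_simp
    _ ≤ _ := by
        have : (0 : ℝ) ≤ d := by positivity
        nlinarith

/-- Completing the square in `w`. Keeping the product factored pointwise, rather than only
integrated, also gives the moments of `w` against it. -/
theorem heat_mul_heat {u τ : ℝ} (hu : 0 < u) (hτ : 0 < τ) (X w : Pl d) :
    heat u w * heat τ (X - w) =
      heat (u + τ) X * heat (u * τ / (u + τ)) (w - (u / (u + τ)) • X) := by
  have hpi := Real.pi_pos
  have hc : √(Real.pi * u) * √(Real.pi * τ) =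
      √(Real.pi * (u + τ)) * √(Real.pi * (u * τ / (u + τ))) := by
    rw [← Real.sqrt_mul (by positivity), ← Real.sqrt_mul (by positivity)]
    congr 1; field_simp
  have he : -(‖w‖ ^ 2 / u) + -(‖X - w‖ ^ 2 / τ) = -(‖X‖ ^ 2 / (u + τ)) +
      -(‖w - (u / (u + τ)) • X‖ ^ 2 / (u * τ / (u + τ))) := by
    rw [norm_sub_sq_real, norm_sub_sq_real, inner_smul_right, norm_smul, real_inner_comm X w,
      Real.norm_of_nonneg (by positivity)]
    field_simp
    ring
  unfold heat
  calc _ = ((√(Real.pi * u) * √(Real.pi * τ)) ^ d)⁻¹ *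
        Real.exp (-(‖w‖ ^ 2 / u) + -(‖X - w‖ ^ 2 / τ)) := by
        rw [Real.exp_add, mul_pow, mul_inv]; ring
    _ = _ := by rw [hc, he, Real.exp_add, mul_pow, mul_inv]; ring

theorem integral_heat_mul_heat {u τ : ℝ} (hu : 0 < u) (hτ : 0 < τ) (X : Pl d) :
    ∫ w, heat u w * heat τ (X - w) = heat (u + τ) X := by
  simp only [heat_mul_heat hu hτ, integral_const_mul]
  rw [integral_sub_right_eq_self (heat (u * τ / (u + τ))), integral_heat (by positivity), mul_one]

theorem integral_inner_mul_heat {τ : ℝ} (X : Pl d) :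
    ∫ w, inner ℝ X w * heat τ w = 0 := by
  have h : ∫ w, inner ℝ X w * heat τ w = - ∫ w, inner ℝ X w * heat τ w := by
    rw [← integral_neg, ← integral_neg_eq_self]
    simp [heat_neg]
  linarith

theorem integrable_inner_mul_heat {τ : ℝ} (hτ : 0 < τ) (X : Pl d) :
    Integrable fun w => inner ℝ X w * heat τ w := by
  have h1 := integrable_pow_mul_heat (d := d) 1 hτ
  refine (h1.const_mul ‖X‖).mono' (by fun_prop) (Eventually.of_forall fun w => ?_)
  rw [norm_mul, Real.norm_of_nonneg (heat_pos hτ w).le, pow_one, ← mul_assoc]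
  have := (heat_pos hτ w).le
  gcongr
  exact norm_inner_le_norm _ _

/-- Since `heat u w • w` is `-(u / 2)` times the gradient of `heat u`, the left side is `u τ / 4`
times the Laplacian of `heat (u + τ)`, and `∂_τ heat = Δ heat / 4`. The computation centres `w` at
the mean of the product Gaussian; the term linear in the centred variable vanishes by oddness. -/
theorem integral_inner_heat_mul_heat {u τ : ℝ} (hu : 0 < u) (hτ : 0 < τ) (X : Pl d) :
    ∫ w, inner ℝ w (X - w) * (heat u w * heat τ (X - w)) = u * τ * heatDot (u + τ) X := by
  set s := u * τ / (u + τ) with hs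
  set l := u / (u + τ) with hl
  have hs0 : 0 < s := by positivity
  have e : ∀ w : Pl d, inner ℝ w (X - w) * (heat u w * heat τ (X - w)) =
      (fun w' => heat (u + τ) X * ((l * (1 - l) * ‖X‖ ^ 2) * heat s w' +
        (1 - 2 * l) * (inner ℝ X w' * heat s w') - ‖w'‖ ^ 2 * heat s w')) (w - l • X) := by
    intro w
    rw [heat_mul_heat hu hτ]
    generalize hw : w - l • X = w'
    have : w = w' + l • X := by rw [← hw]; abel
    subst this
    have : inner ℝ (w' + l • X) (X - (w' + l • X)) = l * (1 - l) * ‖X‖ ^ 2 +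
        (1 - 2 * l) * inner ℝ X w' - ‖w'‖ ^ 2 := by
      simp only [inner_add_left, inner_sub_right, inner_add_right, real_inner_smul_left,
        real_inner_smul_right, real_inner_self_eq_norm_sq, real_inner_comm X w', norm_smul,
        mul_pow, Real.norm_eq_abs, sq_abs]
      ring
    rw [this]; ring
  simp only [e]
  rw [integral_sub_right_eq_self (fun w' => heat (u + τ) X * ((l * (1 - l) * ‖X‖ ^ 2) * heat s w' +
        (1 - 2 * l) * (inner ℝ X w' * heat s w') - ‖w'‖ ^ 2 * heat s w')), integral_const_mul,
    integral_sub, integral_add, integral_const_mul, integral_const_mul, integral_heat hs0,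
    integral_inner_mul_heat, integral_sq_mul_heat hs0, heatDot]
  · rw [hs, hl]; field_simp; ring
  · exact (integrable_heat hs0).const_mul _
  · exact (integrable_inner_mul_heat hs0 X).const_mul _
  · exact ((integrable_heat hs0).const_mul _).add ((integrable_inner_mul_heat hs0 X).const_mul _)
  · exact integrable_pow_mul_heat 2 hs0

theorem hasDerivAt_heat {τ : ℝ} (hτ : 0 < τ) (x : Pl d) :
    HasDerivAt (fun s => heat s x) (heatDot τ x) τ := by
  have hpi := Real.pi_pos
  have h1 : HasDerivAt (fun s : ℝ => √(Real.pi * s)) (Real.pi / (2 * √(Real.pi * τ))) τ := by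
    have := ((hasDerivAt_id τ).const_mul Real.pi).sqrt (by simp; positivity)
    simpa using this
  have hs : √(Real.pi * τ) ≠ 0 := by positivity
  have h2 := (h1.pow d).inv (pow_ne_zero d hs)
  have h3 : HasDerivAt (fun s : ℝ => Real.exp (-(‖x‖ ^ 2 / s)))
      (Real.exp (-(‖x‖ ^ 2 / τ)) * (‖x‖ ^ 2 / τ ^ 2)) τ := by
    have := (((hasDerivAt_inv hτ.ne').const_mul (‖x‖ ^ 2)).neg).exp
    exact this.congr_deriv (by simp only [Pi.neg_apply, div_eq_mul_inv]; ring)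
  have h4 := h2.mul h3
  have hs2 : √(Real.pi * τ) ^ 2 = Real.pi * τ := Real.sq_sqrt (by positivity)
  refine h4.congr_deriv ?_
  rcases Nat.eq_zero_or_pos d with rfl | hd
  · simp [heatDot, heat]
  obtain ⟨e, rfl⟩ : ∃ e, d = e + 1 := ⟨d - 1, by omega⟩
  simp only [heatDot, heat, Nat.add_sub_cancel, Pi.pow_apply, Pi.inv_apply]
  have : Real.pi / (2 * √(Real.pi * τ)) = √(Real.pi * τ) / (2 * τ) := by
    field_simp; rw [hs2]
  rw [this]
  push_cast
  field_simp
  ring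

end Gaussian

/-! ### Size and Lipschitz bounds for Gaussian kernels -/

section HeatBounds

variable {d : ℕ}

/-- The mean value theorem, with the derivative bounded by its Gaussian majorant at the smaller
endpoint; adding the value at the other endpoint makes the bound symmetric. Half of the Gaussian
exponent is kept in reserve, so polynomial factors can be absorbed at the price of passing from time
`τ` to `2 * τ`. -/
theorem abs_sub_le_of_gaussian_deriv {Φ Φ' : ℝ → ℝ} {K : ℝ} (hΦ : ∀ s, HasDerivAt Φ (Φ' s) s)
    (hK : ∀ s, 0 ≤ s → |Φ' s| ≤ K * Real.exp (-(s ^ 2 / 2))) {p q : ℝ} (hp : 0 ≤ p) (hq : 0 ≤ q) :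
    |Φ p - Φ q| ≤ K * |p - q| * (Real.exp (-(p ^ 2 / 2)) + Real.exp (-(q ^ 2 / 2))) := by
  have hK0 : 0 ≤ K := by
    have := (abs_nonneg _).trans (hK 0 le_rfl)
    simpa using this
  wlog hpq : p ≤ q generalizing p q
  · have := this hq hp (le_of_not_ge hpq)
    rw [abs_sub_comm, abs_sub_comm q p, add_comm] at this
    exact this
  have h := Convex.norm_image_sub_le_of_norm_hasDerivWithin_le (f := Φ) (f' := Φ')
    (C := K * Real.exp (-(p ^ 2 / 2))) (s := Set.Icc p q) (x := q) (y := p)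
    (fun x _ => (hΦ x).hasDerivWithinAt) (fun x hx => ?_) (convex_Icc p q)
    (Set.right_mem_Icc.2 hpq) (Set.left_mem_Icc.2 hpq)
  · rw [Real.norm_eq_abs, Real.norm_eq_abs] at h
    refine h.trans ?_
    have := Real.exp_pos (-(q ^ 2 / 2))
    rw [mul_right_comm]
    gcongr
    linarith
  · have hx1 := hx.1
    have hx0 : 0 ≤ x := hp.trans hx1
    refine (hK x hx0).trans ?_
    gcongr

theorem exp_half_eq_heat {τ : ℝ} (hτ : 0 < τ) (x : Pl d) :
    (√(Real.pi * τ) ^ d)⁻¹ * Real.exp (-((‖x‖ / √τ) ^ 2 / 2)) = √2 ^ d * heat (2 * τ) x := by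
  have hpi := Real.pi_pos
  rw [heat, show Real.pi * (2 * τ) = 2 * (Real.pi * τ) by ring, Real.sqrt_mul zero_le_two,
    mul_pow, div_pow, Real.sq_sqrt hτ.le, div_div, mul_comm τ 2]
  have : √2 ^ d ≠ 0 := by positivity
  rw [mul_inv, ← mul_assoc, ← mul_assoc, mul_inv_cancel₀ this, one_mul]

theorem abs_norm_div_sub_le {τ : ℝ} (x y : Pl d) :
    |‖x‖ / √τ - ‖y‖ / √τ| ≤ ‖x - y‖ / √τ := by
  rw [← sub_div, abs_div, abs_of_nonneg (Real.sqrt_nonneg τ)]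
  have := abs_norm_sub_norm_le x y
  gcongr

theorem heat_eq_profile {τ : ℝ} (hτ : 0 < τ) (x : Pl d) :
    heat τ x = (√(Real.pi * τ) ^ d)⁻¹ * Real.exp (-(‖x‖ / √τ) ^ 2) := by
  rw [heat, div_pow, Real.sq_sqrt hτ.le]

theorem heatDot_eq_profile {τ : ℝ} (hτ : 0 < τ) (x : Pl d) :
    heatDot τ x = (√(Real.pi * τ) ^ d)⁻¹ * τ⁻¹ *
      (((‖x‖ / √τ) ^ 2 - d / 2) * Real.exp (-(‖x‖ / √τ) ^ 2)) := by
  rw [heatDot, heat_eq_profile hτ, div_pow, Real.sq_sqrt hτ.le]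
  field_simp

theorem exists_abs_heat_sub_le (d : ℕ) : ∃ K : ℝ, 0 < K ∧ ∀ (τ : ℝ), 0 < τ → ∀ x y : Pl d,
    |heat τ x - heat τ y| ≤ K / √τ * ‖x - y‖ * (heat (2 * τ) x + heat (2 * τ) y) := by
  obtain ⟨K, hK, h⟩ := exists_pow_mul_exp_neg_le 1 (show (0 : ℝ) < 1 / 2 by norm_num)
  refine ⟨2 * K * √2 ^ d, by positivity, fun τ hτ x y => ?_⟩
  have hpi := Real.pi_pos
  have hΦ : ∀ s : ℝ, HasDerivAt (fun s : ℝ => Real.exp (-s ^ 2)) (Real.exp (-s ^ 2) * (-(2 * s))) s :=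
    fun s => by
      have := ((hasDerivAt_pow 2 s).neg).exp
      simpa using this
  have key := abs_sub_le_of_gaussian_deriv (K := 2 * K) hΦ (fun s hs => by
    have h1 := h s hs
    rw [abs_mul, abs_neg, abs_of_nonneg (by positivity : 0 ≤ 2 * s), abs_of_pos (Real.exp_pos _)]
    calc _ = 2 * (s ^ 1 * Real.exp (-(1 / 2 * s ^ 2))) * Real.exp (-(s ^ 2 / 2)) := by
          rw [show -s ^ 2 = -(1 / 2 * s ^ 2) + -(s ^ 2 / 2) by ring, Real.exp_add]; ring
      _ ≤ _ := by gcongr) (p := ‖x‖ / √τ) (q := ‖y‖ / √τ) (by positivity) (by positivity)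
  rw [heat_eq_profile hτ, heat_eq_profile hτ, ← mul_sub, abs_mul, abs_of_nonneg (by positivity)]
  calc _ ≤ (√(Real.pi * τ) ^ d)⁻¹ * (2 * K * (‖x - y‖ / √τ) *
        (Real.exp (-((‖x‖ / √τ) ^ 2 / 2)) + Real.exp (-((‖y‖ / √τ) ^ 2 / 2)))) := by
        gcongr
        refine key.trans ?_
        gcongr
        exact abs_norm_div_sub_le x y
    _ = 2 * K * (‖x - y‖ / √τ) * ((√(Real.pi * τ) ^ d)⁻¹ * Real.exp (-((‖x‖ / √τ) ^ 2 / 2)) +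
          (√(Real.pi * τ) ^ d)⁻¹ * Real.exp (-((‖y‖ / √τ) ^ 2 / 2))) := by ring
    _ = _ := by rw [exp_half_eq_heat hτ, exp_half_eq_heat hτ]; ring

theorem exists_abs_heatDot_sub_le (d : ℕ) : ∃ K : ℝ, 0 < K ∧ ∀ (τ : ℝ), 0 < τ → ∀ x y : Pl d,
    |heatDot τ x - heatDot τ y| ≤
      K / (τ * √τ) * ‖x - y‖ * (heat (2 * τ) x + heat (2 * τ) y) := by
  obtain ⟨K, hK, h⟩ := exists_pow_mul_exp_neg_le 1 (show (0 : ℝ) < 1 / 2 by norm_num)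
  obtain ⟨K3, hK3, h3⟩ := exists_pow_mul_exp_neg_le 3 (show (0 : ℝ) < 1 / 2 by norm_num)
  refine ⟨((2 + d) * K + 2 * K3) * √2 ^ d, by positivity, fun τ hτ x y => ?_⟩
  have hpi := Real.pi_pos
  have hΦ : ∀ s : ℝ, HasDerivAt (fun s : ℝ => (s ^ 2 - d / 2) * Real.exp (-s ^ 2))
      (((2 + d) * s - 2 * s ^ 3) * Real.exp (-s ^ 2)) s := fun s => by
    have h1 : HasDerivAt (fun s : ℝ => Real.exp (-s ^ 2)) (Real.exp (-s ^ 2) * (-(2 * s))) s := by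
      have := ((hasDerivAt_pow 2 s).neg).exp
      simpa using this
    have h2 : HasDerivAt (fun s : ℝ => s ^ 2 - (d : ℝ) / 2) (2 * s) s := by
      simpa using (hasDerivAt_pow 2 s).sub_const ((d : ℝ) / 2)
    exact (h2.mul h1).congr_deriv (by ring)
  have key := abs_sub_le_of_gaussian_deriv (K := (2 + d) * K + 2 * K3) hΦ (fun s hs => by
    have h1 := h s hs
    have h2 := h3 s hs
    rw [abs_mul, abs_of_pos (Real.exp_pos _)]
    calc _ ≤ ((2 + d) * s + 2 * s ^ 3) * Real.exp (-s ^ 2) := by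
          gcongr
          refine (abs_sub _ _).trans (le_of_eq ?_)
          rw [abs_of_nonneg (by positivity), abs_of_nonneg (by positivity)]
      _ = ((2 + d) * (s ^ 1 * Real.exp (-(1 / 2 * s ^ 2))) +
            2 * (s ^ 3 * Real.exp (-(1 / 2 * s ^ 2)))) * Real.exp (-(s ^ 2 / 2)) := by
          rw [show -s ^ 2 = -(1 / 2 * s ^ 2) + -(s ^ 2 / 2) by ring, Real.exp_add]; ring
      _ ≤ _ := by gcongr) (p := ‖x‖ / √τ) (q := ‖y‖ / √τ) (by positivity) (by positivity)
  set K' := (2 + d) * K + 2 * K3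
  have hK' : 0 < K' := by positivity
  rw [heatDot_eq_profile hτ, heatDot_eq_profile hτ, ← mul_sub, abs_mul,
    abs_of_nonneg (by positivity)]
  calc _ ≤ (√(Real.pi * τ) ^ d)⁻¹ * τ⁻¹ * (K' * (‖x - y‖ / √τ) *
        (Real.exp (-((‖x‖ / √τ) ^ 2 / 2)) + Real.exp (-((‖y‖ / √τ) ^ 2 / 2)))) := by
        gcongr
        refine key.trans ?_
        gcongr
        exact abs_norm_div_sub_le x y
    _ = K' * τ⁻¹ * (‖x - y‖ / √τ) * ((√(Real.pi * τ) ^ d)⁻¹ * Real.exp (-((‖x‖ / √τ) ^ 2 / 2)) +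
          (√(Real.pi * τ) ^ d)⁻¹ * Real.exp (-((‖y‖ / √τ) ^ 2 / 2))) := by ring
    _ = _ := by rw [exp_half_eq_heat hτ, exp_half_eq_heat hτ]; field_simp

theorem heat_le {τ : ℝ} (hτ : 0 < τ) (x : Pl d) : heat τ x ≤ (√(Real.pi * τ) ^ d)⁻¹ := by
  have hpi := Real.pi_pos
  refine mul_le_of_le_one_right (by positivity) (Real.exp_le_one_iff.2 ?_)
  rw [neg_nonpos]; positivity

theorem exists_abs_heatDot_le (d : ℕ) : ∃ K : ℝ, 0 < K ∧ ∀ (τ : ℝ), 0 < τ → ∀ x : Pl d,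
    |heatDot τ x| ≤ K * τ⁻¹ * (√τ ^ d)⁻¹ := by
  obtain ⟨K, hK, h⟩ := exists_pow_mul_exp_neg_le 2 (show (0 : ℝ) < 1 by norm_num)
  have hpi := Real.pi_pos
  refine ⟨(√Real.pi ^ d)⁻¹ * (K + d / 2), by positivity, fun τ hτ x => ?_⟩
  rw [heatDot_eq_profile hτ, abs_mul, abs_of_nonneg (by positivity)]
  have h1 : |((‖x‖ / √τ) ^ 2 - d / 2) * Real.exp (-(‖x‖ / √τ) ^ 2)| ≤ K + d / 2 := by
    generalize hs : ‖x‖ / √τ = s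
    have hs0 : 0 ≤ s := by rw [← hs]; positivity
    rw [abs_mul, abs_of_pos (Real.exp_pos _)]
    calc _ ≤ (s ^ 2 + d / 2) * Real.exp (-s ^ 2) := by
          gcongr
          refine (abs_sub _ _).trans (le_of_eq ?_)
          rw [abs_of_nonneg (by positivity), abs_of_nonneg (by positivity)]
      _ = s ^ 2 * Real.exp (-(1 * s ^ 2)) + d / 2 * Real.exp (-s ^ 2) := by rw [one_mul]; ring
      _ ≤ K + d / 2 * 1 := by
          gcongr
          · exact h s hs0
          · exact Real.exp_le_one_iff.2 (by rw [neg_nonpos]; positivity)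
      _ = _ := by ring
  calc _ ≤ (√(Real.pi * τ) ^ d)⁻¹ * τ⁻¹ * (K + d / 2) := by gcongr
    _ = _ := by rw [Real.sqrt_mul hpi.le, mul_pow, mul_inv]; ring

end HeatBounds

/-! ### Mollification of measures with bounded density at a fixed scale -/

section Transfer

variable {d : ℕ} {σ : Measure (Pl d)}

theorem volume_ball_eq {r : ℝ} (hr : 0 < r) (x : Pl d) :
    volume (ball x r) = ENNReal.ofReal (r ^ d) * volume (ball (0 : Pl d) 1) := by
  rw [Measure.addHaar_ball_of_pos _ _ hr, finrank_euclideanSpace_fin]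

/-- The volume of the unit ball of `ℝ^d`. -/
def unitVol (d : ℕ) : ℝ := (volume (ball (0 : Pl d) 1)).toReal

theorem unitVol_pos (d : ℕ) : 0 < unitVol d :=
  ENNReal.toReal_pos (measure_ball_pos _ _ one_pos).ne' measure_ball_lt_top.ne

theorem volume_ball_eq_ofReal {r : ℝ} (hr : 0 < r) (x : Pl d) :
    volume (ball x r) = ENNReal.ofReal (r ^ d * unitVol d) := by
  rw [volume_ball_eq hr, ENNReal.ofReal_mul (by positivity), unitVol,
    ENNReal.ofReal_toReal measure_ball_lt_top.ne]

/-- Average `f y` over the ball of radius `r` about `y`, replace `f y` by `f₁ w` there, and exchange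
the integrals: the inner integral becomes `σ (ball w r)`. -/
theorem lintegral_le_of_measure_ball_le [SFinite σ] {r M : ℝ} (hr : 0 < r)
    (hσ : ∀ w, σ (ball w r) ≤ ENNReal.ofReal M) {f f₁ : Pl d → ENNReal} (hf₁ : Measurable f₁)
    (h : ∀ y w, dist y w < r → f y ≤ f₁ w) :
    ENNReal.ofReal (r ^ d * unitVol d) * ∫⁻ y, f y ∂σ ≤ ENNReal.ofReal M * ∫⁻ w, f₁ w := by
  have hm : MeasurableSet {p : Pl d × Pl d | dist p.1 p.2 < r} :=
    measurableSet_lt (by fun_prop) measurable_const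
  have hm2 : Measurable fun p : Pl d × Pl d =>
      {p : Pl d × Pl d | dist p.1 p.2 < r}.indicator (fun p => f₁ p.2) p :=
    (hf₁.comp measurable_snd).indicator hm
  calc _ = ∫⁻ y, ENNReal.ofReal (r ^ d * unitVol d) * f y ∂σ := by
        rw [lintegral_const_mul' _ _ ENNReal.ofReal_ne_top]
    _ ≤ ∫⁻ y, (∫⁻ w, {p : Pl d × Pl d | dist p.1 p.2 < r}.indicator (fun p => f₁ p.2) (y, w)) ∂σ := by
        refine lintegral_mono fun y => ?_
        calc _ = ∫⁻ w in ball y r, f y := by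
              rw [setLIntegral_const, volume_ball_eq_ofReal hr, mul_comm]
          _ ≤ ∫⁻ w in ball y r, f₁ w := by
              refine setLIntegral_mono hf₁ fun w hw => h y w ?_
              rw [dist_comm]; exact hw
          _ = ∫⁻ w, (ball y r).indicator f₁ w := (lintegral_indicator measurableSet_ball _).symm
          _ = _ := by
              refine lintegral_congr fun w => ?_
              simp only [Set.indicator, mem_ball, Set.mem_ofPred_eq, dist_comm]
    _ = ∫⁻ w, ∫⁻ y, {p : Pl d × Pl d | dist p.1 p.2 < r}.indicator (fun p => f₁ p.2) (y, w) ∂σ :=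
        lintegral_lintegral_swap hm2.aemeasurable
    _ = ∫⁻ w, f₁ w * σ (ball w r) := by
        refine lintegral_congr fun w => ?_
        rw [← lintegral_indicator_const measurableSet_ball]
        refine lintegral_congr fun y => ?_
        simp only [Set.indicator, mem_ball, Set.mem_ofPred_eq]
    _ ≤ ∫⁻ w, ENNReal.ofReal M * f₁ w := by
        refine lintegral_mono fun w => ?_
        rw [mul_comm]
        gcongr
        exact hσ w
    _ = _ := lintegral_const_mul _ hf₁

theorem integral_le_of_measure_ball_le [SFinite σ] {r M : ℝ} (hr : 0 < r) (hM : 0 ≤ M)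
    (hσ : ∀ w, σ (ball w r) ≤ ENNReal.ofReal M) {f f₁ : Pl d → ℝ}
    (hf : Measurable f) (hf0 : ∀ y, 0 ≤ f y) (hf₁ : Measurable f₁) (hi : Integrable f₁)
    (h : ∀ y w, dist y w < r → f y ≤ f₁ w) :
    Integrable f σ ∧ ∫ y, f y ∂σ ≤ M / (r ^ d * unitVol d) * ∫ w, f₁ w := by
  have hv := unitVol_pos d
  have hf₁0 : ∀ w, 0 ≤ f₁ w := fun w => (hf0 w).trans (h w w (by simpa using hr))
  have key := lintegral_le_of_measure_ball_le hr hσ hf₁.ennreal_ofReal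
    (fun y w hyw => ENNReal.ofReal_le_ofReal (h y w hyw))
  rw [← ofReal_integral_eq_lintegral_ofReal hi (Eventually.of_forall hf₁0),
    ← ENNReal.ofReal_mul hM] at key
  have hfin : ∫⁻ y, ENNReal.ofReal (f y) ∂σ ≠ ⊤ := by
    intro htop
    rw [htop, ENNReal.mul_top (by simpa using by positivity)] at key
    exact ENNReal.ofReal_ne_top (top_le_iff.1 key)
  have hint : Integrable f σ := by
    refine ⟨hf.aestronglyMeasurable, ?_⟩
    rw [hasFiniteIntegral_iff_ofReal (Eventually.of_forall hf0)]
    exact hfin.lt_top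
  refine ⟨hint, ?_⟩
  rw [← ofReal_integral_eq_lintegral_ofReal hint (Eventually.of_forall hf0),
    ← ENNReal.ofReal_mul (by positivity)] at key
  have h0 : 0 ≤ M * ∫ w, f₁ w := mul_nonneg hM (integral_nonneg hf₁0)
  have := (ENNReal.ofReal_le_ofReal_iff h0).1 key
  rw [div_mul_eq_mul_div, le_div_iff₀ (by positivity)]
  linarith

/-- The convolution of the measure `σ` with a Gaussian. -/
def heatConv (σ : Measure (Pl d)) (τ : ℝ) (x : Pl d) : ℝ := ∫ y, heat τ (x - y) ∂σ

/-- The constant that bounds Gaussian averages of measures with bounded density at their scale. -/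
def heatBd (d : ℕ) : ℝ := Real.exp 1 * √2 ^ d / unitVol d

theorem heatBd_pos (d : ℕ) : 0 < heatBd d := by
  have := unitVol_pos d
  unfold heatBd; positivity

/-- Moving the centre by `√τ` is harmless after doubling the time, because `(a + 1)² / 2 ≤ a² + 1`.
-/
theorem heat_le_exp_mul_heat {τ : ℝ} (hτ : 0 < τ) {x y w : Pl d} (h : dist y w < √τ) :
    heat τ (x - y) ≤ Real.exp 1 * √2 ^ d * heat (2 * τ) (x - w) := by
  have hpi := Real.pi_pos
  rw [heat_eq_profile hτ, mul_assoc, ← exp_half_eq_heat hτ, mul_left_comm, ← Real.exp_add]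
  gcongr
  have hs : 0 < √τ := by positivity
  have h1 : ‖x - w‖ ≤ ‖x - y‖ + √τ := by
    rw [dist_eq_norm] at h
    calc ‖x - w‖ = ‖(x - y) + (y - w)‖ := by congr 1; abel
      _ ≤ _ := (norm_add_le _ _).trans (by gcongr)
  have h2 : ‖x - w‖ / √τ ≤ ‖x - y‖ / √τ + 1 := by
    rw [← div_self hs.ne', ← add_div]; gcongr
  have h3 : 0 ≤ ‖x - w‖ / √τ := by positivity
  nlinarith [sq_nonneg (‖x - y‖ / √τ - 1)]

theorem heatConv_nonneg {τ : ℝ} (hτ : 0 < τ) (x : Pl d) : 0 ≤ heatConv σ τ x :=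
  integral_nonneg fun _ => (heat_pos hτ _).le

variable [IsFiniteMeasure σ]

theorem integrable_heat_sub {τ : ℝ} (hτ : 0 < τ) (x : Pl d) :
    Integrable (fun y => heat τ (x - y)) σ := by
  refine Integrable.of_bound (by fun_prop) (√(Real.pi * τ) ^ d)⁻¹ (Eventually.of_forall fun y => ?_)
  rw [Real.norm_of_nonneg (heat_pos hτ _).le]
  exact heat_le hτ _

theorem heatConv_le {τ C₁ : ℝ} (hτ : 0 < τ) (hC : 0 ≤ C₁)
    (hσ : ∀ w, σ (ball w √τ) ≤ ENNReal.ofReal (C₁ * √τ ^ d)) (x : Pl d) :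
    heatConv σ τ x ≤ C₁ * heatBd d := by
  have hs : 0 < √τ := by positivity
  have hv := unitVol_pos d
  have h2 : (0 : ℝ) < 2 * τ := by positivity
  have hi : Integrable fun w : Pl d => heat (2 * τ) (x - w) :=
    (integrable_heat h2).comp_sub_left x
  have := (integral_le_of_measure_ball_le hs (by positivity) hσ
    (f := fun y => heat τ (x - y)) (f₁ := fun w => Real.exp 1 * √2 ^ d * heat (2 * τ) (x - w))
    (by fun_prop) (fun y => (heat_pos hτ _).le) (by fun_prop) (hi.const_mul _)
    (fun y w h => heat_le_exp_mul_heat hτ h)).2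
  refine this.trans (le_of_eq ?_)
  rw [integral_const_mul, integral_sub_left_eq_self (heat (2 * τ)), integral_heat h2, heatBd]
  field_simp

theorem le_heatConv {τ c₁ : ℝ} (hτ : 0 < τ) (hc : 0 ≤ c₁) {x : Pl d}
    (hσ : ENNReal.ofReal (c₁ * √τ ^ d) ≤ σ (ball x √τ)) :
    c₁ * (Real.exp (-1) / √Real.pi ^ d) ≤ heatConv σ τ x := by
  have hs : 0 < √τ := by positivity
  have hpi := Real.pi_pos
  -- The kernel is at least `e⁻¹` times its maximum on the ball of radius `√τ`. The quotient, which
  -- is at most `1`, normalizes the minorant so that its integral is exactly the claimed bound; if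
  -- the ball is null, then `c₁ = 0`.
  calc _ = ∫ y, (√(Real.pi * τ) ^ d)⁻¹ * Real.exp (-1) * (c₁ * √τ ^ d / σ.real (ball x √τ)) *
        (ball x √τ).indicator 1 y ∂σ := by
        rw [integral_const_mul, integral_indicator_one measurableSet_ball]
        rcases eq_or_ne (σ.real (ball x √τ)) 0 with h0 | h0
        · have h3 : c₁ * √τ ^ d ≤ 0 := by
            rw [measureReal_def, ENNReal.toReal_eq_zero_iff] at h0
            simpa [h0.resolve_right (measure_ne_top _ _)] using hσ
          have h4 : c₁ = 0 := le_antisymm (by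
            by_contra hcon
            push Not at hcon
            have : 0 < c₁ * √τ ^ d := by positivity
            linarith) hc
          simp [h4]
        · rw [Real.sqrt_mul hpi.le, mul_pow]
          field_simp
    _ ≤ _ := by
        refine integral_mono ?_ (integrable_heat_sub hτ x) fun y => ?_
        · refine Integrable.const_mul ?_ _
          exact (integrable_const (1 : ℝ)).indicator measurableSet_ball
        · by_cases hy : y ∈ ball x √τ
          · simp only [Set.indicator_of_mem hy, Pi.one_apply, mul_one]
            have h1 : c₁ * √τ ^ d / σ.real (ball x √τ) ≤ 1 := by
              apply div_le_one_of_le₀ _ measureReal_nonneg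
              rw [measureReal_def]
              exact (ENNReal.ofReal_le_iff_le_toReal (measure_ne_top _ _)).1 hσ
            calc _ ≤ (√(Real.pi * τ) ^ d)⁻¹ * Real.exp (-1) * 1 := by gcongr
              _ ≤ heat τ (x - y) := by
                rw [mul_one, heat]
                gcongr
                apply div_le_one_of_le₀ _ hτ.le
                rw [mem_ball', dist_eq_norm] at hy
                calc ‖x - y‖ ^ 2 ≤ √τ ^ 2 := by gcongr
                  _ = τ := Real.sq_sqrt hτ.le
          · simp only [Set.indicator_of_notMem hy, mul_zero]
            exact (heat_pos hτ _).le

theorem exists_lipschitz_heat (d : ℕ) {τ : ℝ} (hτ : 0 < τ) : ∃ K : ℝ, 0 < K ∧ ∀ x y : Pl d,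
    |heat τ x - heat τ y| ≤ K * ‖x - y‖ := by
  obtain ⟨K, hK, h⟩ := exists_abs_heat_sub_le d
  have hpi := Real.pi_pos
  refine ⟨K / √τ * (2 * (√(Real.pi * (2 * τ)) ^ d)⁻¹), by positivity, fun x y => ?_⟩
  refine (h τ hτ x y).trans ?_
  have h2 : (0 : ℝ) < 2 * τ := by positivity
  rw [mul_right_comm]
  gcongr
  linarith [heat_le h2 x, heat_le h2 y]

theorem abs_heatConv_sub_le {τ K : ℝ} (hτ : 0 < τ)
    (hK : ∀ x y : Pl d, |heat τ x - heat τ y| ≤ K * ‖x - y‖) (x y : Pl d) :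
    |heatConv σ τ x - heatConv σ τ y| ≤ K * σ.real Set.univ * ‖x - y‖ := by
  rw [heatConv, heatConv, ← integral_sub (integrable_heat_sub hτ x) (integrable_heat_sub hτ y)]
  have := norm_integral_le_of_norm_le_const (μ := σ) (C := K * ‖x - y‖)
    (f := fun w => heat τ (x - w) - heat τ (y - w)) (Eventually.of_forall fun w => by
      have := hK (x - w) (y - w)
      simpa using this)
  rw [Real.norm_eq_abs] at this
  linarith

theorem integrable_prod_heat {τ : ℝ} (hτ : 0 < τ) :
    Integrable (fun p : Pl d × Pl d => heat τ (p.1 - p.2)) (volume.prod σ) := by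
  have hm : AEStronglyMeasurable (fun p : Pl d × Pl d => heat τ (p.1 - p.2)) (volume.prod σ) :=
    (Continuous.measurable (by fun_prop)).aestronglyMeasurable
  rw [integrable_prod_iff' hm]
  refine ⟨Eventually.of_forall fun y => (integrable_heat hτ).comp_sub_right y, ?_⟩
  have e : ∀ y : Pl d, ∫ x, ‖heat τ (x - y)‖ = 1 := fun y => by
    simp only [Real.norm_of_nonneg (heat_pos hτ _).le]
    rw [integral_sub_right_eq_self (heat τ), integral_heat hτ]
  simp only [e]
  exact integrable_const _

theorem integrable_heatConv {τ : ℝ} (hτ : 0 < τ) : Integrable (heatConv σ τ) :=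
  (integrable_prod_heat hτ).integral_prod_left

theorem continuous_heatConv {τ : ℝ} (hτ : 0 < τ) : Continuous (heatConv σ τ) := by
  obtain ⟨K, hK, h⟩ := exists_lipschitz_heat d hτ
  refine (LipschitzWith.of_dist_le_mul (K := Real.toNNReal (K * σ.real Set.univ))
    fun x y => ?_).continuous
  rw [Real.coe_toNNReal _ (by positivity), dist_eq_norm, dist_eq_norm]
  exact abs_heatConv_sub_le hτ h x y

/-- Testing against a mollified measure is the same as testing the mollified function. -/
theorem integral_heatConv_smul {F : Type*} [NormedAddCommGroup F] [NormedSpace ℝ F]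
    [CompleteSpace F] {τ : ℝ}
    (hτ : 0 < τ) {q : Pl d → F} (hq : AEStronglyMeasurable q volume) {B : ℝ}
    (hB : ∀ x, ‖q x‖ ≤ B) :
    ∫ x, heatConv σ τ x • q x = ∫ y, (∫ x, heat τ (x - y) • q x) ∂σ := by
  have hi : Integrable (fun p : Pl d × Pl d => heat τ (p.1 - p.2) • q p.1) (volume.prod σ) := by
    refine ((integrable_prod_heat hτ).mul_const B).mono'
      ((integrable_prod_heat hτ).aestronglyMeasurable.smul hq.comp_fst)
      (Eventually.of_forall fun p => ?_)
    rw [norm_smul, Real.norm_of_nonneg (heat_pos hτ _).le]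
    have := (heat_pos hτ (p.1 - p.2)).le
    gcongr
    exact hB _
  rw [← integral_integral_swap hi]
  refine integral_congr_ae (Eventually.of_forall fun x => ?_)
  simp only [heatConv]
  rw [integral_smul_const]

/-- Moving the mollification onto `q` changes `q` at each point by at most its Lipschitz constant
times the first moment of the Gaussian. -/
theorem norm_integral_heatConv_smul_sub_le {F : Type*} [NormedAddCommGroup F] [NormedSpace ℝ F]
    [CompleteSpace F] {τ : ℝ} (hτ : 0 < τ) {q : Pl d → F} {B L : ℝ} (hL : 0 ≤ L)
    (hqc : Continuous q) (hB : ∀ x, ‖q x‖ ≤ B) (hq : ∀ x y, ‖q x - q y‖ ≤ L * ‖x - y‖)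
    (hqσ : Integrable q σ) :
    ‖(∫ x, heatConv σ τ x • q x) - ∫ y, q y ∂σ‖ ≤ L * ((1 + d) * √τ) * σ.real Set.univ := by
  have hqm : AEStronglyMeasurable q volume := hqc.aestronglyMeasurable
  have hh : ∀ y : Pl d, Integrable fun x => heat τ (x - y) := fun y =>
    (integrable_heat hτ).comp_sub_right y
  have hi : ∀ y : Pl d, Integrable fun x => heat τ (x - y) • q x := fun y => by
    refine ((hh y).mul_const B).mono' ((hh y).aestronglyMeasurable.smul hqm)
      (Eventually.of_forall fun x => ?_)
    rw [norm_smul, Real.norm_of_nonneg (heat_pos hτ _).le]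
    have := (heat_pos hτ (x - y)).le
    gcongr
    exact hB _
  have hpt : ∀ y, ‖(∫ x, heat τ (x - y) • q x) - q y‖ ≤ L * ((1 + d) * √τ) := by
    intro y
    have e : q y = ∫ x, heat τ (x - y) • q y := by
      rw [integral_smul_const, integral_sub_right_eq_self (heat τ), integral_heat hτ, one_smul]
    rw [e, ← integral_sub (hi y) ((hh y).smul_const _)]
    have h1 := integrable_pow_mul_heat (d := d) 1 hτ
    simp only [pow_one] at h1
    calc _ ≤ ∫ x, L * (‖x - y‖ * heat τ (x - y)) := by
          refine norm_integral_le_of_norm_le ((h1.comp_sub_right y).const_mul L)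
            (Eventually.of_forall fun x => ?_)
          rw [← smul_sub, norm_smul, Real.norm_of_nonneg (heat_pos hτ _).le, ← mul_assoc, mul_comm]
          have := (heat_pos hτ (x - y)).le
          gcongr
          exact hq x y
      _ = L * ∫ x, ‖x‖ * heat τ x := by
          rw [integral_const_mul, integral_sub_right_eq_self (fun x : Pl d => ‖x‖ * heat τ x)]
      _ ≤ _ := by gcongr; exact integral_norm_mul_heat_le hτ
  rw [integral_heatConv_smul hτ hqm hB]
  have hint : Integrable (fun y => ∫ x, heat τ (x - y) • q x) σ := by
    have hi' : Integrable (fun p : Pl d × Pl d => heat τ (p.1 - p.2) • q p.1) (volume.prod σ) := by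
      refine ((integrable_prod_heat hτ).mul_const B).mono'
        ((integrable_prod_heat hτ).aestronglyMeasurable.smul hqm.comp_fst)
        (Eventually.of_forall fun p => ?_)
      rw [norm_smul, Real.norm_of_nonneg (heat_pos hτ _).le]
      have := (heat_pos hτ (p.1 - p.2)).le
      gcongr
      exact hB _
    exact hi'.integral_prod_right
  rw [← integral_sub hint hqσ]
  exact norm_integral_le_of_norm_le_const (Eventually.of_forall hpt)

end Transfer

/-! ### Gaussian energy and the pigeonhole choice of a scale -/

section Energy

variable {d : ℕ} {σ : Measure (Pl d)} [IsFiniteMeasure σ]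

theorem heatConv_le_mass {τ : ℝ} (hτ : 0 < τ) (x : Pl d) :
    heatConv σ τ x ≤ (√(Real.pi * τ) ^ d)⁻¹ * σ.real Set.univ := by
  calc _ ≤ ∫ _, (√(Real.pi * τ) ^ d)⁻¹ ∂σ :=
        integral_mono (integrable_heat_sub hτ x) (integrable_const _) fun y => heat_le hτ _
    _ = _ := by rw [integral_const, smul_eq_mul, mul_comm]

theorem integral_heatConv_mul_heat {s t : ℝ} (hs : 0 < s) (ht : 0 < t) (y : Pl d) :
    ∫ x, heatConv σ t x * heat s (x - y) = heatConv σ (s + t) y := by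
  have h := integral_heatConv_smul (σ := σ) ht (q := fun x => heat s (x - y)) (by fun_prop)
    (B := (√(Real.pi * s) ^ d)⁻¹) (fun x => by
      rw [Real.norm_of_nonneg (heat_pos hs _).le]; exact heat_le hs _)
  simp only [smul_eq_mul] at h
  rw [h, heatConv]
  refine integral_congr_ae (Eventually.of_forall fun w => ?_)
  simp only
  have e := integral_heat_mul_heat hs ht (y - w)
  rw [← e, ← integral_sub_left_eq_self (fun x => heat s x * heat t (y - w - x)) volume y]
  refine integral_congr_ae (Eventually.of_forall fun x => ?_)
  simp only
  rw [heat_sub_comm s x y, mul_comm]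
  congr 2
  abel

/-- The Gaussian energy of `σ`. -/
def heatEnergy (σ : Measure (Pl d)) (u : ℝ) : ℝ := ∫ y, heatConv σ u y ∂σ

theorem heatConv_norm_le {τ : ℝ} (hτ : 0 < τ) (x : Pl d) :
    ‖heatConv σ τ x‖ ≤ (√(Real.pi * τ) ^ d)⁻¹ * σ.real Set.univ := by
  rw [Real.norm_of_nonneg (heatConv_nonneg hτ x)]
  exact heatConv_le_mass hτ x

theorem integrable_heatConv_mul {s t : ℝ} (hs : 0 < s) (ht : 0 < t) :
    Integrable fun x => heatConv σ s x * heatConv σ t x :=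
  (integrable_heatConv hs).mul_bdd (continuous_heatConv ht).aestronglyMeasurable
    (Eventually.of_forall (heatConv_norm_le ht))

theorem integral_heatConv_mul_heatConv {s t : ℝ} (hs : 0 < s) (ht : 0 < t) :
    ∫ x, heatConv σ s x * heatConv σ t x = heatEnergy σ (s + t) := by
  have h := integral_heatConv_smul (σ := σ) hs (q := heatConv σ t)
    (continuous_heatConv ht).aestronglyMeasurable (heatConv_norm_le ht)
  simp only [smul_eq_mul] at h
  rw [h, heatEnergy]
  refine integral_congr_ae (Eventually.of_forall fun y => ?_)
  simp only [mul_comm (heat s _)]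
  exact integral_heatConv_mul_heat hs ht y

theorem integral_heatConv_sub_sq {s t : ℝ} (hs : 0 < s) (ht : 0 < t) :
    ∫ x, (heatConv σ s x - heatConv σ t x) ^ 2 =
      heatEnergy σ (2 * s) - 2 * heatEnergy σ (s + t) + heatEnergy σ (2 * t) := by
  have e : ∀ x, (heatConv σ s x - heatConv σ t x) ^ 2 = heatConv σ s x * heatConv σ s x -
      2 * (heatConv σ s x * heatConv σ t x) + heatConv σ t x * heatConv σ t x := fun x => by ring
  simp only [e]
  rw [integral_add, integral_sub, integral_const_mul, integral_heatConv_mul_heatConv hs hs,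
    integral_heatConv_mul_heatConv hs ht, integral_heatConv_mul_heatConv ht ht, two_mul s,
    two_mul t]
  · exact integrable_heatConv_mul hs hs
  · exact (integrable_heatConv_mul hs ht).const_mul _
  · exact (integrable_heatConv_mul hs hs).sub ((integrable_heatConv_mul hs ht).const_mul _)
  · exact integrable_heatConv_mul ht ht

omit [IsFiniteMeasure σ] in
theorem heatEnergy_nonneg {u : ℝ} (hu : 0 < u) : 0 ≤ heatEnergy σ u :=
  integral_nonneg fun y => heatConv_nonneg hu y

theorem integrable_heatConv_self {u : ℝ} (hu : 0 < u) : Integrable (heatConv σ u) σ :=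
  Integrable.of_bound (continuous_heatConv hu).aestronglyMeasurable _
    (Eventually.of_forall (heatConv_norm_le hu))

theorem heatEnergy_le {u B : ℝ} (hu : 0 < u) (hB : ∀ y, heatConv σ u y ≤ B) :
    heatEnergy σ u ≤ B * σ.real Set.univ := by
  calc _ ≤ ∫ _, B ∂σ := integral_mono (integrable_heatConv_self hu) (integrable_const _) hB
    _ = _ := by rw [integral_const, smul_eq_mul, mul_comm]

/-- Convexity makes the increments nondecreasing, so a positive first increment would force linear
growth. -/
theorem le_of_midpoint_convex_of_bounded {a : ℕ → ℝ} {B : ℝ} (hB : ∀ k, a k ≤ B)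
    (hc : ∀ k, 2 * a (k + 1) ≤ a k + a (k + 2)) : a 1 ≤ a 0 := by
  by_contra! h
  have h1 : ∀ k, a 1 - a 0 ≤ a (k + 1) - a k := by
    intro k
    induction k with
    | zero => simp
    | succ k ih => have := hc k; linarith
  have h2 : ∀ k : ℕ, a 0 + k * (a 1 - a 0) ≤ a k := by
    intro k
    induction k with
    | zero => simp
    | succ k ih => have := h1 k; push_cast; linarith
  obtain ⟨n, hn⟩ := exists_nat_gt ((B - a 0) / (a 1 - a 0))
  rw [div_lt_iff₀ (by linarith)] at hn
  linarith [h2 n, hB n]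

/-- The energy is midpoint convex in time, because its second difference is the square of an `L²`
norm (`integral_heatConv_sub_sq`). It is bounded on `[s, ∞)` by means of the finite mass, hence
nonincreasing along the progression `s, t, 2t - s, …`. -/
theorem heatEnergy_anti {s t : ℝ} (hs : 0 < s) (hst : s ≤ t) :
    heatEnergy σ t ≤ heatEnergy σ s := by
  have hpi := Real.pi_pos
  have hpos : ∀ k : ℕ, 0 < s + k * (t - s) := fun k => by
    have : 0 ≤ t - s := by linarith
    positivity
  have h := le_of_midpoint_convex_of_bounded (a := fun k : ℕ => heatEnergy σ (s + k * (t - s)))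
    (B := (√(Real.pi * s) ^ d)⁻¹ * σ.real Set.univ * σ.real Set.univ) (fun k => ?_) (fun k => ?_)
  · simpa using h
  · refine heatEnergy_le (hpos k) fun y => (heatConv_le_mass (hpos k) y).trans ?_
    gcongr
    have : 0 ≤ t - s := by linarith
    exact le_add_of_nonneg_right (by positivity)
  · have h1 := integral_heatConv_sub_sq (σ := σ) (half_pos (hpos k)) (half_pos (hpos (k + 2)))
    have h2 : 0 ≤ ∫ x, (heatConv σ ((s + k * (t - s)) / 2) x -
        heatConv σ ((s + (k + 2 : ℕ) * (t - s)) / 2) x) ^ 2 := integral_nonneg fun x => sq_nonneg _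
    rw [h1] at h2
    have e1 : 2 * ((s + k * (t - s)) / 2) = s + k * (t - s) := by ring
    have e2 : 2 * ((s + (k + 2 : ℕ) * (t - s)) / 2) = s + (k + 2 : ℕ) * (t - s) := by ring
    have e3 : (s + k * (t - s)) / 2 + (s + (k + 2 : ℕ) * (t - s)) / 2 =
        s + (k + 1 : ℕ) * (t - s) := by push_cast; ring
    rw [e1, e2, e3] at h2
    linarith

theorem integral_heatConv_sub_sq_le {s t : ℝ} (hs : 0 < s) (hst : s ≤ t) :
    ∫ x, (heatConv σ s x - heatConv σ t x) ^ 2 ≤ heatEnergy σ (2 * s) - heatEnergy σ (2 * t) := by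
  have ht : 0 < t := hs.trans_le hst
  rw [integral_heatConv_sub_sq hs ht]
  have := heatEnergy_anti (σ := σ) (show 0 < s + t by positivity) (show s + t ≤ 2 * t by linarith)
  linarith

/-- Each squared distance is at most an energy increment, and the increments telescope to at most
`heatEnergy σ (2 * r J)`, so one of the `J` distances is at most the average. -/
theorem exists_integral_heatConv_sub_sq_le {r : ℕ → ℝ} (hr : ∀ j, 0 < r j)
    (hr' : ∀ j, r (j + 1) ≤ r j) {J : ℕ} (hJ : 0 < J) {B : ℝ}
    (hB : heatEnergy σ (2 * r J) ≤ B) :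
    ∃ j < J, ∫ x, (heatConv σ (r (j + 1)) x - heatConv σ (r j) x) ^ 2 ≤ B / J := by
  by_contra! h
  have h1 : ∀ k ≤ J, k * (B / J) ≤ heatEnergy σ (2 * r k) - heatEnergy σ (2 * r 0) := by
    intro k
    induction k with
    | zero => simp
    | succ k ih =>
      intro hk
      have h2 := ih (by omega)
      have h3 := h k (by omega)
      have h4 := integral_heatConv_sub_sq_le (σ := σ) (hr (k + 1)) (hr' k)
      push_cast
      linarith
  -- The last increment is kept apart from the induction, because its strict inequality yields the
  -- contradiction.
  obtain ⟨k, rfl⟩ : ∃ k, J = k + 1 := ⟨J - 1, by omega⟩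
  have h2 := h1 k (by omega)
  have h3 := h k (by omega)
  have h4 := integral_heatConv_sub_sq_le (σ := σ) (hr (k + 1)) (hr' k)
  have h5 : ((k + 1 : ℕ) : ℝ) * (B / (k + 1 : ℕ)) = B := by field_simp
  push_cast at h5 h3 h2
  have h6 := heatEnergy_nonneg (σ := σ) (show 0 < 2 * r 0 by linarith [hr 0])
  linarith

end Energy

/-! ### Dyadic estimates for measures of polynomial growth -/

section GrowthBounds

variable {X : Type*} [PseudoMetricSpace X] [MeasurableSpace X] [OpensMeasurableSpace X]
  {ν : Measure X}

theorem lintegral_inv_dist_pow_near {e : ℕ} {C δ : ℝ} (hC : 0 ≤ C) (hδ : 0 < δ) {x : X}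
    (hν : ∀ r, 0 < r → ν (ball x r) ≤ ENNReal.ofReal (C * r ^ (e + 1))) :
    ∫⁻ y in ball x δ, ENNReal.ofReal ((dist y x ^ e)⁻¹) ∂ν ≤
      ENNReal.ofReal (C * 2 ^ (e + 1) * δ) := by
  have hpt : ∀ y ∈ ball x δ, ENNReal.ofReal ((dist y x ^ e)⁻¹) ≤
      ∑' k : ℕ, (ball x (δ * (1 / 2) ^ k)).indicator
        (fun _ => ENNReal.ofReal ((2 ^ (k + 1) / δ) ^ e)) y := by
    intro y hy
    rw [mem_ball] at hy
    rcases (dist_nonneg (x := y) (y := x)).eq_or_lt with h0 | hpos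
    · refine le_trans ?_ (ENNReal.le_tsum 0)
      rw [Set.indicator_of_mem (by simpa using hy)]
      apply ENNReal.ofReal_le_ofReal
      rw [← h0]
      -- At distance zero the integrand is `1` if `e = 0` and `0⁻¹ = 0` otherwise, so the first
      -- dyadic ball suffices.
      rcases Nat.eq_zero_or_pos e with rfl | he
      · simp
      · rw [zero_pow he.ne', inv_zero]; positivity
    · obtain ⟨k, hk1, hk2⟩ := exists_nat_pow_near_of_lt_one (div_pos hpos hδ)
        ((div_le_one hδ).2 hy.le) (show (0 : ℝ) < 1 / 2 by norm_num) (by norm_num)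
      rw [div_le_iff₀ hδ] at hk2
      rw [lt_div_iff₀ hδ] at hk1
      rcases hk2.lt_or_eq with hk2 | hk2
      · refine le_trans ?_ (ENNReal.le_tsum k)
        rw [Set.indicator_of_mem (by rw [mem_ball, mul_comm]; exact hk2)]
        apply ENNReal.ofReal_le_ofReal
        rw [← inv_pow]
        apply pow_le_pow_left₀ (by positivity)
        rw [inv_le_comm₀ hpos (by positivity), inv_div]
        refine le_trans (le_of_eq ?_) hk1.le
        rw [one_div, inv_pow]; field_simp
      -- A point exactly on the sphere of radius `δ / 2 ^ k` is not in the open ball of that radius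
      -- and is assigned to the preceding one, whose weight it attains exactly.
      · obtain ⟨j, rfl⟩ : ∃ j, k = j + 1 := by
          refine ⟨k - 1, ?_⟩
          rcases Nat.eq_zero_or_pos k with rfl | hk
          · simp at hk2; linarith
          · omega
        refine le_trans ?_ (ENNReal.le_tsum j)
        rw [Set.indicator_of_mem (by
          rw [mem_ball, hk2, pow_succ]
          have : 0 < (1 / 2 : ℝ) ^ j * δ := by positivity
          linarith)]
        apply ENNReal.ofReal_le_ofReal
        rw [← inv_pow]
        apply pow_le_pow_left₀ (by positivity)
        rw [hk2, one_div, inv_pow, mul_inv, inv_inv, div_eq_mul_inv]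
  calc _ ≤ ∫⁻ y in ball x δ, (∑' k : ℕ, (ball x (δ * (1 / 2) ^ k)).indicator
        (fun _ => ENNReal.ofReal ((2 ^ (k + 1) / δ) ^ e)) y) ∂ν :=
        setLIntegral_mono' measurableSet_ball hpt
    _ ≤ ∫⁻ y, (∑' k : ℕ, (ball x (δ * (1 / 2) ^ k)).indicator
        (fun _ => ENNReal.ofReal ((2 ^ (k + 1) / δ) ^ e)) y) ∂ν := setLIntegral_le_lintegral _ _
    _ = ∑' k : ℕ, ENNReal.ofReal ((2 ^ (k + 1) / δ) ^ e) * ν (ball x (δ * (1 / 2) ^ k)) := by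
        rw [lintegral_tsum (fun k => (measurable_const.indicator measurableSet_ball).aemeasurable)]
        simp [lintegral_indicator measurableSet_ball]
    _ ≤ ∑' k : ℕ, ENNReal.ofReal (C * 2 ^ e * δ * (1 / 2) ^ k) := by
        gcongr with k
        refine (mul_le_mul_right (hν _ (by positivity)) _).trans ?_
        rw [← ENNReal.ofReal_mul (by positivity)]
        apply ENNReal.ofReal_le_ofReal (le_of_eq _)
        have h2 : (2 : ℝ) ^ k * (1 / 2) ^ k = 1 := by rw [← mul_pow]; norm_num
        have h3 : ((2 : ℝ) ^ k) ^ e * ((1 / 2) ^ k) ^ e = 1 := by rw [← mul_pow, h2, one_pow]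
        calc _ = C * 2 ^ e * δ * (1 / 2) ^ k * (((2 : ℝ) ^ k) ^ e * ((1 / 2) ^ k) ^ e) := by
              rw [pow_succ 2 k, div_pow, mul_pow, mul_pow, pow_succ, pow_succ]
              field_simp
          _ = _ := by rw [h3, mul_one]
    _ = _ := by
        rw [← ENNReal.ofReal_tsum_of_nonneg (fun k => by positivity)
          ((summable_geometric_of_lt_one (by norm_num) (by norm_num)).mul_left _), tsum_mul_left,
          tsum_geometric_of_lt_one (by norm_num) (by norm_num)]
        congr 1; ring

theorem lintegral_inv_dist_pow_far {d : ℕ} {C ρ : ℝ} (hC : 0 ≤ C) (hρ : 0 < ρ) {x : X}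
    (hν : ∀ r, 0 < r → ν (ball x r) ≤ ENNReal.ofReal (C * r ^ d)) :
    ∫⁻ y in (ball x ρ)ᶜ, ENNReal.ofReal ((dist y x ^ (d + 1))⁻¹) ∂ν ≤
      ENNReal.ofReal (C * 2 ^ (d + 1) / ρ) := by
  have hpt : ∀ y ∈ (ball x ρ)ᶜ, ENNReal.ofReal ((dist y x ^ (d + 1))⁻¹) ≤
      ∑' k : ℕ, (ball x (ρ * 2 ^ (k + 1))).indicator
        (fun _ => ENNReal.ofReal (((ρ * 2 ^ k) ^ (d + 1))⁻¹)) y := by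
    intro y hy
    rw [Set.mem_compl_iff, mem_ball, not_lt] at hy
    obtain ⟨k, hk1, hk2⟩ := exists_nat_pow_near ((one_le_div hρ).2 hy) (show (1 : ℝ) < 2 by norm_num)
    rw [le_div_iff₀ hρ] at hk1
    rw [div_lt_iff₀ hρ] at hk2
    refine le_trans ?_ (ENNReal.le_tsum k)
    rw [Set.indicator_of_mem (by rw [mem_ball, mul_comm]; exact hk2)]
    apply ENNReal.ofReal_le_ofReal
    rw [mul_comm ρ]
    gcongr
  calc _ ≤ ∫⁻ y in (ball x ρ)ᶜ, (∑' k : ℕ, (ball x (ρ * 2 ^ (k + 1))).indicator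
        (fun _ => ENNReal.ofReal (((ρ * 2 ^ k) ^ (d + 1))⁻¹)) y) ∂ν :=
        setLIntegral_mono' measurableSet_ball.compl hpt
    _ ≤ ∫⁻ y, (∑' k : ℕ, (ball x (ρ * 2 ^ (k + 1))).indicator
        (fun _ => ENNReal.ofReal (((ρ * 2 ^ k) ^ (d + 1))⁻¹)) y) ∂ν := setLIntegral_le_lintegral _ _
    _ = ∑' k : ℕ, ENNReal.ofReal (((ρ * 2 ^ k) ^ (d + 1))⁻¹) * ν (ball x (ρ * 2 ^ (k + 1))) := by
        rw [lintegral_tsum (fun k => (measurable_const.indicator measurableSet_ball).aemeasurable)]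
        simp [lintegral_indicator measurableSet_ball]
    _ ≤ ∑' k : ℕ, ENNReal.ofReal (C * 2 ^ d / ρ * (1 / 2) ^ k) := by
        gcongr with k
        refine (mul_le_mul_right (hν _ (by positivity)) _).trans ?_
        rw [← ENNReal.ofReal_mul (by positivity)]
        apply ENNReal.ofReal_le_ofReal (le_of_eq _)
        rw [one_div, inv_pow, pow_succ (2 : ℝ) k, ← mul_assoc ρ, mul_pow (ρ * 2 ^ k) 2, pow_succ]
        field_simp
    _ = _ := by
        rw [← ENNReal.ofReal_tsum_of_nonneg (fun k => by positivity)
          ((summable_geometric_of_lt_one (by norm_num) (by norm_num)).mul_left _), tsum_mul_left,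
          tsum_geometric_of_lt_one (by norm_num) (by norm_num)]
        congr 1; ring

end GrowthBounds

/-! ### The regularized Riesz kernel -/

section Kernel

variable {F : Type*} [NormedAddCommGroup F] [NormedSpace ℝ F]

/-- The regularized `d`-dimensional Riesz kernel on a normed space. -/
def rk (d : ℕ) (δ : ℝ) (x : F) : F := (max δ ‖x‖ ^ (d + 1))⁻¹ • x

theorem rk_neg (d : ℕ) (δ : ℝ) (x : F) : rk d δ (-x) = -rk d δ x := by simp [rk]

theorem rk_eq_of_le {d : ℕ} {δ δ' : ℝ} {x : F} (h : δ ≤ ‖x‖) (h' : δ' ≤ ‖x‖) :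
    rk d δ x = rk d δ' x := by
  rw [rk, rk, max_eq_right h, max_eq_right h']

theorem norm_rk_le {d : ℕ} {δ : ℝ} (hδ : 0 < δ) (x : F) : ‖rk d δ x‖ ≤ (δ ^ d)⁻¹ := by
  have hm : 0 < max δ ‖x‖ := lt_max_of_lt_left hδ
  rw [rk, norm_smul, Real.norm_of_nonneg (by positivity)]
  calc _ ≤ (max δ ‖x‖ ^ (d + 1))⁻¹ * max δ ‖x‖ := by gcongr; exact le_max_right _ _
    _ = (max δ ‖x‖ ^ d)⁻¹ := by rw [pow_succ]; field_simp
    _ ≤ _ := by gcongr; exact le_max_left _ _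

theorem norm_rk_mul_norm_le {e : ℕ} {δ : ℝ} (x : F) :
    ‖rk (e + 1) δ x‖ * ‖x‖ ≤ (‖x‖ ^ e)⁻¹ := by
  rcases eq_or_ne x 0 with rfl | hx
  · simp only [norm_zero, mul_zero]; positivity
  have hx' : 0 < ‖x‖ := norm_pos_iff.2 hx
  have hm : 0 < max δ ‖x‖ := lt_max_of_lt_right hx'
  rw [rk, norm_smul, Real.norm_of_nonneg (by positivity)]
  calc _ ≤ (‖x‖ ^ (e + 1 + 1))⁻¹ * ‖x‖ * ‖x‖ := by gcongr; exact le_max_right _ _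
    _ = _ := by field_simp; ring

theorem norm_rk_le_of_le {d : ℕ} {δ r : ℝ} (hr : 0 < r) {x : F} (hx : r ≤ ‖x‖) :
    ‖rk d δ x‖ ≤ (r ^ d)⁻¹ := by
  have hm : 0 < max δ ‖x‖ := lt_max_of_lt_right (hr.trans_le hx)
  rw [rk, norm_smul, Real.norm_of_nonneg (by positivity)]
  calc _ ≤ (max δ ‖x‖ ^ (d + 1))⁻¹ * max δ ‖x‖ := by gcongr; exact le_max_right _ _
    _ = (max δ ‖x‖ ^ d)⁻¹ := by rw [pow_succ]; field_simp
    _ ≤ _ := by gcongr; exact hx.trans (le_max_right _ _)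

/-- The lower bound `m` for the two denominators is left free: `m = δ` gives the global Lipschitz
bound, and a multiple of the distance to the source gives the far field decay. The difference of the
two powers is a geometric sum with `d + 1` terms. -/
theorem norm_rk_sub_le {d : ℕ} {δ m : ℝ} (hm : 0 < m) {a b : F} (ha : m ≤ max δ ‖a‖)
    (hb : m ≤ max δ ‖b‖) :
    ‖rk d δ a - rk d δ b‖ ≤ (d + 2) * (m ^ (d + 1))⁻¹ * ‖a - b‖ := by
  set M := max δ ‖a‖ with hM
  set N := max δ ‖b‖ with hN
  have hM0 : 0 < M := hm.trans_le ha
  have hN0 : 0 < N := hm.trans_le hb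
  have hbN : ‖b‖ ≤ N := le_max_right _ _
  have hMN : |N - M| ≤ ‖a - b‖ := by
    rw [hM, hN, max_comm δ, max_comm δ]
    refine (abs_max_sub_max_le_abs _ _ _).trans ?_
    rw [norm_sub_rev]
    exact abs_norm_sub_norm_le b a
  have e : rk d δ a - rk d δ b = (M ^ (d + 1))⁻¹ • (a - b) +
      ((M ^ (d + 1))⁻¹ - (N ^ (d + 1))⁻¹) • b := by
    rw [rk, rk, ← hM, ← hN]; module
  have h1 : |(M ^ (d + 1))⁻¹ - (N ^ (d + 1))⁻¹| * N ≤ (d + 1) * (m ^ (d + 1))⁻¹ * ‖a - b‖ := by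
    have e1 : (M ^ (d + 1))⁻¹ - (N ^ (d + 1))⁻¹ =
        (N - M) * ∑ i ∈ Finset.range (d + 1), (M⁻¹) ^ (i + 1) * (N⁻¹) ^ (d + 1 - i) := by
      rw [← inv_pow, ← inv_pow, ← Commute.mul_geom_sum₂ (Commute.all _ _)]
      have : M⁻¹ - N⁻¹ = (N - M) * (M⁻¹ * N⁻¹) := by field_simp
      rw [this, mul_assoc, Finset.mul_sum]
      congr 1
      refine Finset.sum_congr rfl fun i hi => ?_
      rw [Finset.mem_range] at hi
      rw [show d + 1 - i = (d + 1 - 1 - i) + 1 by omega, pow_succ, pow_succ]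
      ring
    have hS : 0 ≤ ∑ i ∈ Finset.range (d + 1), (M⁻¹) ^ (i + 1) * (N⁻¹) ^ (d + 1 - i) := by positivity
    rw [e1, abs_mul, mul_assoc, abs_of_nonneg hS, Finset.sum_mul]
    have h2 : ∑ i ∈ Finset.range (d + 1), (M⁻¹) ^ (i + 1) * (N⁻¹) ^ (d + 1 - i) * N ≤
        (d + 1) * (m ^ (d + 1))⁻¹ := by
      calc _ ≤ ∑ i ∈ Finset.range (d + 1), (m ^ (d + 1))⁻¹ := by
            refine Finset.sum_le_sum fun i hi => ?_
            rw [Finset.mem_range] at hi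
            have : (N⁻¹) ^ (d + 1 - i) * N = (N⁻¹) ^ (d - i) := by
              rw [show d + 1 - i = (d - i) + 1 by omega, pow_succ]; field_simp
            rw [mul_assoc, this]
            calc _ ≤ (m⁻¹) ^ (i + 1) * (m⁻¹) ^ (d - i) := by gcongr
              _ = _ := by rw [← pow_add, ← inv_pow]; congr 1; omega
        _ = _ := by simp
    calc _ ≤ ‖a - b‖ * ((d + 1) * (m ^ (d + 1))⁻¹) := by gcongr
      _ = _ := by ring
  rw [e]
  refine (norm_add_le _ _).trans ?_
  rw [norm_smul, norm_smul, Real.norm_of_nonneg (by positivity), Real.norm_eq_abs]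
  calc _ ≤ (m ^ (d + 1))⁻¹ * ‖a - b‖ + |(M ^ (d + 1))⁻¹ - (N ^ (d + 1))⁻¹| * N := by gcongr
    _ ≤ (m ^ (d + 1))⁻¹ * ‖a - b‖ + (d + 1) * (m ^ (d + 1))⁻¹ * ‖a - b‖ := by gcongr
    _ = _ := by ring

theorem norm_rk_sub_le' {d : ℕ} {δ : ℝ} (hδ : 0 < δ) (a b : F) :
    ‖rk d δ a - rk d δ b‖ ≤ (d + 2) * (δ ^ (d + 1))⁻¹ * ‖a - b‖ :=
  norm_rk_sub_le hδ (le_max_left _ _) (le_max_left _ _)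

theorem continuous_rk {d : ℕ} {δ : ℝ} (hδ : 0 < δ) : Continuous (rk d δ : F → F) := by
  unfold rk
  refine Continuous.smul (Continuous.inv₀ (by fun_prop) fun x => ?_) continuous_id
  have : 0 < max δ ‖x‖ := lt_max_of_lt_left hδ
  positivity

theorem measurable_rk [MeasurableSpace F] [BorelSpace F] [SecondCountableTopology F]
    {d : ℕ} {δ : ℝ} : Measurable (rk d δ : F → F) := by
  unfold rk
  exact (by fun_prop : Measurable fun x : F => (max δ ‖x‖ ^ (d + 1))⁻¹).smul measurable_id

end Kernel

/-! ### Principal values against Lipschitz fields -/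

section Singular

theorem norm_rk_mul_norm_le' {F : Type*} [NormedAddCommGroup F] [NormedSpace ℝ F] {d : ℕ}
    (hd : 1 ≤ d) {δ : ℝ} (x : F) : ‖rk d δ x‖ * ‖x‖ ≤ (‖x‖ ^ (d - 1))⁻¹ := by
  obtain ⟨e, rfl⟩ : ∃ e, d = e + 1 := ⟨d - 1, by omega⟩
  exact norm_rk_mul_norm_le x

variable {d : ℕ}

theorem integrableOn_inv_norm_pow (hd : 1 ≤ d) {θ : ℝ} (hθ : 0 < θ) :
    IntegrableOn (fun w : Pl d => (‖w‖ ^ (d - 1))⁻¹) (ball 0 θ) ∧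
      ∫ w in ball (0 : Pl d) θ, (‖w‖ ^ (d - 1))⁻¹ ≤ unitVol d * 2 ^ d * θ := by
  obtain ⟨e, rfl⟩ : ∃ e, d = e + 1 := ⟨d - 1, by omega⟩
  simp only [Nat.add_sub_cancel]
  have hv := unitVol_pos (e + 1)
  have key := lintegral_inv_dist_pow_near (X := Pl (e + 1)) (ν := volume) (C := unitVol (e + 1))
    hv.le hθ (x := 0) (fun r hr => by rw [volume_ball_eq_ofReal hr, mul_comm])
  simp only [dist_zero_right] at key
  have hm : Measurable fun w : Pl (e + 1) => (‖w‖ ^ e)⁻¹ := by fun_prop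
  have hi : IntegrableOn (fun w : Pl (e + 1) => (‖w‖ ^ e)⁻¹) (ball 0 θ) := by
    refine ⟨hm.aestronglyMeasurable, ?_⟩
    rw [hasFiniteIntegral_iff_ofReal (Eventually.of_forall fun w => by positivity)]
    exact key.trans_lt ENNReal.ofReal_lt_top
  refine ⟨hi, ?_⟩
  rw [← ofReal_integral_eq_lintegral_ofReal hi (Eventually.of_forall fun w => by positivity)] at key
  exact (ENNReal.ofReal_le_ofReal_iff (by positivity)).1 key

/-- The antisymmetrized principal value of the pairing of the Riesz kernel with `h`. -/
def rieszAvg (δ : ℝ) (h : Pl d → Pl d) (y : Pl d) : ℝ :=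
  (1 / 2) * ∫ w, inner ℝ (rk d δ w) (h (y - w) - h (y + w))

variable {h H : Pl d → Pl d} {L : ℝ}

theorem norm_sub_add_le (hL : ∀ a b, ‖h a - h b‖ ≤ L * ‖a - b‖) (y w : Pl d) :
    ‖h (y - w) - h (y + w)‖ ≤ 2 * L * ‖w‖ := by
  refine (hL _ _).trans (le_of_eq ?_)
  have : y - w - (y + w) = -((2 : ℝ) • w) := by rw [two_smul]; abel
  rw [this, norm_neg, norm_smul]; norm_num; ring

theorem inner_rk_near_le (hd : 1 ≤ d) (hL : ∀ a b, ‖h a - h b‖ ≤ L * ‖a - b‖) (hL0 : 0 ≤ L)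
    (δ : ℝ) (y w : Pl d) :
    |inner ℝ (rk d δ w) (h (y - w) - h (y + w))| ≤ 2 * L * (‖w‖ ^ (d - 1))⁻¹ := by
  refine (abs_real_inner_le_norm _ _).trans ?_
  calc _ ≤ ‖rk d δ w‖ * (2 * L * ‖w‖) := by gcongr; exact norm_sub_add_le hL y w
    _ = 2 * L * (‖rk d δ w‖ * ‖w‖) := by ring
    _ ≤ _ := by gcongr; exact norm_rk_mul_norm_le' hd w

theorem integrable_inner_rk (hd : 1 ≤ d) (hL : ∀ a b, ‖h a - h b‖ ≤ L * ‖a - b‖) (hL0 : 0 ≤ L)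
    (hm : Measurable h) (hi : Integrable h) (δ : ℝ) (y : Pl d) :
    Integrable fun w => (inner ℝ (rk d δ w) (h (y - w) - h (y + w)) : ℝ) := by
  have hmeas : Measurable fun w => (inner ℝ (rk d δ w) (h (y - w) - h (y + w)) : ℝ) :=
    measurable_rk.inner (by fun_prop)
  rw [← integrableOn_univ, ← Set.union_compl_self (ball (0 : Pl d) 1)]
  refine IntegrableOn.union ?_ ?_
  · refine Integrable.mono' ((integrableOn_inv_norm_pow hd one_pos).1.const_mul (2 * L))
      hmeas.aestronglyMeasurable (Eventually.of_forall fun w => ?_)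
    exact inner_rk_near_le hd hL hL0 δ y w
  · have hi' : Integrable fun w => ‖h (y - w)‖ + ‖h (y + w)‖ :=
      (hi.comp_sub_left y).norm.add (hi.comp_add_left y).norm
    refine Integrable.mono' hi'.integrableOn hmeas.aestronglyMeasurable ?_
    filter_upwards [ae_restrict_mem measurableSet_ball.compl] with w hw
    rw [Set.mem_compl_iff, mem_ball, not_lt, dist_zero_right] at hw
    refine (norm_inner_le_norm _ _).trans ?_
    have h1 : ‖rk d δ w‖ ≤ 1 := by simpa using norm_rk_le_of_le (d := d) (δ := δ) one_pos hw
    calc _ ≤ 1 * (‖h (y - w)‖ + ‖h (y + w)‖) := by gcongr; exact norm_sub_le _ _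
      _ = _ := one_mul _

/-- For `‖w‖ < θ` both integrands are at most `2 L ‖w‖^{1-d}` by the Lipschitz cancellation. For
`‖w‖ ≥ θ ≥ δ` the two kernels coincide and are at most `θ^{-d}`, which leaves the `L¹` distance of
the fields. -/
theorem abs_rieszAvg_sub_le (hd : 1 ≤ d) (hL : ∀ a b, ‖h a - h b‖ ≤ L * ‖a - b‖) (hL0 : 0 ≤ L)
    (hm : Measurable h) (hi : Integrable h) (hL' : ∀ a b, ‖H a - H b‖ ≤ L * ‖a - b‖)
    (hm' : Measurable H) (hi' : Integrable H) {δ θ : ℝ} (hθ : 0 < θ) (hδθ : δ ≤ θ) (y : Pl d) :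
    |rieszAvg δ H y - rieszAvg 0 h y| ≤
      2 * L * (unitVol d * 2 ^ d * θ) + (θ ^ d)⁻¹ * ∫ u, ‖H u - h u‖ := by
  set f : Pl d → ℝ := fun w => inner ℝ (rk d δ w) (H (y - w) - H (y + w)) -
    inner ℝ (rk d 0 w) (h (y - w) - h (y + w)) with hf
  have hi1 := integrable_inner_rk hd hL' hL0 hm' hi' δ y
  have hi2 := integrable_inner_rk hd hL hL0 hm hi 0 y
  have hfi : Integrable f := hi1.sub hi2
  have e : rieszAvg δ H y - rieszAvg 0 h y = (1 / 2) * ∫ w, f w := by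
    rw [rieszAvg, rieszAvg, hf, integral_sub hi1 hi2]; ring
  have hg : Integrable fun u => ‖H u - h u‖ := (hi'.sub hi).norm
  have n1 : |∫ w in ball 0 θ, f w| ≤ 4 * L * (unitVol d * 2 ^ d * θ) := by
    obtain ⟨hn, hn'⟩ := integrableOn_inv_norm_pow hd hθ
    calc _ ≤ ∫ w in ball (0 : Pl d) θ, 4 * L * (‖w‖ ^ (d - 1))⁻¹ := by
          rw [← Real.norm_eq_abs]
          refine norm_integral_le_of_norm_le (hn.const_mul _) (Eventually.of_forall fun w => ?_)
          have a1 := inner_rk_near_le hd hL hL0 0 y w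
          have a2 := inner_rk_near_le hd hL' hL0 δ y w
          refine (abs_sub _ _).trans ?_
          linarith
      _ ≤ _ := by rw [integral_const_mul]; gcongr
  have n2 : |∫ w in (ball 0 θ)ᶜ, f w| ≤ 2 * ((θ ^ d)⁻¹ * ∫ u, ‖H u - h u‖) := by
    have hg' : Integrable fun w => (θ ^ d)⁻¹ *
        (‖H (y - w) - h (y - w)‖ + ‖H (y + w) - h (y + w)‖) :=
      ((hg.comp_sub_left y).add (hg.comp_add_left y)).const_mul _
    calc _ ≤ ∫ w in (ball (0 : Pl d) θ)ᶜ, (θ ^ d)⁻¹ *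
          (‖H (y - w) - h (y - w)‖ + ‖H (y + w) - h (y + w)‖) := by
          rw [← Real.norm_eq_abs]
          refine norm_integral_le_of_norm_le hg'.integrableOn ?_
          filter_upwards [ae_restrict_mem measurableSet_ball.compl] with w hw
          rw [Set.mem_compl_iff, mem_ball, not_lt, dist_zero_right] at hw
          have e1 : f w = inner ℝ (rk d 0 w)
              ((H (y - w) - h (y - w)) - (H (y + w) - h (y + w))) := by
            simp only [hf]
            rw [rk_eq_of_le (δ := δ) (δ' := 0) (hδθ.trans hw) (norm_nonneg _), ← inner_sub_right]
            congr 1; abel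
          rw [e1]
          refine (norm_inner_le_norm _ _).trans ?_
          gcongr
          · exact norm_rk_le_of_le hθ hw
          · exact norm_sub_le _ _
      _ ≤ ∫ w, (θ ^ d)⁻¹ * (‖H (y - w) - h (y - w)‖ + ‖H (y + w) - h (y + w)‖) :=
          setIntegral_le_integral hg' (Eventually.of_forall fun w => by positivity)
      _ = _ := by
          rw [integral_const_mul, integral_add (hg.comp_sub_left y) (hg.comp_add_left y),
            integral_sub_left_eq_self (fun u => ‖H u - h u‖),
            integral_add_left_eq_self (fun u => ‖H u - h u‖)]
          ring
  rw [e, ← integral_add_compl (measurableSet_ball (x := (0 : Pl d)) (ε := θ)) hfi, abs_mul,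
    abs_of_pos (by norm_num : (0 : ℝ) < 1 / 2)]
  have := abs_add_le (∫ w in ball 0 θ, f w) (∫ w in (ball 0 θ)ᶜ, f w)
  linarith

/-- For a truncated kernel the antisymmetrized pairing is an honest convolution. -/
theorem rieszAvg_eq (hm : Measurable H) (hi : Integrable H) {δ : ℝ} (hδ : 0 < δ) (y : Pl d) :
    rieszAvg δ H y = ∫ w, inner ℝ (rk d δ w) (H (y - w)) := by
  have hi1 : Integrable fun w => (inner ℝ (rk d δ w) (H (y - w)) : ℝ) := by
    refine ((hi.comp_sub_left y).norm.const_mul (δ ^ d)⁻¹).mono'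
      (measurable_rk.inner (by fun_prop)).aestronglyMeasurable (Eventually.of_forall fun w => ?_)
    refine (norm_inner_le_norm _ _).trans ?_
    gcongr
    exact norm_rk_le hδ w
  have e : ∀ w, (inner ℝ (rk d δ w) (H (y + w)) : ℝ) =
      -(fun w => inner ℝ (rk d δ w) (H (y - w)) : Pl d → ℝ) (-w) := fun w => by
    simp only [rk_neg, inner_neg_left, neg_neg, sub_neg_eq_add]
  have hi2 : Integrable fun w => (inner ℝ (rk d δ w) (H (y + w)) : ℝ) := by
    simp only [e]
    exact (hi1.comp_neg).neg
  have e2 : ∫ w, (inner ℝ (rk d δ w) (H (y + w)) : ℝ) =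
      -∫ w, inner ℝ (rk d δ w) (H (y - w)) := by
    simp only [e]
    rw [integral_neg, integral_neg_eq_self (fun w => inner ℝ (rk d δ w) (H (y - w)) : Pl d → ℝ)]
  rw [rieszAvg]
  simp only [inner_sub_right]
  rw [integral_sub hi1 hi2, e2]
  ring

end Singular

/-! ### Subordination: the Riesz kernel as a superposition of Gaussians -/

section Subordination

variable {d : ℕ}

/-- The normalization in the representation of the Riesz kernel by Gaussians. -/
def subConst (d : ℕ) : ℝ := ∫ s in Set.Ioi (0 : ℝ), (s ^ (d + 2))⁻¹ * Real.exp (-(1 / s ^ 2))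

theorem integrableOn_sub (d : ℕ) :
    IntegrableOn (fun s : ℝ => (s ^ (d + 2))⁻¹ * Real.exp (-(1 / s ^ 2))) (Set.Ioi 0) := by
  obtain ⟨K, hK, h⟩ := exists_pow_mul_exp_neg_le (d + 2) one_pos
  obtain ⟨K', hK', h'⟩ := exists_pow_mul_exp_neg_le d one_pos
  refine Integrable.mono' ((integrable_inv_one_add_sq.const_mul (K + K')).integrableOn)
    (by fun_prop : Measurable _).aestronglyMeasurable ?_
  filter_upwards [ae_restrict_mem measurableSet_Ioi] with s hs
  have hs0 : (0 : ℝ) < s := hs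
  rw [Real.norm_of_nonneg (by positivity), ← div_eq_mul_inv, le_div_iff₀ (by positivity)]
  have h1 := h s⁻¹ (by positivity)
  have h2 := h' s⁻¹ (by positivity)
  have e : 1 * s⁻¹ ^ 2 = 1 / s ^ 2 := by rw [inv_pow]; ring
  rw [e] at h1 h2
  calc _ = s⁻¹ ^ (d + 2) * Real.exp (-(1 / s ^ 2)) + s⁻¹ ^ d * Real.exp (-(1 / s ^ 2)) := by
        rw [inv_pow, inv_pow]; field_simp; ring
    _ ≤ _ := by linarith

theorem subConst_pos (d : ℕ) : 0 < subConst d := by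
  rw [subConst, setIntegral_pos_iff_support_of_nonneg_ae _ (integrableOn_sub d)]
  · have : Set.Ioi (0 : ℝ) ⊆ (Function.support fun s : ℝ =>
        (s ^ (d + 2))⁻¹ * Real.exp (-(1 / s ^ 2))) ∩ Set.Ioi 0 := fun s hs => by
      have hs0 : (0 : ℝ) < s := hs
      refine ⟨?_, hs⟩
      rw [Function.mem_support]
      positivity
    exact lt_of_lt_of_le (by simp) (measure_mono this)
  · filter_upwards [ae_restrict_mem measurableSet_Ioi] with s hs
    have hs0 : (0 : ℝ) < s := hs
    simp only [Pi.zero_apply]; positivity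

theorem sqrt_pi_pow_mul_heat_sq {ξ : ℝ} (hξ : 0 < ξ) (w : Pl d) :
    √Real.pi ^ d * heat (ξ ^ 2) w = (ξ ^ d)⁻¹ * Real.exp (-(‖w‖ ^ 2 / ξ ^ 2)) := by
  have hpi := Real.pi_pos
  rw [heat, Real.sqrt_mul hpi.le, Real.sqrt_sq hξ.le, mul_pow]
  field_simp

/-- Measuring `ξ` in units of `‖w‖` separates the variables; the power of `‖w‖` that comes out,
together with the Jacobian, is that of the Riesz kernel. -/
theorem sub_scaling {ξ : ℝ} (hξ : 0 < ξ) {w : Pl d} (hw : 0 < ‖w‖) :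
    ((‖w‖ * ξ) ^ 2)⁻¹ * (√Real.pi ^ d * heat ((‖w‖ * ξ) ^ 2) w) =
      (‖w‖ ^ (d + 2))⁻¹ * ((ξ ^ (d + 2))⁻¹ * Real.exp (-(1 / ξ ^ 2))) := by
  rw [sqrt_pi_pow_mul_heat_sq (by positivity)]
  have : ‖w‖ ^ 2 / (‖w‖ * ξ) ^ 2 = 1 / ξ ^ 2 := by rw [mul_pow]; field_simp
  rw [this, mul_pow, mul_pow, pow_add, pow_add]
  field_simp

theorem integrableOn_sub_heat {w : Pl d} (hw : 0 < ‖w‖) :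
    IntegrableOn (fun ξ : ℝ => (ξ ^ 2)⁻¹ * (√Real.pi ^ d * heat (ξ ^ 2) w)) (Set.Ioi 0) := by
  have h1 : IntegrableOn (fun ξ : ℝ => ((‖w‖ * ξ) ^ 2)⁻¹ *
      (√Real.pi ^ d * heat ((‖w‖ * ξ) ^ 2) w)) (Set.Ioi 0) := by
    refine IntegrableOn.congr_fun ((integrableOn_sub d).const_mul (‖w‖ ^ (d + 2))⁻¹)
      (fun ξ hξ => ?_) measurableSet_Ioi
    exact (sub_scaling hξ hw).symm
  have := (integrableOn_Ioi_comp_mul_left_iff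
    (fun ξ : ℝ => (ξ ^ 2)⁻¹ * (√Real.pi ^ d * heat (ξ ^ 2) w)) 0 hw).1 h1
  simpa using this

theorem integral_sub_heat {w : Pl d} (hw : 0 < ‖w‖) :
    ∫ ξ in Set.Ioi (0 : ℝ), (ξ ^ 2)⁻¹ * (√Real.pi ^ d * heat (ξ ^ 2) w) =
      subConst d * (‖w‖ ^ (d + 1))⁻¹ := by
  have h := integral_comp_mul_left_Ioi
    (fun ξ : ℝ => (ξ ^ 2)⁻¹ * (√Real.pi ^ d * heat (ξ ^ 2) w)) 0 hw
  rw [mul_zero, smul_eq_mul, eq_inv_mul_iff_mul_eq₀ hw.ne'] at h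
  rw [← h, setIntegral_congr_fun measurableSet_Ioi (fun ξ hξ => sub_scaling hξ hw),
    integral_const_mul, ← subConst]
  field_simp
  ring

theorem integral_sub_heat_smul (w : Pl d) (v : Pl d) :
    subConst d * inner ℝ (rk d 0 w) v =
      ∫ ξ in Set.Ioi (0 : ℝ), (ξ ^ 2)⁻¹ * (√Real.pi ^ d * heat (ξ ^ 2) w) * inner ℝ w v := by
  rcases eq_or_ne w 0 with rfl | hw
  · simp [rk]
  have hw' : 0 < ‖w‖ := norm_pos_iff.2 hw
  rw [integral_mul_const, integral_sub_heat hw', rk, real_inner_smul_left,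
    max_eq_right (norm_nonneg _)]
  ring

/-- A vector field proportional to the gradient of a Gaussian centred at `x`. -/
def heatField (τ : ℝ) (x u : Pl d) : Pl d := heat τ (u - x) • (u - x)

@[fun_prop]
theorem continuous_heatField (τ : ℝ) (x : Pl d) : Continuous (heatField τ x) := by
  unfold heatField; fun_prop

theorem norm_heatField {τ : ℝ} (hτ : 0 < τ) (x u : Pl d) :
    ‖heatField τ x u‖ = ‖u - x‖ * heat τ (u - x) := by
  rw [heatField, norm_smul, Real.norm_of_nonneg (heat_pos hτ _).le, mul_comm]

theorem integrable_heatField {τ : ℝ} (hτ : 0 < τ) (x : Pl d) : Integrable (heatField τ x) := by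
  have h1 := (integrable_pow_mul_heat (d := d) 1 hτ).comp_sub_right x
  refine h1.mono' (by fun_prop) (Eventually.of_forall fun u => ?_)
  rw [norm_heatField hτ, pow_one]

theorem integral_heatField (τ : ℝ) (x : Pl d) : ∫ u, heatField τ x u = 0 := by
  unfold heatField
  rw [integral_sub_right_eq_self (fun u : Pl d => heat τ u • u)]
  have h : ∫ u : Pl d, heat τ u • u = -∫ u : Pl d, heat τ u • u := by
    rw [← integral_neg, ← integral_neg_eq_self]
    simp [heat_neg]
  have h2 : (2 : ℝ) • ∫ u : Pl d, heat τ u • u = 0 := by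
    rw [two_smul]; nth_rewrite 1 [h]; exact neg_add_cancel _
  exact (smul_eq_zero.1 h2).resolve_left two_ne_zero

theorem exists_heatField_lipschitz (d : ℕ) {T₀ : ℝ} (hT₀ : 0 < T₀) : ∃ L : ℝ, 0 < L ∧
    ∀ τ, T₀ ≤ τ → ∀ x a b : Pl d, ‖heatField τ x a - heatField τ x b‖ ≤ L * ‖a - b‖ := by
  obtain ⟨K, hK, h⟩ := exists_abs_heat_sub_le d
  obtain ⟨K₁, hK₁, h₁⟩ := exists_pow_mul_exp_neg_le 1 one_pos
  have hpi := Real.pi_pos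
  refine ⟨(√(Real.pi * T₀) ^ d)⁻¹ * (1 + K * (2 * (K₁ * √2))), by positivity, fun τ hτ x => ?_⟩
  have hτ0 : 0 < τ := hT₀.trans_le hτ
  have hst : 0 < √τ := by positivity
  have hmono : (√(Real.pi * τ) ^ d)⁻¹ ≤ (√(Real.pi * T₀) ^ d)⁻¹ := by gcongr
  have hmono2 : (√(Real.pi * (2 * τ)) ^ d)⁻¹ ≤ (√(Real.pi * T₀) ^ d)⁻¹ := by gcongr; linarith
  have hdec : ∀ a : Pl d, ‖a‖ * heat (2 * τ) a ≤ K₁ * √2 * √τ * (√(Real.pi * T₀) ^ d)⁻¹ := by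
    intro a
    have h2 : (0 : ℝ) < 2 * τ := by positivity
    have h3 := h₁ (‖a‖ / √(2 * τ)) (by positivity)
    rw [heat_eq_profile h2]
    have hs2 : 0 < √(2 * τ) := by positivity
    rw [pow_one, one_mul, div_mul_eq_mul_div, div_le_iff₀ hs2] at h3
    calc _ = (√(Real.pi * (2 * τ)) ^ d)⁻¹ * (‖a‖ * Real.exp (-(‖a‖ / √(2 * τ)) ^ 2)) := by ring
      _ ≤ (√(Real.pi * T₀) ^ d)⁻¹ * (K₁ * √(2 * τ)) := by gcongr
      _ = _ := by rw [Real.sqrt_mul zero_le_two]; ring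
  have main : ∀ a b : Pl d, ‖a‖ ≤ ‖b‖ → ‖heat τ a • a - heat τ b • b‖ ≤
      (√(Real.pi * T₀) ^ d)⁻¹ * (1 + K * (2 * (K₁ * √2))) * ‖a - b‖ := by
    intro a b hab
    -- The difference of the Gaussians multiplies the shorter vector `a`. The larger of the two
    -- Gaussians at time `2 * τ` is then the one at `a`, and `‖a‖ * heat (2 * τ) a` supplies the
    -- `√τ` that cancels `1 / √τ`. This makes the bound uniform in `τ ≥ T₀`.
    have e : heat τ a • a - heat τ b • b = heat τ b • (a - b) + (heat τ a - heat τ b) • a := by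
      module
    have hle : heat (2 * τ) b ≤ heat (2 * τ) a := by unfold heat; gcongr
    rw [e]
    refine (norm_add_le _ _).trans ?_
    rw [norm_smul, norm_smul, Real.norm_of_nonneg (heat_pos hτ0 b).le, Real.norm_eq_abs]
    calc _ ≤ (√(Real.pi * T₀) ^ d)⁻¹ * ‖a - b‖ +
          K / √τ * ‖a - b‖ * (heat (2 * τ) a + heat (2 * τ) b) * ‖a‖ := by
          gcongr
          · exact (heat_le hτ0 b).trans hmono
          · exact h τ hτ0 a b
      _ ≤ (√(Real.pi * T₀) ^ d)⁻¹ * ‖a - b‖ +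
          K / √τ * ‖a - b‖ * (2 * (K₁ * √2 * √τ * (√(Real.pi * T₀) ^ d)⁻¹)) := by
          have h5 : (heat (2 * τ) a + heat (2 * τ) b) * ‖a‖ ≤
              2 * (K₁ * √2 * √τ * (√(Real.pi * T₀) ^ d)⁻¹) := by
            have := hdec a
            nlinarith [mul_le_mul_of_nonneg_right hle (norm_nonneg a)]
          have := mul_le_mul_of_nonneg_left h5 (by positivity : 0 ≤ K / √τ * ‖a - b‖)
          rw [mul_assoc (K / √τ * ‖a - b‖)]
          linarith
      _ = _ := by field_simp
  intro a b
  rw [heatField, heatField]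
  rcases le_total ‖a - x‖ ‖b - x‖ with hab | hab
  · simpa using main (a - x) (b - x) hab
  · rw [norm_sub_rev, norm_sub_rev a]
    simpa using main (b - x) (a - x) hab

theorem exists_heatField_decay (d N : ℕ) {T₀ T₁ A : ℝ} (hT₀ : 0 < T₀) (hA : 0 ≤ A) :
    ∃ B : ℝ, 0 < B ∧ ∀ τ, T₀ ≤ τ → τ ≤ T₁ → ∀ x u : Pl d, ‖x‖ ≤ A →
      ‖heatField τ x u‖ ≤ B * ((1 + ‖u‖) ^ N)⁻¹ := by
  have hpi := Real.pi_pos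
  by_cases hT : T₀ ≤ T₁
  swap
  · exact ⟨1, one_pos, fun τ h1 h2 => absurd (h1.trans h2) hT⟩
  have hT₁ : 0 < T₁ := hT₀.trans_le hT
  obtain ⟨K, hK, h⟩ := exists_pow_mul_exp_neg_le (N + 1) (inv_pos.2 hT₁)
  refine ⟨(1 + A) ^ N * ((√(Real.pi * T₀) ^ d)⁻¹ * (2 ^ (N + 1) * (1 + K))), by positivity,
    fun τ h1 h2 x u hx => ?_⟩
  have hτ : 0 < τ := hT₀.trans_le h1
  rw [norm_heatField hτ, ← div_eq_mul_inv, le_div_iff₀ (by positivity)]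
  set s := ‖u - x‖ with hs
  have hs0 : 0 ≤ s := norm_nonneg _
  have hu : 1 + ‖u‖ ≤ (1 + A) * (1 + s) := by
    have : ‖u‖ ≤ s + A := by
      calc ‖u‖ = ‖(u - x) + x‖ := by congr 1; abel
        _ ≤ _ := (norm_add_le _ _).trans (by gcongr)
    nlinarith
  have hheat : heat τ (u - x) ≤ (√(Real.pi * T₀) ^ d)⁻¹ * Real.exp (-(T₁⁻¹ * s ^ 2)) := by
    rw [heat, ← hs, div_eq_inv_mul]
    gcongr
  have hp : (1 + s) ^ (N + 1) * Real.exp (-(T₁⁻¹ * s ^ 2)) ≤ 2 ^ (N + 1) * (1 + K) := by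
    have h3 := h s hs0
    have h4 : (1 + s) ^ (N + 1) ≤ 2 ^ (N + 1) * (1 + s ^ (N + 1)) := by
      rcases le_total s 1 with hs1 | hs1
      · calc (1 + s) ^ (N + 1) ≤ 2 ^ (N + 1) := by gcongr; linarith
          _ ≤ _ := le_mul_of_one_le_right (by positivity) (by linarith [pow_nonneg hs0 (N + 1)])
      · calc (1 + s) ^ (N + 1) ≤ (2 * s) ^ (N + 1) := by gcongr; linarith
          _ = 2 ^ (N + 1) * s ^ (N + 1) := mul_pow _ _ _
          _ ≤ _ := by gcongr; linarith
    have h5 : Real.exp (-(T₁⁻¹ * s ^ 2)) ≤ 1 :=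
      Real.exp_le_one_iff.2 (by rw [neg_nonpos]; positivity)
    calc _ ≤ 2 ^ (N + 1) * (1 + s ^ (N + 1)) * Real.exp (-(T₁⁻¹ * s ^ 2)) := by gcongr
      _ = 2 ^ (N + 1) * (Real.exp (-(T₁⁻¹ * s ^ 2)) +
          s ^ (N + 1) * Real.exp (-(T₁⁻¹ * s ^ 2))) := by ring
      _ ≤ _ := by gcongr
  calc _ ≤ s * ((√(Real.pi * T₀) ^ d)⁻¹ * Real.exp (-(T₁⁻¹ * s ^ 2))) *
        ((1 + A) * (1 + s)) ^ N := by gcongr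
    _ = (1 + A) ^ N * ((√(Real.pi * T₀) ^ d)⁻¹ *
        (s * (1 + s) ^ N * Real.exp (-(T₁⁻¹ * s ^ 2)))) := by rw [mul_pow]; ring
    _ ≤ (1 + A) ^ N * ((√(Real.pi * T₀) ^ d)⁻¹ *
        ((1 + s) ^ (N + 1) * Real.exp (-(T₁⁻¹ * s ^ 2)))) := by
        gcongr
        rw [pow_succ, mul_comm]
        gcongr
        linarith
    _ ≤ _ := by gcongr

theorem inner_heatField_integral {u τ : ℝ} (hu : 0 < u) (hτ : 0 < τ) (x y : Pl d) :
    Integrable (fun w => heat u w * inner ℝ w (heatField τ x (y - w))) ∧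
    ∫ w, heat u w * inner ℝ w (heatField τ x (y - w)) = u * τ * heatDot (u + τ) (y - x) := by
  have e : ∀ w, heat u w * inner ℝ w (heatField τ x (y - w)) =
      inner ℝ w (y - x - w) * (heat u w * heat τ (y - x - w)) := fun w => by
    rw [heatField, real_inner_smul_right, show y - w - x = y - x - w by abel]; ring
  refine ⟨?_, by simp only [e]; exact integral_inner_heat_mul_heat hu hτ (y - x)⟩
  have h1 := (integrable_heatField hτ x).comp_sub_left y
  obtain ⟨K, hK, h⟩ := exists_pow_mul_exp_neg_le 1 (inv_pos.2 hu)
  have hpi := Real.pi_pos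
  refine (h1.norm.const_mul (K * (√(Real.pi * u) ^ d)⁻¹)).mono' (by fun_prop)
    (Eventually.of_forall fun w => ?_)
  rw [norm_mul, Real.norm_of_nonneg (heat_pos hu _).le]
  have h2 := h ‖w‖ (norm_nonneg _)
  calc _ ≤ heat u w * (‖w‖ * ‖heatField τ x (y - w)‖) := by
        have := (heat_pos hu w).le
        gcongr; exact norm_inner_le_norm _ _
    _ = (√(Real.pi * u) ^ d)⁻¹ * (‖w‖ ^ 1 * Real.exp (-(u⁻¹ * ‖w‖ ^ 2))) *
        ‖heatField τ x (y - w)‖ := by rw [heat, div_eq_inv_mul]; ring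
    _ ≤ (√(Real.pi * u) ^ d)⁻¹ * K * ‖heatField τ x (y - w)‖ := by gcongr
    _ = _ := by ring

/-- Each Gaussian `heat (ξ²)` in the subordination formula pairs with the field to `ξ² τ heatDot (τ
+ ξ²)`, and the factor `ξ²` cancels the weight `ξ⁻²`. -/
theorem subConst_mul_rieszAvg (hd : 1 ≤ d) {τ : ℝ} (hτ : 0 < τ) (x y : Pl d) :
    subConst d * rieszAvg 0 (heatField τ x) y =
      √Real.pi ^ d * τ * ∫ ξ in Set.Ioi (0 : ℝ), heatDot (τ + ξ ^ 2) (y - x) := by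
  obtain ⟨L, hL0, hL⟩ := exists_heatField_lipschitz d hτ
  have hL := hL τ le_rfl x
  set h := heatField τ x with hh
  set Δ : Pl d → Pl d := fun w => h (y - w) - h (y + w) with hΔ
  have hΔm : Measurable Δ := by
    have : Continuous h := continuous_heatField τ x
    exact Continuous.measurable (by fun_prop)
  have hint := integrable_inner_rk hd hL hL0.le (continuous_heatField τ x).measurable
    (integrable_heatField hτ x) 0 y
  have hm : Measurable fun p : Pl d × ℝ =>
      (p.2 ^ 2)⁻¹ * (√Real.pi ^ d * heat (p.2 ^ 2) p.1) * (inner ℝ p.1 (Δ p.1) : ℝ) := by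
    have h1 : Measurable fun p : Pl d × ℝ => heat (p.2 ^ 2) p.1 :=
      measurable_heat_uncurry.comp (by fun_prop : Measurable fun p : Pl d × ℝ => (p.2 ^ 2, p.1))
    have h2 : Measurable fun p : Pl d × ℝ => (inner ℝ p.1 (Δ p.1) : ℝ) :=
      measurable_fst.inner (hΔm.comp measurable_fst)
    fun_prop
  -- Fubini requires the antisymmetrized field `Δ`: the integral in `ξ` of the absolute value is
  -- `subConst d * |⟨rk d 0 w, Δ w⟩|`, integrable because `Δ w = O(‖w‖)` near the origin.
  have hprod : Integrable (fun p : Pl d × ℝ =>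
      (p.2 ^ 2)⁻¹ * (√Real.pi ^ d * heat (p.2 ^ 2) p.1) * (inner ℝ p.1 (Δ p.1) : ℝ))
      (volume.prod (volume.restrict (Set.Ioi 0))) := by
    rw [integrable_prod_iff hm.aestronglyMeasurable]
    constructor
    · refine Eventually.of_forall fun w => ?_
      rcases eq_or_ne w 0 with rfl | hw
      · simp
      · have := (integrableOn_sub_heat (norm_pos_iff.2 hw)).mul_const (inner ℝ w (Δ w))
        exact this
    · refine (hint.norm.const_mul (subConst d)).congr (Eventually.of_forall fun w => ?_)
      simp only
      rcases eq_or_ne w 0 with rfl | hw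
      · simp [rk]
      have hw' : 0 < ‖w‖ := norm_pos_iff.2 hw
      have e1 : ∀ ξ ∈ Set.Ioi (0 : ℝ),
          ‖(ξ ^ 2)⁻¹ * (√Real.pi ^ d * heat (ξ ^ 2) w) * (inner ℝ w (Δ w) : ℝ)‖ =
          (ξ ^ 2)⁻¹ * (√Real.pi ^ d * heat (ξ ^ 2) w) * |(inner ℝ w (Δ w) : ℝ)| := by
        intro ξ hξ
        have hξ0 : (0 : ℝ) < ξ := hξ
        have := heat_pos (pow_pos hξ0 2) w
        rw [norm_mul, Real.norm_of_nonneg (by positivity), Real.norm_eq_abs]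
      rw [setIntegral_congr_fun measurableSet_Ioi e1, integral_mul_const, integral_sub_heat hw',
        rk, real_inner_smul_left, max_eq_right (norm_nonneg _), norm_mul,
        Real.norm_of_nonneg (by positivity), Real.norm_eq_abs]
      ring
  have e1 : subConst d * rieszAvg 0 h y = (1 / 2) * ∫ w, ∫ ξ in Set.Ioi (0 : ℝ),
      (ξ ^ 2)⁻¹ * (√Real.pi ^ d * heat (ξ ^ 2) w) * (inner ℝ w (Δ w) : ℝ) := by
    rw [rieszAvg, mul_left_comm, ← integral_const_mul]
    congr 1
    exact integral_congr_ae (Eventually.of_forall fun w => integral_sub_heat_smul w (Δ w))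
  rw [e1, integral_integral_swap hprod, ← integral_const_mul, ← integral_const_mul]
  refine setIntegral_congr_fun measurableSet_Ioi fun ξ hξ => ?_
  have hξ0 : (0 : ℝ) < ξ := hξ
  have hξ2 : 0 < ξ ^ 2 := by positivity
  obtain ⟨i1, v1⟩ := inner_heatField_integral hξ2 hτ x y
  have e3 : ∀ w, heat (ξ ^ 2) w * (inner ℝ w (h (y + w)) : ℝ) =
      -(fun w => heat (ξ ^ 2) w * (inner ℝ w (h (y - w)) : ℝ)) (-w) := fun w => by
    simp only [heat_neg, inner_neg_left, sub_neg_eq_add]; ring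
  have i2 : Integrable fun w => heat (ξ ^ 2) w * (inner ℝ w (h (y + w)) : ℝ) := by
    simp only [e3]
    exact i1.comp_neg.neg
  have v2 : ∫ w, heat (ξ ^ 2) w * (inner ℝ w (h (y + w)) : ℝ) =
      -(ξ ^ 2 * τ * heatDot (ξ ^ 2 + τ) (y - x)) := by
    simp only [e3]
    rw [integral_neg, integral_neg_eq_self
      (fun w => heat (ξ ^ 2) w * (inner ℝ w (h (y - w)) : ℝ)), v1]
  have e4 : ∀ w, (ξ ^ 2)⁻¹ * (√Real.pi ^ d * heat (ξ ^ 2) w) * (inner ℝ w (Δ w) : ℝ) =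
      (ξ ^ 2)⁻¹ * √Real.pi ^ d * (heat (ξ ^ 2) w * (inner ℝ w (h (y - w)) : ℝ) -
        heat (ξ ^ 2) w * (inner ℝ w (h (y + w)) : ℝ)) := fun w => by
    simp only [hΔ, inner_sub_right]; ring
  simp only [e4]
  rw [integral_const_mul, integral_sub i1 i2, v1, v2, add_comm (ξ ^ 2) τ]
  field_simp
  ring

end Subordination

/-! ### Abel inversion of the half-order derivative -/

section Abel

variable {d : ℕ}

theorem exists_abs_heatDot_le' (hd : 1 ≤ d) {t : ℝ} (ht : 0 < t) : ∃ K : ℝ, 0 < K ∧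
    ∀ s, t ≤ s → ∀ X : Pl d, |heatDot s X| ≤ K * (s * √s)⁻¹ := by
  obtain ⟨K, hK, h⟩ := exists_abs_heatDot_le d
  refine ⟨K * (√t ^ (d - 1))⁻¹, by positivity, fun s hs X => ?_⟩
  have hs0 : 0 < s := ht.trans_le hs
  refine (h s hs0 X).trans ?_
  have e : √s ^ d = √s ^ (d - 1) * √s := by rw [← pow_succ]; congr 1; omega
  calc K * s⁻¹ * (√s ^ d)⁻¹ = K * (√s ^ (d - 1))⁻¹ * (s * √s)⁻¹ := by
        rw [e, mul_inv, mul_inv]; ring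
    _ ≤ _ := by gcongr

theorem hasDerivAt_heat_comp_sq {t : ℝ} (ht : 0 < t) (X : Pl d) (r : ℝ) :
    HasDerivAt (fun r => heat (t + r ^ 2) X / 2) (r * heatDot (t + r ^ 2) X) r := by
  have h1 : HasDerivAt (fun r : ℝ => t + r ^ 2) (2 * r) r := by
    simpa using (hasDerivAt_pow 2 r).const_add t
  have h2 := (hasDerivAt_heat (show 0 < t + r ^ 2 by positivity) X).comp r h1
  exact (h2.div_const 2).congr_deriv (by ring)

theorem integral_mul_heatDot_add_sq (hd : 1 ≤ d) {t : ℝ} (ht : 0 < t) (X : Pl d) :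
    ∫ r in Set.Ioi (0 : ℝ), r * heatDot (t + r ^ 2) X = -(heat t X / 2) := by
  obtain ⟨K, hK, h⟩ := exists_abs_heatDot_le' hd ht
  have hm : Measurable fun r : ℝ => r * heatDot (t + r ^ 2) X :=
    measurable_id.mul (measurable_heatDot_uncurry.comp
      (by fun_prop : Measurable fun r : ℝ => (t + r ^ 2, X)))
  have hint : IntegrableOn (fun r : ℝ => r * heatDot (t + r ^ 2) X) (Set.Ioi 0) := by
    have hmin : 0 < min t 1 := lt_min ht one_pos
    refine ((integrable_inv_one_add_sq.const_mul (K * (min t 1)⁻¹)).mono' hm.aestronglyMeasurable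
      (Eventually.of_forall fun r => ?_)).integrableOn
    rw [norm_mul, Real.norm_eq_abs, Real.norm_eq_abs]
    have hs : 0 < t + r ^ 2 := by positivity
    have h1 := h (t + r ^ 2) (by linarith [sq_nonneg r]) X
    have h2 : |r| ≤ √(t + r ^ 2) := Real.abs_le_sqrt (by linarith)
    have h3 : min t 1 * (1 + r ^ 2) ≤ t + r ^ 2 := by
      nlinarith [min_le_left t 1, min_le_right t 1, sq_nonneg r]
    calc _ ≤ √(t + r ^ 2) * (K * ((t + r ^ 2) * √(t + r ^ 2))⁻¹) := by gcongr
      _ = K * (t + r ^ 2)⁻¹ := by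
          have : 0 < √(t + r ^ 2) := by positivity
          field_simp
      _ ≤ K * (min t 1 * (1 + r ^ 2))⁻¹ := by gcongr
      _ = _ := by rw [mul_inv]; ring
  have hlim : Tendsto (fun r : ℝ => heat (t + r ^ 2) X / 2) atTop (𝓝 0) := by
    have hpi := Real.pi_pos
    have h1 : Tendsto (fun r : ℝ => √(Real.pi * (t + r ^ 2)) ^ d) atTop atTop :=
      (tendsto_pow_atTop (by omega)).comp (Real.tendsto_sqrt_atTop.comp
        ((tendsto_atTop_add_const_left _ t (tendsto_pow_atTop two_ne_zero)).const_mul_atTop hpi))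
    have h2 : Tendsto (fun r : ℝ => (√(Real.pi * (t + r ^ 2)) ^ d)⁻¹ / 2) atTop (𝓝 0) := by
      simpa using h1.inv_tendsto_atTop.div_const 2
    refine squeeze_zero (fun r => (half_pos (heat_pos (by positivity) X)).le) (fun r => ?_) h2
    have := heat_le (show 0 < t + r ^ 2 by positivity) X
    linarith
  have := integral_Ioi_of_hasDerivAt_of_tendsto
    (hasDerivAt_heat_comp_sq ht X 0).continuousAt.continuousWithinAt
    (fun r _ => hasDerivAt_heat_comp_sq ht X r) hint hlim
  rw [this]; simp

/-- In polar coordinates the radial integrand is the derivative of `heat (t + r²) X / 2`, which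
vanishes at infinity since `d ≥ 1`; the angle contributes `2π`. This is why two successive
half-order integrations undo one time derivative. -/
theorem integral_heatDot_add_sq_add_sq (hd : 1 ≤ d) {t : ℝ} (ht : 0 < t) (X : Pl d) :
    ∫ p : ℝ × ℝ, heatDot (t + p.1 ^ 2 + p.2 ^ 2) X = -(Real.pi * heat t X) := by
  rw [← integral_comp_polarCoord_symm]
  have e : ∀ p : ℝ × ℝ, p.1 • heatDot (t + (polarCoord.symm p).1 ^ 2 + (polarCoord.symm p).2 ^ 2) X =
      (p.1 * heatDot (t + p.1 ^ 2) X) * (fun _ => (1 : ℝ)) p.2 := fun p => by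
    have : t + (polarCoord.symm p).1 ^ 2 + (polarCoord.symm p).2 ^ 2 = t + p.1 ^ 2 := by
      simp only [polarCoord_symm_apply]
      have := Real.sin_sq_add_cos_sq p.2
      linear_combination p.1 ^ 2 * this
    rw [this]; simp
  simp only [e]
  rw [polarCoord_target, Measure.volume_eq_prod, setIntegral_prod_mul
    (fun r => r * heatDot (t + r ^ 2) X) (fun _ => (1 : ℝ)), integral_mul_heatDot_add_sq hd ht]
  have hpi := Real.pi_pos
  simp [hpi.le]
  ring

theorem integrable_inv_add_sq_mul_sqrt {t : ℝ} (ht : 0 < t) : Integrable fun p : ℝ × ℝ =>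
    ((t + p.1 ^ 2 + p.2 ^ 2) * √(t + p.1 ^ 2 + p.2 ^ 2))⁻¹ := by
  have hj := integrable_one_add_norm (E := ℝ × ℝ) (μ := volume) (r := 3) (by
    simp [Module.finrank_prod]; norm_num)
  set m := min t 1 with hm
  have hmin : 0 < m := lt_min ht one_pos
  refine (hj.const_mul ((m / 2) * √(m / 2))⁻¹).mono'
    (by fun_prop : Measurable _).aestronglyMeasurable (Eventually.of_forall fun p => ?_)
  have hs : 0 < t + p.1 ^ 2 + p.2 ^ 2 := by positivity
  rw [Real.norm_of_nonneg (by positivity)]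
  have h1 : m / 2 * (1 + ‖p‖) ^ 2 ≤ t + p.1 ^ 2 + p.2 ^ 2 := by
    -- The norm on `ℝ × ℝ` is the maximum norm.
    have h2 : ‖p‖ ^ 2 ≤ p.1 ^ 2 + p.2 ^ 2 := by
      rw [Prod.norm_def]
      rcases max_cases ‖p.1‖ ‖p.2‖ with ⟨h, _⟩ | ⟨h, _⟩ <;> rw [h, Real.norm_eq_abs, sq_abs] <;>
        nlinarith [sq_nonneg p.1, sq_nonneg p.2]
    have h3 : m * (1 + ‖p‖ ^ 2) ≤ t + p.1 ^ 2 + p.2 ^ 2 := by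
      nlinarith [min_le_left t 1, min_le_right t 1, sq_nonneg ‖p‖]
    nlinarith [sq_nonneg (1 - ‖p‖)]
  have h4 : √(m / 2) * (1 + ‖p‖) ≤ √(t + p.1 ^ 2 + p.2 ^ 2) := by
    apply Real.le_sqrt_of_sq_le
    rw [mul_pow, Real.sq_sqrt (by positivity)]
    exact h1
  have e : (1 + ‖p‖) ^ (-3 : ℝ) = ((1 + ‖p‖) ^ 3)⁻¹ := by
    rw [Real.rpow_neg (by positivity)]; norm_cast
  rw [e, ← mul_inv]
  refine inv_anti₀ (by positivity) ?_
  calc _ = (m / 2 * (1 + ‖p‖) ^ 2) * (√(m / 2) * (1 + ‖p‖)) := by ring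
    _ ≤ _ := by gcongr

variable {σ : Measure (Pl d)}

/-- The time derivative of `heatConv`. -/
def heatConvDot (σ : Measure (Pl d)) (s : ℝ) (x : Pl d) : ℝ := ∫ y, heatDot s (x - y) ∂σ

/-- The half-order time derivative of the Gaussian extension of `σ`. -/
def halfDeriv (σ : Measure (Pl d)) (τ : ℝ) (x : Pl d) : ℝ :=
  ∫ ξ in Set.Ioi (0 : ℝ), heatConvDot σ (τ + ξ ^ 2) x

theorem halfDeriv_eq (τ : ℝ) (x : Pl d) :
    2 * halfDeriv σ τ x = ∫ ξ, heatConvDot σ (τ + ξ ^ 2) x := by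
  have := integral_comp_abs (f := fun ξ => heatConvDot σ (τ + ξ ^ 2) x)
  simp only [sq_abs] at this
  rw [this, halfDeriv]

variable [IsFiniteMeasure σ]

theorem integrable_heatDot_prod (hd : 1 ≤ d) {t : ℝ} (ht : 0 < t) (x : Pl d) :
    Integrable (fun q : (ℝ × ℝ) × Pl d => heatDot (t + q.1.1 ^ 2 + q.1.2 ^ 2) (x - q.2))
      (volume.prod σ) := by
  obtain ⟨K, hK, h⟩ := exists_abs_heatDot_le' hd ht
  have hb : Integrable (fun q : (ℝ × ℝ) × Pl d => K *
      ((t + q.1.1 ^ 2 + q.1.2 ^ 2) * √(t + q.1.1 ^ 2 + q.1.2 ^ 2))⁻¹) (volume.prod σ) :=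
    ((integrable_inv_add_sq_mul_sqrt ht).comp_fst σ).const_mul K
  refine hb.mono' (measurable_heatDot_uncurry.comp (by fun_prop : Measurable
    fun q : (ℝ × ℝ) × Pl d => (t + q.1.1 ^ 2 + q.1.2 ^ 2, x - q.2))).aestronglyMeasurable
    (Eventually.of_forall fun q => h _ ?_ _)
  nlinarith [sq_nonneg q.1.1, sq_nonneg q.1.2]

theorem integrable_heatConvDot_add_sq_add_sq (hd : 1 ≤ d) {t : ℝ} (ht : 0 < t) (x : Pl d) :
    Integrable fun p : ℝ × ℝ => heatConvDot σ (t + p.1 ^ 2 + p.2 ^ 2) x :=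
  (integrable_heatDot_prod hd ht x).integral_prod_left

theorem integrable_halfDeriv_add_sq (hd : 1 ≤ d) {t : ℝ} (ht : 0 < t) (x : Pl d) :
    Integrable fun ζ : ℝ => halfDeriv σ (t + ζ ^ 2) x := by
  have h := (integrable_heatConvDot_add_sq_add_sq (σ := σ) hd ht x).integral_prod_left
  simp only [← halfDeriv_eq] at h
  refine (h.const_mul (1 / 2)).congr (Eventually.of_forall fun ζ => ?_)
  simp only; ring

/-- Abel inversion: a Gaussian extension is recovered from its half-order derivative. -/
theorem heatConv_eq_integral_halfDeriv (hd : 1 ≤ d) {t : ℝ} (ht : 0 < t) (x : Pl d) :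
    heatConv σ t x = -(2 / Real.pi) * ∫ ζ : ℝ, halfDeriv σ (t + ζ ^ 2) x := by
  have hpi := Real.pi_pos
  have h1 : ∫ p : ℝ × ℝ, heatConvDot σ (t + p.1 ^ 2 + p.2 ^ 2) x = -(Real.pi * heatConv σ t x) := by
    unfold heatConvDot
    rw [integral_integral_swap (integrable_heatDot_prod hd ht x)]
    simp only [integral_heatDot_add_sq_add_sq hd ht]
    rw [integral_neg, integral_const_mul, heatConv]
  rw [Measure.volume_eq_prod, integral_prod _ (integrable_heatConvDot_add_sq_add_sq hd ht x)] at h1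
  simp only [← halfDeriv_eq] at h1
  rw [integral_const_mul] at h1
  field_simp
  linarith

theorem integrable_heatDot_prod_Ioi (hd : 1 ≤ d) {τ : ℝ} (hτ : 0 < τ) (x : Pl d) :
    Integrable (fun q : ℝ × Pl d => heatDot (τ + q.1 ^ 2) (x - q.2))
      ((volume.restrict (Set.Ioi 0)).prod σ) := by
  obtain ⟨K, hK, h⟩ := exists_abs_heatDot_le' hd hτ
  have hmin : 0 < min τ 1 := lt_min hτ one_pos
  have hb : Integrable (fun q : ℝ × Pl d => K * (√τ)⁻¹ * (min τ 1)⁻¹ * (1 + q.1 ^ 2)⁻¹)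
      ((volume.restrict (Set.Ioi 0)).prod σ) :=
    ((integrable_inv_one_add_sq.integrableOn).comp_fst σ).const_mul _
  refine hb.mono' (measurable_heatDot_uncurry.comp (by fun_prop : Measurable
    fun q : ℝ × Pl d => (τ + q.1 ^ 2, x - q.2))).aestronglyMeasurable
    (Eventually.of_forall fun q => (h _ (by nlinarith [sq_nonneg q.1]) _).trans ?_)
  have h3 : min τ 1 * (1 + q.1 ^ 2) ≤ τ + q.1 ^ 2 := by
    nlinarith [min_le_left τ 1, min_le_right τ 1, sq_nonneg q.1]
  calc _ ≤ K * ((min τ 1 * (1 + q.1 ^ 2)) * √τ)⁻¹ := by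
        gcongr
        nlinarith [sq_nonneg q.1]
    _ = _ := by rw [mul_inv, mul_inv]; ring

theorem integrable_heatConvDot_add_sq (hd : 1 ≤ d) {τ : ℝ} (hτ : 0 < τ) (x : Pl d) :
    IntegrableOn (fun ξ : ℝ => heatConvDot σ (τ + ξ ^ 2) x) (Set.Ioi 0) :=
  (integrable_heatDot_prod_Ioi hd hτ x).integral_prod_left

/-- The bridge between the two halves of the proof: a bound for the pairing of `σ` with Gaussian
fields is a bound for the half-order derivative of its Gaussian extension. -/
theorem subConst_mul_integral_rieszAvg (hd : 1 ≤ d) {τ : ℝ} (hτ : 0 < τ) (x : Pl d) :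
    subConst d * ∫ y, rieszAvg 0 (heatField τ x) y ∂σ = √Real.pi ^ d * τ * halfDeriv σ τ x := by
  rw [← integral_const_mul]
  simp only [subConst_mul_rieszAvg hd hτ]
  rw [integral_const_mul, halfDeriv]
  congr 1
  unfold heatConvDot
  simp only [heatDot_sub_comm _ _ x]
  exact (integral_integral_swap (integrable_heatDot_prod_Ioi hd hτ x)).symm

theorem integrable_rieszAvg (hd : 1 ≤ d) {τ : ℝ} (hτ : 0 < τ) (x : Pl d) :
    Integrable (fun y => rieszAvg 0 (heatField τ x) y) σ := by
  have h := (integrable_heatDot_prod_Ioi (σ := σ) hd hτ x).integral_prod_right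
  refine (h.const_mul ((subConst d)⁻¹ * (√Real.pi ^ d * τ))).congr
    (Eventually.of_forall fun y => ?_)
  have hk := subConst_pos d
  have := subConst_mul_rieszAvg hd hτ x y
  simp only [heatDot_sub_comm _ x]
  rw [mul_assoc, ← this]
  field_simp

theorem integrable_heatDot_sub {s : ℝ} (hs : 0 < s) (x : Pl d) :
    Integrable (fun y => heatDot s (x - y)) σ := by
  obtain ⟨K, hK, h⟩ := exists_abs_heatDot_le d
  exact Integrable.of_bound (by fun_prop) _ (Eventually.of_forall fun y => h s hs _)

/-- The bound uses only the density of `σ` at scale `√(2 * s)` and never its total mass. This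
matters because the mass grows with `ρ`, which is chosen later. -/
theorem exists_abs_heatConvDot_sub_le (d : ℕ) : ∃ K : ℝ, 0 < K ∧
    ∀ (σ : Measure (Pl d)) [IsFiniteMeasure σ] (C₁ s : ℝ), 0 < s → 0 ≤ C₁ →
    (∀ w, σ (ball w √(2 * s)) ≤ ENNReal.ofReal (C₁ * √(2 * s) ^ d)) → ∀ x y : Pl d,
    |heatConvDot σ s x - heatConvDot σ s y| ≤ K * C₁ * ‖x - y‖ * (s * √s)⁻¹ := by
  obtain ⟨K, hK, h⟩ := exists_abs_heatDot_sub_le d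
  have hB := heatBd_pos d
  refine ⟨2 * K * heatBd d, by positivity, fun σ _ C₁ s hs hC hσ x y => ?_⟩
  have h2 : (0 : ℝ) < 2 * s := by positivity
  rw [heatConvDot, heatConvDot, ← integral_sub (integrable_heatDot_sub hs x)
    (integrable_heatDot_sub hs y)]
  have hi := (integrable_heat_sub (σ := σ) h2 x).add (integrable_heat_sub (σ := σ) h2 y)
  calc _ ≤ ∫ w, K / (s * √s) * ‖x - y‖ * (heat (2 * s) (x - w) + heat (2 * s) (y - w)) ∂σ := by
        rw [← Real.norm_eq_abs]
        refine norm_integral_le_of_norm_le (hi.const_mul _) (Eventually.of_forall fun w => ?_)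
        have := h s hs (x - w) (y - w)
        simpa using this
    _ = K / (s * √s) * ‖x - y‖ * (heatConv σ (2 * s) x + heatConv σ (2 * s) y) := by
        rw [integral_const_mul, integral_add (integrable_heat_sub h2 x) (integrable_heat_sub h2 y),
          heatConv, heatConv]
    _ ≤ K / (s * √s) * ‖x - y‖ * (C₁ * heatBd d + C₁ * heatBd d) := by
        gcongr
        · exact heatConv_le h2 hC hσ x
        · exact heatConv_le h2 hC hσ y
    _ = _ := by rw [div_eq_mul_inv]; ring

theorem integral_Ioi_inv_sq_add_sq {ζ : ℝ} (hζ : 0 < ζ) :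
    IntegrableOn (fun ξ : ℝ => (ζ ^ 2 + ξ ^ 2)⁻¹) (Set.Ioi 0) ∧
      ∫ ξ in Set.Ioi (0 : ℝ), (ζ ^ 2 + ξ ^ 2)⁻¹ = Real.pi / 2 * ζ⁻¹ := by
  have e : ∀ ξ : ℝ, (ζ ^ 2 + (ζ * ξ) ^ 2)⁻¹ = (ζ ^ 2)⁻¹ * (1 + ξ ^ 2)⁻¹ := fun ξ => by
    rw [← mul_inv]; congr 1; ring
  constructor
  · have := (integrableOn_Ioi_comp_mul_left_iff (fun ξ : ℝ => (ζ ^ 2 + ξ ^ 2)⁻¹) 0 hζ).1 (by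
      simp only [e]
      exact (integrable_inv_one_add_sq.const_mul _).integrableOn)
    simpa using this
  · have h := integral_comp_mul_left_Ioi (fun ξ : ℝ => (ζ ^ 2 + ξ ^ 2)⁻¹) 0 hζ
    rw [mul_zero, smul_eq_mul, eq_inv_mul_iff_mul_eq₀ hζ.ne'] at h
    rw [← h]
    simp only [e]
    rw [integral_const_mul, integral_Ioi_inv_one_add_sq]
    simp
    field_simp

/-- Abel inversion is applied to the difference of the values at `x` and `y`. For `|ζ| ≤ Z` the
integrand is at most `ε`. For `|ζ| > Z` the spatial difference gains a factor `1 / √s` in the time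
derivative, so the half-order derivatives differ by `O(B ζ⁻²)`, which is integrable at infinity. -/
theorem abs_heatConv_sub_le_of_halfDeriv (hd : 1 ≤ d) {t Z B ε : ℝ} (ht : 0 < t) (hZ : 0 < Z)
    (hB : 0 ≤ B) {x y : Pl d}
    (h1 : ∀ ζ, 0 < ζ → ζ ≤ Z → |halfDeriv σ (t + ζ ^ 2) x - halfDeriv σ (t + ζ ^ 2) y| ≤ ε)
    (h2 : ∀ s, t ≤ s → |heatConvDot σ s x - heatConvDot σ s y| ≤ B * (s * √s)⁻¹) :
    |heatConv σ t x - heatConv σ t y| ≤ 4 / Real.pi * (ε * Z) + 2 * B / Z := by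
  have hpi := Real.pi_pos
  set D : ℝ → ℝ := fun ζ => halfDeriv σ (t + ζ ^ 2) x - halfDeriv σ (t + ζ ^ 2) y with hD
  have hDi : Integrable D :=
    (integrable_halfDeriv_add_sq hd ht x).sub (integrable_halfDeriv_add_sq hd ht y)
  have hfar : ∀ ζ ∈ Set.Ioi Z, |D ζ| ≤ B * (Real.pi / 2) * ζ ^ (-2 : ℝ) := by
    intro ζ hζ
    have hζ0 : 0 < ζ := hZ.trans hζ
    have hτ : 0 < t + ζ ^ 2 := by positivity
    obtain ⟨hi, hv⟩ := integral_Ioi_inv_sq_add_sq hζ0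
    simp only [hD, halfDeriv]
    rw [← integral_sub (integrable_heatConvDot_add_sq hd hτ x)
      (integrable_heatConvDot_add_sq hd hτ y), ← Real.norm_eq_abs]
    calc _ ≤ ∫ ξ in Set.Ioi (0 : ℝ), B * ζ⁻¹ * (ζ ^ 2 + ξ ^ 2)⁻¹ := by
          refine norm_integral_le_of_norm_le (hi.const_mul _) (Eventually.of_forall fun ξ => ?_)
          refine (h2 _ (by nlinarith [sq_nonneg ζ, sq_nonneg ξ])).trans ?_
          -- With `s = t + ζ² + ξ²`, the product `s √s` is at least `(ζ² + ξ²) ζ`.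
          rw [mul_assoc, ← mul_inv]
          gcongr B * ?_
          apply inv_anti₀ (by positivity)
          rw [mul_comm]
          gcongr
          · linarith
          · apply Real.le_sqrt_of_sq_le; nlinarith [sq_nonneg ξ]
      _ = B * (Real.pi / 2) * (ζ⁻¹ * ζ⁻¹) := by rw [integral_const_mul, hv]; ring
      _ = _ := by
          rw [Real.rpow_neg hζ0.le, ← mul_inv]
          norm_cast
          rw [pow_two]
  have hsplit : ∫ ζ, |D ζ| ≤ 2 * (ε * Z + B * (Real.pi / 2) / Z) := by
    have e := integral_comp_abs (f := fun ζ => |D ζ|)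
    have e' : ∀ ζ : ℝ, abs (D (abs ζ)) = abs (D ζ) := fun ζ => by simp only [hD, sq_abs]
    simp only [e'] at e
    rw [e]
    have hu : Set.Ioi (0 : ℝ) = Set.Ioc 0 Z ∪ Set.Ioi Z := (Set.Ioc_union_Ioi_eq_Ioi hZ.le).symm
    rw [hu, setIntegral_union (Set.Ioc_disjoint_Ioi le_rfl) measurableSet_Ioi
      hDi.abs.integrableOn hDi.abs.integrableOn]
    gcongr
    · calc _ ≤ ∫ ζ in Set.Ioc 0 Z, ε :=
            setIntegral_mono_on hDi.abs.integrableOn (integrableOn_const (by simp)) measurableSet_Ioc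
              fun ζ hζ => h1 ζ hζ.1 hζ.2
        _ = _ := by simp [hZ.le, mul_comm]
    · have hr := integrableOn_Ioi_rpow_of_lt (show (-2 : ℝ) < -1 by norm_num) hZ
      calc _ ≤ ∫ ζ in Set.Ioi Z, B * (Real.pi / 2) * ζ ^ (-2 : ℝ) :=
            setIntegral_mono_on hDi.abs.integrableOn (hr.const_mul _) measurableSet_Ioi hfar
        _ = _ := by
            rw [integral_const_mul, integral_Ioi_rpow_of_lt (by norm_num) hZ]
            have : ((-2 : ℝ) + 1) = -1 := by norm_num
            rw [this, Real.rpow_neg_one]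
            field_simp
  rw [heatConv_eq_integral_halfDeriv hd ht, heatConv_eq_integral_halfDeriv hd ht, ← mul_sub,
    ← integral_sub (integrable_halfDeriv_add_sq hd ht x) (integrable_halfDeriv_add_sq hd ht y),
    abs_mul, abs_neg, abs_of_pos (by positivity : 0 < 2 / Real.pi)]
  calc _ ≤ 2 / Real.pi * (2 * (ε * Z + B * (Real.pi / 2) / Z)) := by
        gcongr
        exact (abs_integral_le_integral_abs).trans hsplit
    _ = _ := by field_simp; ring

end Abel

/-! ### Calculus of bounded Lipschitz maps and cutoffs -/

/-- `f` is bounded by `M` and Lipschitz with constant `L`. -/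
structure BddLip {X F : Type*} [NormedAddCommGroup X] [NormedAddCommGroup F] (f : X → F)
    (M L : ℝ) : Prop where
  bdd : ∀ x, ‖f x‖ ≤ M
  lip : ∀ x y, ‖f x - f y‖ ≤ L * ‖x - y‖

namespace BddLip

variable {X F : Type*} [NormedAddCommGroup X] [NormedAddCommGroup F] {f g : X → F}
  {M L M' L' : ℝ}

theorem nonneg (hf : BddLip f M L) : 0 ≤ M := (norm_nonneg _).trans (hf.bdd 0)

theorem continuous (hf : BddLip f M L) : Continuous f := by
  refine (LipschitzWith.of_dist_le_mul (K := Real.toNNReal L) fun x y => ?_).continuous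
  rw [dist_eq_norm, dist_eq_norm]
  refine (hf.lip x y).trans ?_
  gcongr
  exact Real.le_coe_toNNReal L

theorem mono (hf : BddLip f M L) (hM : M ≤ M') (hL : L ≤ L') : BddLip f M' L' :=
  ⟨fun x => (hf.bdd x).trans hM, fun x y => (hf.lip x y).trans (by gcongr)⟩

theorem sub (hf : BddLip f M L) (hg : BddLip g M' L') :
    BddLip (fun x => f x - g x) (M + M') (L + L') :=
  ⟨fun x => (norm_sub_le _ _).trans (add_le_add (hf.bdd x) (hg.bdd x)), fun x y => by
    have e : f x - g x - (f y - g y) = (f x - f y) - (g x - g y) := by abel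
    rw [e, add_mul]
    exact (norm_sub_le _ _).trans (add_le_add (hf.lip x y) (hg.lip x y))⟩

theorem const (a : F) : BddLip (fun _ : X => a) ‖a‖ 0 := ⟨fun _ => le_rfl, fun _ _ => by simp⟩

theorem smul [NormedSpace ℝ F] {c : X → ℝ} (hc : BddLip c M L) (hf : BddLip f M' L') :
    BddLip (fun x => c x • f x) (M * M') (M * L' + L * M') := by
  have h1 := hc.nonneg
  refine ⟨fun x => ?_, fun x y => ?_⟩
  · rw [norm_smul]
    have := hc.bdd x
    have := hf.bdd x
    gcongr
  · have e : c x • f x - c y • f y = c x • (f x - f y) + (c x - c y) • f y := by module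
    rw [e]
    refine (norm_add_le _ _).trans ?_
    rw [norm_smul, norm_smul]
    have h2 := hc.bdd x
    have h3 := hf.lip x y
    have h4 := hc.lip x y
    have h5 := hf.bdd y
    have h6 := (norm_nonneg _).trans h4
    calc _ ≤ M * (L' * ‖x - y‖) + (L * ‖x - y‖) * M' := by gcongr
      _ = _ := by ring

theorem inner [InnerProductSpace ℝ F] (hf : BddLip f M L) (hg : BddLip g M' L') :
    BddLip (fun x => (Inner.inner ℝ (f x) (g x) : ℝ)) (M * M') (M * L' + L * M') := by
  have h1 := hf.nonneg
  refine ⟨fun x => ?_, fun x y => ?_⟩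
  · refine (norm_inner_le_norm _ _).trans ?_
    have := hf.bdd x
    have := hg.bdd x
    gcongr
  · have e : (Inner.inner ℝ (f x) (g x) : ℝ) - Inner.inner ℝ (f y) (g y) =
        Inner.inner ℝ (f x) (g x - g y) + Inner.inner ℝ (f x - f y) (g y) := by
      rw [inner_sub_right, inner_sub_left]; ring
    rw [e]
    refine (norm_add_le _ _).trans ?_
    have h2 := hf.bdd x
    have h3 := hg.lip x y
    have h4 := hf.lip x y
    have h5 := hg.bdd y
    have h6 := (norm_nonneg _).trans h4
    calc _ ≤ ‖f x‖ * ‖g x - g y‖ + ‖f x - f y‖ * ‖g y‖ :=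
          add_le_add (norm_inner_le_norm _ _) (norm_inner_le_norm _ _)
      _ ≤ M * (L' * ‖x - y‖) + (L * ‖x - y‖) * M' := by gcongr
      _ = _ := by ring

theorem integrable [MeasurableSpace X] [OpensMeasurableSpace X] [SecondCountableTopology X]
    (hf : BddLip f M L) (μ : Measure X) [IsFiniteMeasure μ] : Integrable f μ :=
  Integrable.of_bound hf.continuous.aestronglyMeasurable M (Eventually.of_forall hf.bdd)

end BddLip

section Cutoff

variable {d : ℕ}

/-- The piecewise linear cutoff that is `1` on the ball of radius `D` and `0` off that of radius
`2 D`. -/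
def cutoff {X : Type*} [NormedAddCommGroup X] (D : ℝ) (u : X) : ℝ := max 0 (min 1 (2 - ‖u‖ / D))

variable {X : Type*} [NormedAddCommGroup X] {D : ℝ}

theorem cutoff_nonneg (D : ℝ) (u : X) : 0 ≤ cutoff D u := le_max_left _ _

theorem cutoff_le_one (D : ℝ) (u : X) : cutoff D u ≤ 1 :=
  max_le zero_le_one (min_le_left _ _)

theorem cutoff_eq_one (hD : 0 < D) {u : X} (hu : ‖u‖ ≤ D) : cutoff D u = 1 := by
  have : ‖u‖ / D ≤ 1 := (div_le_one hD).2 hu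
  rw [cutoff, min_eq_left (by linarith), max_eq_right zero_le_one]

theorem cutoff_eq_zero (hD : 0 < D) {u : X} (hu : 2 * D ≤ ‖u‖) : cutoff D u = 0 := by
  have : 2 ≤ ‖u‖ / D := (le_div_iff₀ hD).2 hu
  rw [cutoff, min_eq_right (by linarith), max_eq_left (by linarith)]

theorem bddLip_cutoff (hD : 1 ≤ D) : BddLip (cutoff D : X → ℝ) 1 1 := by
  have hD0 : 0 < D := by linarith
  refine ⟨fun u => ?_, fun x y => ?_⟩
  · rw [Real.norm_of_nonneg (cutoff_nonneg D u)]; exact cutoff_le_one D u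
  · rw [Real.norm_eq_abs, cutoff, cutoff, max_comm 0, max_comm 0]
    refine (abs_max_sub_max_le_abs _ _ _).trans ?_
    rw [min_comm 1, min_comm 1]
    refine (abs_min_sub_min_le_max _ _ _ _).trans ?_
    rw [sub_self, abs_zero, max_eq_left (abs_nonneg _)]
    have e : 2 - ‖x‖ / D - (2 - ‖y‖ / D) = -((‖x‖ - ‖y‖) / D) := by ring
    rw [e, abs_neg, abs_div, abs_of_pos hD0, one_mul]
    calc _ ≤ |‖x‖ - ‖y‖| / 1 := by gcongr
      _ = |‖x‖ - ‖y‖| := div_one _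
      _ ≤ _ := abs_norm_sub_norm_le x y

end Cutoff

/-! ### Truncated Riesz potentials of planar measures -/

section Potential

variable {d : ℕ} {σ : Measure (Pl d)}

/-- The truncated Riesz potential of a measure on `ℝ^d`. -/
def rpot (σ : Measure (Pl d)) (δ : ℝ) (u : Pl d) : Pl d := ∫ w, rk d δ (u - w) ∂σ

variable [IsFiniteMeasure σ]

theorem integrable_rk {δ : ℝ} (hδ : 0 < δ) (u : Pl d) : Integrable (fun w => rk d δ (u - w)) σ :=
  Integrable.of_bound ((continuous_rk hδ).comp (by fun_prop)).aestronglyMeasurable _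
    (Eventually.of_forall fun _ => norm_rk_le hδ _)

theorem bddLip_rpot {δ m : ℝ} (hδ : 0 < δ) (hm : σ.real Set.univ ≤ m) :
    BddLip (rpot σ δ) ((δ ^ d)⁻¹ * m) ((d + 2) * (δ ^ (d + 1))⁻¹ * m) := by
  refine ⟨fun u => ?_, fun u v => ?_⟩
  · refine (norm_integral_le_of_norm_le_const (Eventually.of_forall fun w =>
      norm_rk_le hδ (u - w))).trans ?_
    gcongr
  · rw [rpot, rpot, ← integral_sub (integrable_rk hδ u) (integrable_rk hδ v)]
    refine (norm_integral_le_of_norm_le_const (C := (d + 2) * (δ ^ (d + 1))⁻¹ * ‖u - v‖)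
      (Eventually.of_forall fun w => ?_)).trans ?_
    · have := norm_rk_sub_le' (d := d) hδ (u - w) (v - w)
      simpa using this
    · calc _ ≤ (d + 2) * (δ ^ (d + 1))⁻¹ * ‖u - v‖ * m := by gcongr
        _ = _ := by ring

theorem integrable_inner_rk_prod {δ : ℝ} (hδ : 0 < δ) {H : Pl d → Pl d} (hm : Measurable H)
    (hi : Integrable H) : Integrable
      (fun p : Pl d × Pl d => (inner ℝ (rk d δ (p.1 - p.2)) (H p.1) : ℝ)) (volume.prod σ) := by
  have hb : Integrable (fun p : Pl d × Pl d => (δ ^ d)⁻¹ * ‖H p.1‖) (volume.prod σ) :=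
    (hi.norm.comp_fst σ).const_mul _
  refine hb.mono' (((measurable_rk.comp (measurable_fst.sub measurable_snd)).inner
    (hm.comp measurable_fst)).aestronglyMeasurable) (Eventually.of_forall fun p => ?_)
  refine (norm_inner_le_norm _ _).trans ?_
  gcongr
  exact norm_rk_le hδ _

theorem integral_inner_rk_sub {δ : ℝ} (hδ : 0 < δ) {H : Pl d → Pl d} (hm : Measurable H)
    (hi : Integrable H) (y : Pl d) :
    ∫ z, (inner ℝ (rk d δ (z - y)) (H z) : ℝ) = -rieszAvg δ H y := by
  rw [rieszAvg_eq hm hi hδ, ← integral_neg,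
    ← integral_sub_left_eq_self (fun z => (inner ℝ (rk d δ (z - y)) (H z) : ℝ)) volume y]
  refine integral_congr_ae (Eventually.of_forall fun w => ?_)
  simp only
  rw [show y - w - y = -w by abel, rk_neg, inner_neg_left]

theorem integral_inner_rpot {δ : ℝ} (hδ : 0 < δ) {H : Pl d → Pl d} (hm : Measurable H)
    (hi : Integrable H) :
    Integrable (rieszAvg δ H) σ ∧
    ∫ z, (inner ℝ (rpot σ δ z) (H z) : ℝ) = -∫ y, rieszAvg δ H y ∂σ := by
  have hp := integrable_inner_rk_prod (σ := σ) hδ hm hi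
  constructor
  · refine hp.integral_prod_right.neg.congr (Eventually.of_forall fun y => ?_)
    simp only [Pi.neg_apply]
    rw [integral_inner_rk_sub hδ hm hi, neg_neg]
  · have e : ∀ z, (inner ℝ (rpot σ δ z) (H z) : ℝ) = ∫ y, inner ℝ (rk d δ (z - y)) (H z) ∂σ :=
      fun z => by
        rw [rpot, real_inner_comm, ← integral_inner (integrable_rk hδ z)]
        simp only [real_inner_comm]
    simp only [e]
    rw [integral_integral_swap hp, ← integral_neg]
    exact integral_congr_ae (Eventually.of_forall fun y => integral_inner_rk_sub hδ hm hi y)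

/-- Fubini moves the kernel from `σ` to the field, with a sign because the kernel is odd. Truncation
and cutoff are then removed pointwise by `abs_rieszAvg_sub_le`. -/
theorem abs_integral_inner_rpot_add_le (hd : 1 ≤ d) {h H : Pl d → Pl d} {L m : ℝ}
    (hL0 : 0 ≤ L) (hL : ∀ a b, ‖h a - h b‖ ≤ L * ‖a - b‖)
    (hm : Measurable h) (hi : Integrable h) (hL' : ∀ a b, ‖H a - H b‖ ≤ L * ‖a - b‖)
    (hm' : Measurable H) (hi' : Integrable H) (hav : Integrable (rieszAvg 0 h) σ) {δ θ : ℝ}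
    (hδ : 0 < δ) (hθ : 0 < θ) (hδθ : δ ≤ θ) (hmass : σ.real Set.univ ≤ m) :
    |(∫ z, (inner ℝ (rpot σ δ z) (H z) : ℝ)) + ∫ y, rieszAvg 0 h y ∂σ| ≤
      (2 * L * (unitVol d * 2 ^ d * θ) + (θ ^ d)⁻¹ * ∫ u, ‖H u - h u‖) * m := by
  have hv := unitVol_pos d
  obtain ⟨i1, e1⟩ := integral_inner_rpot (σ := σ) hδ hm' hi'
  have h0 : 0 ≤ ∫ u, ‖H u - h u‖ := integral_nonneg fun _ => norm_nonneg _
  rw [e1, neg_add_eq_sub, ← integral_sub hav i1, ← Real.norm_eq_abs]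
  refine (norm_integral_le_of_norm_le_const (Eventually.of_forall fun y => ?_)).trans
    (mul_le_mul_of_nonneg_left hmass ?_)
  · rw [Real.norm_eq_abs, abs_sub_comm]
    exact abs_rieszAvg_sub_le hd hL hL0 hm hi hL' hm' hi' hθ hδθ y
  · positivity

end Potential

/-! ### Exchanging Lebesgue measure for the mollified measure -/

section LocalComparison

variable {d : ℕ} {σ : Measure (Pl d)} [IsFiniteMeasure σ]

theorem integral_mul_abs_heatConv_sub_le {s t η R : ℝ} (hs : 0 < s) (ht : 0 < t) (hη : 0 < η)
    (hst : ∫ x, (heatConv σ s x - heatConv σ t x) ^ 2 ≤ η ^ 2) {w : Pl d → ℝ} (hw : Continuous w)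
    {W : ℝ} (hW : ∀ x, |w x| ≤ W) :
    ∫ x in ball 0 R, w x * |heatConv σ s x - heatConv σ t x| ≤
      η / 2 * ((∫ x in ball 0 R, w x ^ 2) + 1) := by
  have hi1 : Integrable fun x => (heatConv σ s x - heatConv σ t x) ^ 2 := by
    refine (((integrable_heatConv_mul (σ := σ) hs hs).sub ((integrable_heatConv_mul (σ := σ) hs ht).const_mul 2)).add
      (integrable_heatConv_mul (σ := σ) ht ht)).congr (Eventually.of_forall fun x => ?_)
    simp only [Pi.add_apply, Pi.sub_apply]; ring
  have hi2 : IntegrableOn (fun x => w x ^ 2) (ball 0 R) := by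
    refine Measure.integrableOn_of_bounded (M := W ^ 2) measure_ball_lt_top.ne
      (by fun_prop) (Eventually.of_forall fun x => ?_)
    rw [Real.norm_of_nonneg (sq_nonneg _), ← sq_abs]
    have := hW x
    gcongr
  have hc1 := continuous_heatConv (σ := σ) hs
  have hc2 := continuous_heatConv (σ := σ) ht
  calc _ ≤ ∫ x in ball 0 R, (η / 2 * w x ^ 2 +
        (2 * η)⁻¹ * (heatConv σ s x - heatConv σ t x) ^ 2) := by
        have hadd := (hi2.const_mul (η / 2)).add (hi1.integrableOn (s := ball 0 R) |>.const_mul (2 * η)⁻¹)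
        have hpt : ∀ x, abs (w x * abs (heatConv σ s x - heatConv σ t x)) ≤ η / 2 * w x ^ 2 +
            (2 * η)⁻¹ * (heatConv σ s x - heatConv σ t x) ^ 2 := fun x => by
          rw [abs_mul, abs_abs, ← sq_abs (w x), ← sq_abs (heatConv σ s x - heatConv σ t x),
            ← sub_nonneg]
          have : η / 2 * |w x| ^ 2 + (2 * η)⁻¹ * |heatConv σ s x - heatConv σ t x| ^ 2 -
              |w x| * |heatConv σ s x - heatConv σ t x| =
              (2 * η)⁻¹ * (η * |w x| - |heatConv σ s x - heatConv σ t x|) ^ 2 := by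
            field_simp; ring
          rw [this]; positivity
        refine integral_mono (hadd.mono' (by fun_prop) (Eventually.of_forall hpt)) hadd
          fun x => (le_abs_self _).trans (hpt x)
    _ = η / 2 * (∫ x in ball 0 R, w x ^ 2) +
        (2 * η)⁻¹ * ∫ x in ball 0 R, (heatConv σ s x - heatConv σ t x) ^ 2 := by
        rw [integral_add (hi2.const_mul _) (hi1.integrableOn.const_mul _), integral_const_mul,
          integral_const_mul]
    _ ≤ η / 2 * (∫ x in ball 0 R, w x ^ 2) + (2 * η)⁻¹ * η ^ 2 := by
        gcongr
        exact (setIntegral_le_integral hi1 (Eventually.of_forall fun x => sq_nonneg _)).trans hst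
    _ = _ := by field_simp

/-- A globally defined inverse of the density `p`, correct where `p ≥ c`. -/
def truncInv (c : ℝ) (p : Pl d → ℝ) (u : Pl d) : ℝ := (max c (p u))⁻¹

omit [IsFiniteMeasure σ] in
theorem bddLip_truncInv {c K : ℝ} (hc : 0 < c) {p : Pl d → ℝ}
    (hp : ∀ x y, |p x - p y| ≤ K * ‖x - y‖) : BddLip (truncInv c p) c⁻¹ (K / c ^ 2) := by
  have hpos : ∀ u, 0 < max c (p u) := fun u => lt_max_of_lt_left hc
  refine ⟨fun u => ?_, fun x y => ?_⟩
  · have := hpos u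
    rw [truncInv, Real.norm_of_nonneg (by positivity)]
    gcongr
    exact le_max_left _ _
  · have hx := hpos x
    have hy := hpos y
    have e : truncInv c p x - truncInv c p y =
        (max c (p y) - max c (p x)) * ((max c (p x))⁻¹ * (max c (p y))⁻¹) := by
      rw [truncInv, truncInv]; field_simp
    rw [e, norm_mul, Real.norm_eq_abs, Real.norm_of_nonneg (by positivity)]
    have h1 : |max c (p y) - max c (p x)| ≤ K * ‖x - y‖ := by
      rw [max_comm c, max_comm c, norm_sub_rev]
      exact (abs_max_sub_max_le_abs _ _ _).trans (hp y x)
    calc _ ≤ K * ‖x - y‖ * (c⁻¹ * c⁻¹) := by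
          gcongr
          · exact (abs_nonneg _).trans h1
          · exact le_max_left _ _
          · exact le_max_left _ _
      _ = _ := by field_simp

/-- Where `p_r = heatConv σ r` is at least `c`, the truncated inverse is exact and `k - p_{r'} k /
p_r = ((p_r - p_{r'}) / p_r) k`, so only the `L²` closeness of the two mollifications is needed. The
weight `w` measures the size of `k`; it is `‖rpot σ δ‖` in one application and `1` in the other. -/
theorem norm_integral_sub_integral_heatConv_smul_le {F : Type*} [NormedAddCommGroup F]
    [NormedSpace ℝ F] [CompleteSpace F] {r r' η R c b K : ℝ} (hr : 0 < r) (hr' : 0 < r')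
    (hη : 0 < η) (hc : 0 < c)
    (hK : ∀ x y, |heatConv σ r x - heatConv σ r y| ≤ K * ‖x - y‖)
    (hlow : ∀ x ∈ ball (0 : Pl d) R, c ≤ heatConv σ r x)
    (hst : ∫ x, (heatConv σ r' x - heatConv σ r x) ^ 2 ≤ η ^ 2) {w : Pl d → ℝ} (hw : Continuous w)
    {W : ℝ} (hW : ∀ x, |w x| ≤ W) {k : Pl d → F} (hk : Continuous k) (hk0 : ∀ x ∉ ball 0 R, k x = 0)
    (hkw : ∀ x, ‖k x‖ ≤ b * w x) (hb : 0 ≤ b) :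
    ‖(∫ x, k x) - ∫ x, heatConv σ r' x • (truncInv c (heatConv σ r) x • k x)‖ ≤
      b / c * (η / 2 * ((∫ x in ball 0 R, w x ^ 2) + 1)) := by
  have hc1 := continuous_heatConv (σ := σ) hr
  have hc2 := continuous_heatConv (σ := σ) hr'
  have hti := (bddLip_truncInv hc hK)
  have hcti := hti.continuous
  have hbd : ∀ x, ‖k x‖ ≤ b * W := fun x => (hkw x).trans (by
    gcongr; exact (le_abs_self _).trans (hW x))
  have hki : Integrable k := by
    rw [← integrableOn_iff_integrable_of_support_subset (s := ball 0 R)]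
    · exact Measure.integrableOn_of_bounded measure_ball_lt_top.ne hk.aestronglyMeasurable
        (Eventually.of_forall hbd)
    · intro x hx
      by_contra h
      exact hx (hk0 x h)
  have hi2 : Integrable fun x => heatConv σ r' x • (truncInv c (heatConv σ r) x • k x) := by
    refine ((integrable_heatConv (σ := σ) hr').mul_const (c⁻¹ * (b * W))).mono'
      (by fun_prop) (Eventually.of_forall fun x => ?_)
    rw [norm_smul, norm_smul, Real.norm_of_nonneg (heatConv_nonneg hr' x)]
    have := heatConv_nonneg (σ := σ) hr' x
    gcongr
    · exact hti.bdd x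
    · exact hbd x
  rw [← integral_sub hki hi2, ← setIntegral_eq_integral_of_forall_compl_eq_zero (s := ball 0 R)
    (fun x hx => by rw [hk0 x hx]; simp)]
  have hwi : IntegrableOn (fun x => w x * |heatConv σ r' x - heatConv σ r x|) (ball 0 R) := by
    have : Integrable fun x => w x * |heatConv σ r' x - heatConv σ r x| :=
      (((integrable_heatConv hr').sub (integrable_heatConv hr)).abs).bdd_mul
        hw.aestronglyMeasurable (Eventually.of_forall hW)
    exact this.integrableOn
  calc _ ≤ ∫ x in ball 0 R, b / c * (w x * |heatConv σ r' x - heatConv σ r x|) := by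
        refine norm_integral_le_of_norm_le (hwi.const_mul _) ?_
        filter_upwards [ae_restrict_mem measurableSet_ball] with x hx
        have hx1 := hlow x hx
        have hp : 0 < heatConv σ r x := hc.trans_le hx1
        have e : k x - heatConv σ r' x • (truncInv c (heatConv σ r) x • k x) =
            (truncInv c (heatConv σ r) x * (heatConv σ r x - heatConv σ r' x)) • k x := by
          have : truncInv c (heatConv σ r) x * heatConv σ r x = 1 := by
            rw [truncInv, max_eq_right hx1, inv_mul_cancel₀ hp.ne']
          rw [mul_sub, sub_smul, this, one_smul, smul_smul, mul_comm]
        rw [e, norm_smul, norm_mul]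
        calc _ ≤ c⁻¹ * ‖heatConv σ r x - heatConv σ r' x‖ * (b * w x) := by
              gcongr
              · exact hti.bdd x
              · exact hkw x
          _ = _ := by rw [Real.norm_eq_abs, abs_sub_comm]; ring
    _ ≤ _ := by
        rw [integral_const_mul]
        gcongr
        exact integral_mul_abs_heatConv_sub_le hr' hr hη hst hw hW

end LocalComparison

/-- What is known about the planar shadow `σ` of a flat good measure, at scales between `β` and
`1`: growth and lower regularity, mass, `L²` bounds for the truncated Riesz potentials and
near-orthogonality of these to mean zero Lipschitz fields. -/
structure PlanarData {d : ℕ} (σ : Measure (Pl d)) (C₁ c₁ C₂ M D ρ β : ℝ) : Prop where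
  upper : ∀ s, β ≤ s → ∀ u, σ (ball u s) ≤ ENNReal.ofReal (C₁ * s ^ d)
  lower : ∀ s, β ≤ s → s ≤ 1 → ∀ u, ‖u‖ ≤ 4 * D → ENNReal.ofReal (c₁ * s ^ d) ≤ σ (ball u s)
  mass : σ.real Set.univ ≤ C₁ * ρ ^ d
  sq_bound : ∀ δ, β ≤ δ → δ ≤ 1 → ∫ u, ‖rpot σ δ u‖ ^ 2 ∂σ ≤ M * ρ ^ d
  pairing : ∀ δ, β ≤ δ → δ ≤ 1 → ∀ (g : Pl d → Pl d) (Mg L : ℝ), 0 < Mg → 0 ≤ L →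
    BddLip g Mg L → (∀ u, 2 * D ≤ ‖u‖ → g u = 0) → ∫ u, g u ∂σ = 0 →
    |∫ u, (inner ℝ (rpot σ δ u) (g u) : ℝ) ∂σ| ≤
      C₂ * (δ * D ^ d * (L + Mg) + D / ρ * ∫ u, ‖g u‖ ∂σ)

/-! ### The main planar estimate -/

section Estimate

variable {d : ℕ} {σ : Measure (Pl d)} [IsFiniteMeasure σ]

-- With `v = rpot σ δ`, `H` the truncation of `h`, `ψ = H / p_r` and `g` the mean zero correction of
-- `ψ`, the chain is `-∫ rieszAvg 0 h dσ ≈ ∫ ⟨v, H⟩ dx ≈ ∫ p_{r'} ⟨v, ψ⟩ dx ≈ ∫ ⟨v, ψ⟩ dσ ≈ ∫ ⟨v, g⟩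
-- dσ ≈ 0`. The five lines of the bound are the errors of these five steps in order. The common
-- bound `Λ` dominates the Lipschitz constants of everything that is mollified, so `hsmall` makes
-- each mollification error at most `η`.
set_option maxHeartbeats 1000000 in
theorem planar_estimate (hd : 1 ≤ d) {C₁ c₁ C₂ M D ρ β : ℝ} (S : PlanarData σ C₁ c₁ C₂ M D ρ β)
    (hβ : 0 < β) (hc₁ : 0 < c₁) (hC₂ : 0 ≤ C₂) (hD : 1 ≤ D) (hρ : 0 < ρ)
    {h : Pl d → Pl d} {B B₁ t₁ : ℝ} (hB : 0 < B) (hh : BddLip h B B) (hi : Integrable h)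
    (h0 : ∫ u, h u = 0) (hav : Integrable (rieszAvg 0 h) σ)
    (htail : ∫ u, ‖cutoff D u • h u - h u‖ ≤ t₁) (hB₁ : ∫ u, ‖h u‖ ∂σ ≤ B₁)
    {r r' δ θ η c K Λ Lψ m : ℝ} (hr' : 0 < r') (hr'r : r' ≤ r) (hr1 : r ≤ 1) (hβr : β ≤ √r')
    (hβδ : β ≤ δ) (hδ1 : δ ≤ 1) (hδθ : δ ≤ θ) (hη : 0 < η) (hη1 : η ≤ 1)
    (hc : c = c₁ * (Real.exp (-1) / √Real.pi ^ d)) (hm : m = C₁ * ρ ^ d)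
    (hK : ∀ x y : Pl d, |heat r x - heat r y| ≤ K * ‖x - y‖)
    (hLψ : Lψ = c⁻¹ * (1 * B + 1 * B) + K * m / c ^ 2 * (1 * B))
    (hΛ₁ : Lψ ≤ Λ)
    (hΛ₂ : (δ ^ d)⁻¹ * m * Lψ + (d + 2) * (δ ^ (d + 1))⁻¹ * m * (c⁻¹ * (1 * B)) ≤ Λ)
    (hΛ₃ : 2 * ((δ ^ d)⁻¹ * m * ((d + 2) * (δ ^ (d + 1))⁻¹ * m)) ≤ Λ)
    (hsmall : Λ * ((1 + d) * √r') * m ≤ η)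
    (hen : ∫ x, (heatConv σ r' x - heatConv σ r x) ^ 2 ≤ η ^ 2) :
    |∫ y, rieszAvg 0 h y ∂σ| ≤
      (2 * (2 * B) * (unitVol d * 2 ^ d * θ) + (θ ^ d)⁻¹ * t₁) * m
      + B / c * (η / 2 * ((M * ρ ^ d + 1) / c + 1))
      + η
      + (η + B / c * (η / 2 * ((2 * D) ^ d * unitVol d + 1)) + t₁) / c₁ * ((M * ρ ^ d + m) / 2)
      + C₂ * (δ * D ^ d * (Lψ + c⁻¹ * B + 2 * (B₁ / (c * c₁))) + D / ρ * (2 * (B₁ / c))) := by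
  have hpi := Real.pi_pos
  have hD0 : 0 < D := by linarith
  have hc0 : 0 < c := by rw [hc]; positivity
  have hr : 0 < r := hr'.trans_le hr'r
  have hδ0 : 0 < δ := hβ.trans_le hβδ
  have hθ0 : 0 < θ := hδ0.trans_le hδθ
  have hmass : σ.real Set.univ ≤ m := hm ▸ S.mass
  have hm0 : 0 ≤ m := measureReal_nonneg.trans hmass
  have hsr : √r' ≤ √r := Real.sqrt_le_sqrt hr'r
  have hsr1 : √r ≤ 1 := Real.sqrt_le_one.2 hr1
  have hlow : ∀ s, r' ≤ s → s ≤ r → ∀ x ∈ ball (0 : Pl d) (2 * D), c ≤ heatConv σ s x := by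
    intro s hs1 hs2 x hx
    rw [mem_ball, dist_zero_right] at hx
    rw [hc]
    refine le_heatConv (hr'.trans_le hs1) hc₁.le (S.lower _ (hβr.trans (Real.sqrt_le_sqrt hs1))
      ((Real.sqrt_le_sqrt hs2).trans hsr1) x (by linarith))
  have hKp : ∀ x y : Pl d, |heatConv σ r x - heatConv σ r y| ≤ K * m * ‖x - y‖ := by
    intro x y
    refine (abs_heatConv_sub_le (σ := σ) hr hK x y).trans ?_
    have hK0 : 0 ≤ K * ‖x - y‖ := (abs_nonneg _).trans (hK x y)
    calc _ = K * ‖x - y‖ * σ.real Set.univ := by ring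
      _ ≤ K * ‖x - y‖ * m := by gcongr
      _ = _ := by ring
  set v := rpot σ δ with hv
  have hvBL : BddLip v _ _ := bddLip_rpot hδ0 hmass
  set H : Pl d → Pl d := fun u => cutoff D u • h u with hH
  have hHBL : BddLip H _ _ := (bddLip_cutoff hD).smul hh
  have hHi : Integrable H := by
    refine hi.norm.mono' hHBL.continuous.aestronglyMeasurable (Eventually.of_forall fun u => ?_)
    rw [hH, norm_smul, Real.norm_of_nonneg (cutoff_nonneg D u)]
    exact mul_le_of_le_one_left (norm_nonneg _) (cutoff_le_one D u)
  have hH0 : ∀ x ∉ ball (0 : Pl d) (2 * D), H x = 0 := by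
    intro x hx
    rw [mem_ball, not_lt, dist_zero_right] at hx
    simp only [hH, cutoff_eq_zero hD0 hx, zero_smul]
  set pinv := truncInv c (heatConv σ r) with hpinv
  have hpBL : BddLip pinv _ _ := bddLip_truncInv hc0 hKp
  set ψ : Pl d → Pl d := fun u => pinv u • H u with hψ
  have hψBL : BddLip ψ (c⁻¹ * (1 * B)) Lψ := hLψ ▸ hpBL.smul hHBL
  have hLψ0 : 0 ≤ Lψ := by
    have : 0 ≤ K * m := by
      have hex : ∃ e : Pl d, ‖e‖ = 1 := by
        have : Nonempty (Fin d) := ⟨⟨0, by omega⟩⟩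
        exact exists_norm_eq _ zero_le_one
      obtain ⟨e, he⟩ := hex
      have := (abs_nonneg _).trans (hKp e 0)
      simpa [he] using this
    rw [hLψ]; positivity
  have hψle : ∀ u, ‖ψ u‖ ≤ c⁻¹ * ‖h u‖ := fun u => by
    rw [hψ, hH, norm_smul, norm_smul, Real.norm_of_nonneg (cutoff_nonneg D u)]
    have := hpBL.bdd u
    have := cutoff_le_one D u
    have : 0 ≤ cutoff D u * ‖h u‖ := mul_nonneg (cutoff_nonneg D u) (norm_nonneg _)
    calc _ ≤ c⁻¹ * (1 * ‖h u‖) := by gcongr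
      _ = _ := by rw [one_mul]
  set q : Pl d → ℝ := fun u => inner ℝ (v u) (ψ u) with hq
  have hqBL : BddLip q _ _ := hvBL.inner hψBL
  have hψint : ∫ u, ‖ψ u‖ ∂σ ≤ B₁ / c := by
    calc _ ≤ ∫ u, c⁻¹ * ‖h u‖ ∂σ :=
          integral_mono (hψBL.integrable σ).norm ((hh.integrable σ).norm.const_mul _) hψle
      _ = c⁻¹ * ∫ u, ‖h u‖ ∂σ := integral_const_mul _ _
      _ ≤ c⁻¹ * B₁ := by gcongr
      _ = _ := by rw [div_eq_inv_mul]
  -- mollification errors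
  have hmoll : ∀ {F : Type} [NormedAddCommGroup F] [NormedSpace ℝ F] [CompleteSpace F]
      (k : Pl d → F) (Mk Lk : ℝ), BddLip k Mk Lk → Lk ≤ Λ →
      ‖(∫ x, heatConv σ r' x • k x) - ∫ y, k y ∂σ‖ ≤ η := by
    intro F _ _ _ k Mk Lk hk hLk
    have hΛ0 : 0 ≤ Λ := hLψ0.trans hΛ₁
    refine (norm_integral_heatConv_smul_sub_le hr' hΛ0 hk.continuous hk.bdd
      (hk.mono le_rfl hLk).lip (hk.integrable σ)).trans (le_trans ?_ hsmall)
    gcongr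
  have hl2 := S.sq_bound δ hβδ hδ1
  have hvv : BddLip (fun u => (inner ℝ (v u) (v u) : ℝ)) _ _ := hvBL.inner hvBL
  -- the `L²` bound for `v` with respect to Lebesgue measure
  have hvol : ∫ x in ball (0 : Pl d) (2 * D), ‖v x‖ ^ 2 ≤ (M * ρ ^ d + 1) / c := by
    have h1 := hmoll _ _ _ hvv (by linarith)
    simp only [real_inner_self_eq_norm_sq, smul_eq_mul] at h1
    rw [Real.norm_eq_abs] at h1
    have h2 := (abs_le.1 h1).2
    have hvi : Integrable fun x => heatConv σ r' x * ‖v x‖ ^ 2 := by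
      refine ((integrable_heatConv (σ := σ) hr').mul_const (((δ ^ d)⁻¹ * m) ^ 2)).mono' ?_
        (Eventually.of_forall fun x => ?_)
      · exact ((continuous_heatConv hr').mul (hvBL.continuous.norm.pow 2)).aestronglyMeasurable
      · have := heatConv_nonneg (σ := σ) hr' x
        have := hvBL.bdd x
        rw [Real.norm_of_nonneg (by positivity)]
        gcongr
    -- On the ball `c ≤ heatConv σ r'`, so the Lebesgue integral is dominated by the integral
    -- weighted with the mollified density, which `h1` compares with the `L²(σ)` bound up to `η ≤
    -- 1`.
    rw [le_div_iff₀ hc0, ← integral_mul_const]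
    calc _ ≤ ∫ x in ball (0 : Pl d) (2 * D), heatConv σ r' x * ‖v x‖ ^ 2 := by
          refine setIntegral_mono_on ?_ hvi.integrableOn measurableSet_ball fun x hx => ?_
          · refine Measure.integrableOn_of_bounded (M := ((δ ^ d)⁻¹ * m) ^ 2 * c)
              measure_ball_lt_top.ne
              ((hvBL.continuous.norm.pow 2).mul continuous_const).aestronglyMeasurable
              (Eventually.of_forall fun x => ?_)
            rw [Real.norm_of_nonneg (by positivity)]
            have := hvBL.bdd x
            gcongr
          · rw [mul_comm]
            gcongr
            exact hlow r' le_rfl hr'r x hx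
      _ ≤ ∫ x, heatConv σ r' x * ‖v x‖ ^ 2 :=
          setIntegral_le_integral hvi (Eventually.of_forall fun x => by
            have := heatConv_nonneg (σ := σ) hr' x
            simp only [Pi.zero_apply]; positivity)
      _ ≤ _ := by linarith
  -- comparison of `H` and `ψ`
  have hvolD : ∫ x in ball (0 : Pl d) (2 * D), (1 : ℝ) ^ 2 = (2 * D) ^ d * unitVol d := by
    have hu := unitVol_pos d
    rw [one_pow, setIntegral_const, smul_eq_mul, mul_one, measureReal_def,
      volume_ball_eq_ofReal (by positivity), ENNReal.toReal_ofReal (by positivity)]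
  have e2 : |(∫ z, (inner ℝ (v z) (H z) : ℝ)) - ∫ x, heatConv σ r' x • q x| ≤
      B / c * (η / 2 * ((M * ρ ^ d + 1) / c + 1)) := by
    have := norm_integral_sub_integral_heatConv_smul_le (σ := σ) (R := 2 * D) (b := B)
      (k := fun z => (inner ℝ (v z) (H z) : ℝ)) (w := fun z => ‖v z‖) hr hr' hη hc0 hKp
      (hlow r hr'r le_rfl) hen hvBL.continuous.norm
      (W := (δ ^ d)⁻¹ * m) (fun x => by rw [abs_norm]; exact hvBL.bdd x)
      (hvBL.continuous.inner hHBL.continuous) (fun x hx => by simp [hH0 x hx])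
      (fun x => (norm_inner_le_norm _ _).trans (by
        rw [mul_comm]
        have := hHBL.bdd x
        rw [one_mul] at this
        gcongr)) hB.le
    rw [Real.norm_eq_abs] at this
    have e : ∀ x, q x = pinv x • (inner ℝ (v x) (H x) : ℝ) := fun x => by
      simp only [hq, hψ, real_inner_smul_right, smul_eq_mul]
    simp only [e]
    refine this.trans ?_
    gcongr
  have e6 : ‖(∫ z, H z) - ∫ x, heatConv σ r' x • ψ x‖ ≤
      B / c * (η / 2 * ((2 * D) ^ d * unitVol d + 1)) := by
    have := norm_integral_sub_integral_heatConv_smul_le (σ := σ) (R := 2 * D) (b := B)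
      (k := H) (w := fun z => (1 : ℝ)) hr hr' hη hc0 hKp
      (hlow r hr'r le_rfl) hen continuous_const (W := 1) (fun x => by simp)
      hHBL.continuous hH0 (fun x => by simpa using hHBL.bdd x) hB.le
    rw [hvolD] at this
    exact this
  have e3 : |(∫ x, heatConv σ r' x • q x) - ∫ y, q y ∂σ| ≤ η := hmoll q _ _ hqBL hΛ₂
  have e7 : ‖(∫ x, heatConv σ r' x • ψ x) - ∫ y, ψ y ∂σ‖ ≤ η := hmoll ψ _ _ hψBL hΛ₁
  have e8 : ‖∫ z, H z‖ ≤ t₁ := by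
    have : ∫ z, H z = ∫ z, (H z - h z) := by rw [integral_sub hHi hi, h0, sub_zero]
    rw [this]
    exact (norm_integral_le_integral_norm _).trans htail
  -- the mean value correction
  set Iφ := ∫ u, cutoff D u ∂σ with hIφ
  have hφi : Integrable (fun u : Pl d => cutoff D u) σ := (bddLip_cutoff hD).integrable σ
  have hIφ1 : c₁ ≤ Iφ := by
    have h1 := S.lower 1 (hβδ.trans hδ1) le_rfl 0 (by simp; positivity)
    rw [one_pow, mul_one] at h1
    have h2 : c₁ ≤ σ.real (ball 0 1) :=
      (ENNReal.ofReal_le_iff_le_toReal (measure_ne_top _ _)).1 h1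
    refine h2.trans ?_
    rw [← integral_indicator_one measurableSet_ball]
    refine integral_mono ((integrable_const (1 : ℝ)).indicator measurableSet_ball) hφi fun u => ?_
    by_cases hu : u ∈ ball (0 : Pl d) 1
    · rw [Set.indicator_of_mem hu, cutoff_eq_one hD0]
      · rfl
      · rw [mem_ball, dist_zero_right] at hu; linarith
    · rw [Set.indicator_of_notMem hu]; exact cutoff_nonneg D u
  have hIφ0 : 0 < Iφ := hc₁.trans_le hIφ1
  set a : Pl d := Iφ⁻¹ • ∫ u, ψ u ∂σ with ha
  have hna : ‖a‖ ≤ ‖∫ u, ψ u ∂σ‖ / c₁ := by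
    rw [ha, norm_smul, Real.norm_of_nonneg (by positivity), div_eq_inv_mul]
    gcongr
  -- Two bounds for `a` are needed. This one is small because `∫ h = 0`, and it enters the error of
  -- replacing `ψ` by `g`. The next one, `hna2`, does not involve `η` and enters the size and
  -- Lipschitz constants of `g`.
  have hna1 : ‖a‖ ≤ (η + B / c * (η / 2 * ((2 * D) ^ d * unitVol d + 1)) + t₁) / c₁ := by
    refine hna.trans ?_
    gcongr
    have e : ∫ u, ψ u ∂σ = -((∫ x, heatConv σ r' x • ψ x) - ∫ y, ψ y ∂σ) -
        ((∫ z, H z) - ∫ x, heatConv σ r' x • ψ x) + ∫ z, H z := by abel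
    rw [e]
    refine (norm_add_le _ _).trans (add_le_add ((norm_sub_le _ _).trans ?_) e8)
    rw [norm_neg]
    exact add_le_add e7 e6
  have hna2 : ‖a‖ ≤ B₁ / (c * c₁) := by
    refine hna.trans ?_
    rw [← div_div]
    gcongr
    exact (norm_integral_le_integral_norm _).trans hψint
  set g : Pl d → Pl d := fun u => ψ u - cutoff D u • a with hg
  have hφaBL : BddLip (fun u : Pl d => cutoff D u • a) _ _ :=
    (bddLip_cutoff hD).smul (BddLip.const a)
  have hB₁0 : 0 ≤ B₁ := (integral_nonneg fun _ => norm_nonneg _).trans hB₁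
  have hgBL : BddLip g (c⁻¹ * B + B₁ / (c * c₁)) (Lψ + B₁ / (c * c₁)) :=
    (hψBL.sub hφaBL).mono (by linarith) (by linarith)
  have hgint : ∫ u, g u ∂σ = 0 := by
    rw [hg, integral_sub (hψBL.integrable σ) (hφaBL.integrable σ), integral_smul_const, ha,
      smul_smul, mul_inv_cancel₀ hIφ0.ne', one_smul, sub_self]
  have hgn : ∫ u, ‖g u‖ ∂σ ≤ 2 * (B₁ / c) := by
    calc _ ≤ ∫ u, (‖ψ u‖ + cutoff D u * ‖a‖) ∂σ := by
          refine integral_mono (hgBL.integrable σ).norm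
            ((hψBL.integrable σ).norm.add (hφi.mul_const _)) fun u => ?_
          refine (norm_sub_le _ _).trans (le_of_eq ?_)
          rw [norm_smul (cutoff D u) a, Real.norm_of_nonneg (cutoff_nonneg D u)]
      _ = (∫ u, ‖ψ u‖ ∂σ) + ‖∫ u, ψ u ∂σ‖ := by
          rw [integral_add (hψBL.integrable σ).norm (hφi.mul_const _), integral_mul_const, ha,
            norm_smul, norm_inv, Real.norm_of_nonneg hIφ0.le, mul_inv_cancel_left₀ hIφ0.ne']
      _ ≤ B₁ / c + B₁ / c :=
          add_le_add hψint ((norm_integral_le_integral_norm _).trans hψint)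
      _ = _ := by ring
  have hA0 : 0 ≤ B₁ / (c * c₁) := by positivity
  have e5 := S.pairing δ hβδ hδ1 g _ _ (by positivity) (by positivity) hgBL
    (fun u hu => by
      have : u ∉ ball (0 : Pl d) (2 * D) := by
        rw [mem_ball, not_lt, dist_zero_right]; exact hu
      simp only [hg, hψ, hH0 u this, cutoff_eq_zero hD0 hu, smul_zero, zero_smul, sub_zero]) hgint
  -- the remaining term
  clear_value g q a Iφ
  have e4 : |(∫ y, q y ∂σ) - ∫ u, (inner ℝ (v u) (g u) : ℝ) ∂σ| ≤
      ‖a‖ * ((M * ρ ^ d + m) / 2) := by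
    have hqi := hqBL.integrable σ
    have hgi := (hvBL.inner hgBL).integrable σ
    rw [← integral_sub hqi hgi]
    have e : ∀ u, q u - inner ℝ (v u) (g u) = inner ℝ (v u) (cutoff D u • a) := fun u => by
      simp only [hq, hg, inner_sub_right]; ring
    simp only [e]
    have hvi : Integrable (fun u => ‖v u‖ ^ 2) σ := by
      simpa only [real_inner_self_eq_norm_sq] using hvv.integrable σ
    calc _ ≤ ∫ u, ‖a‖ * ((‖v u‖ ^ 2 + 1) / 2) ∂σ := by
          rw [← Real.norm_eq_abs]
          refine norm_integral_le_of_norm_le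
            (((hvi.add (integrable_const 1)).div_const 2).const_mul _)
            (Eventually.of_forall fun u => (norm_inner_le_norm _ _).trans ?_)
          rw [norm_smul, Real.norm_of_nonneg (cutoff_nonneg D u)]
          have := cutoff_le_one D u
          calc _ ≤ ‖v u‖ * (1 * ‖a‖) := by gcongr
            _ = ‖a‖ * ‖v u‖ := by ring
            _ ≤ _ := by
              gcongr
              nlinarith [sq_nonneg (‖v u‖ - 1)]
      _ = ‖a‖ * (((∫ u, ‖v u‖ ^ 2 ∂σ) + σ.real Set.univ) / 2) := by
          rw [integral_const_mul, integral_div, integral_add hvi (integrable_const _)]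
          simp
      _ ≤ _ := by gcongr
  have e1 := abs_integral_inner_rpot_add_le (σ := σ) hd (L := 2 * B) (by positivity)
    (hh.mono le_rfl (by linarith)).lip hh.continuous.measurable hi
    (hHBL.mono le_rfl (by linarith)).lip hHBL.continuous.measurable hHi hav hδ0 hθ0 hδθ hmass
  have e1' : (2 * (2 * B) * (unitVol d * 2 ^ d * θ) + (θ ^ d)⁻¹ * ∫ u, ‖H u - h u‖) * m ≤
      (2 * (2 * B) * (unitVol d * 2 ^ d * θ) + (θ ^ d)⁻¹ * t₁) * m := by gcongr
  have hmM : 0 ≤ (M * ρ ^ d + m) / 2 := by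
    have : 0 ≤ ∫ u, ‖rpot σ δ u‖ ^ 2 ∂σ := integral_nonneg fun _ => sq_nonneg _
    linarith
  have e4' := e4.trans (mul_le_mul_of_nonneg_right hna1 hmM)
  have e5' : C₂ * (δ * D ^ d * (Lψ + B₁ / (c * c₁) + (c⁻¹ * B + B₁ / (c * c₁))) +
      D / ρ * ∫ u, ‖g u‖ ∂σ) ≤
      C₂ * (δ * D ^ d * (Lψ + c⁻¹ * B + 2 * (B₁ / (c * c₁))) + D / ρ * (2 * (B₁ / c))) := by
    have : Lψ + B₁ / (c * c₁) + (c⁻¹ * B + B₁ / (c * c₁)) =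
        Lψ + c⁻¹ * B + 2 * (B₁ / (c * c₁)) := by ring
    rw [this]
    gcongr
  have f1 := abs_le.1 (e1.trans e1')
  have f2 := abs_le.1 e2
  have f3 := abs_le.1 e3
  have f4 := abs_le.1 e4'
  have f5 := abs_le.1 (e5.trans e5')
  rw [abs_le]
  constructor <;> linarith [f1.1, f1.2, f2.1, f2.2, f3.1, f3.2, f4.1, f4.2, f5.1, f5.2]

end Estimate

/-! ### Choice of the radii and of the scales -/

theorem integrable_inv_one_add_norm_pow (d : ℕ) :
    Integrable fun u : Pl d => ((1 + ‖u‖) ^ (d + 1))⁻¹ := by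
  have h := integrable_one_add_norm (E := Pl d) (μ := volume) (r := (d + 1 : ℕ))
    (by rw [finrank_euclideanSpace_fin]; push_cast; linarith)
  refine h.congr (Eventually.of_forall fun u => ?_)
  simp only
  rw [Real.rpow_neg (by positivity), Real.rpow_natCast]

/-- Gaussian fields with bounded centre and time in a compact interval decay faster than any power.
The tail beyond `D` can therefore beat whatever power of `D` the planar estimate produces, with
constants that do not depend on `D`. -/
theorem exists_heatField_bounds (d n : ℕ) {T₀ T₁ A C₁ : ℝ} (hT₀ : 0 < T₀) (hA : 0 ≤ A)
    (hC₁ : 0 < C₁) : ∃ B B₁ Bt : ℝ, 0 < B ∧ 0 < B₁ ∧ 0 < Bt ∧ ∀ τ, T₀ ≤ τ → τ ≤ T₁ → ∀ x : Pl d,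
      ‖x‖ ≤ A → BddLip (heatField τ x) B B ∧
      (∀ D, 1 ≤ D → ∫ u, ‖cutoff D u • heatField τ x u - heatField τ x u‖ ≤ Bt * (D ^ n)⁻¹) ∧
      ∀ (σ : Measure (Pl d)) [IsFiniteMeasure σ], (∀ w, σ (ball w 1) ≤ ENNReal.ofReal C₁) →
        ∫ u, ‖heatField τ x u‖ ∂σ ≤ B₁ := by
  obtain ⟨L, hL, hLip⟩ := exists_heatField_lipschitz d hT₀
  obtain ⟨B, hB, hdec⟩ := exists_heatField_decay d (n + (d + 1)) (T₁ := T₁) hT₀ hA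
  have hi := integrable_inv_one_add_norm_pow d
  have hI : 0 ≤ ∫ u : Pl d, ((1 + ‖u‖) ^ (d + 1))⁻¹ := integral_nonneg fun u => by positivity
  set I := ∫ u : Pl d, ((1 + ‖u‖) ^ (d + 1))⁻¹
  have hv := unitVol_pos d
  refine ⟨L + B, C₁ / (1 ^ d * unitVol d) * (B * 2 ^ (d + 1) * I) + 1, B * I + 1, by positivity,
    by positivity, by positivity, fun τ h1 h2 x hx => ⟨⟨fun u => ?_, fun u v => ?_⟩, ?_, ?_⟩⟩
  · refine (hdec τ h1 h2 x u hx).trans ?_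
    have : ((1 + ‖u‖) ^ (n + (d + 1)))⁻¹ ≤ 1 :=
      inv_le_one_of_one_le₀ (one_le_pow₀ (by linarith [norm_nonneg u]))
    nlinarith
  · refine (hLip τ h1 x u v).trans ?_
    gcongr
    linarith
  · intro D hD
    have hD0 : 0 < D := by linarith
    calc _ ≤ ∫ u : Pl d, B * (D ^ n)⁻¹ * ((1 + ‖u‖) ^ (d + 1))⁻¹ := by
          refine integral_mono_of_nonneg (Eventually.of_forall fun u => norm_nonneg _)
            (hi.const_mul _) (Eventually.of_forall fun u => ?_)
          simp only
          rcases le_total ‖u‖ D with hu | hu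
          · rw [cutoff_eq_one hD0 hu, one_smul, sub_self, norm_zero]
            positivity
          · have e : cutoff D u • heatField τ x u - heatField τ x u =
                -((1 - cutoff D u) • heatField τ x u) := by module
            have h3 := cutoff_nonneg D u
            have h4 := cutoff_le_one D u
            rw [e, norm_neg, norm_smul, Real.norm_of_nonneg (by linarith)]
            calc _ ≤ 1 * ‖heatField τ x u‖ := by gcongr; linarith
              _ ≤ B * ((1 + ‖u‖) ^ (n + (d + 1)))⁻¹ := by rw [one_mul]; exact hdec τ h1 h2 x u hx
              _ = B * ((1 + ‖u‖) ^ n)⁻¹ * ((1 + ‖u‖) ^ (d + 1))⁻¹ := by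
                rw [pow_add, mul_inv, mul_assoc]
              _ ≤ _ := by gcongr; linarith
      _ = B * I * (D ^ n)⁻¹ := by rw [integral_const_mul]; ring
      _ ≤ _ := by gcongr; linarith
  · intro σ _ hσ
    have := (integral_le_of_measure_ball_le (σ := σ) one_pos hC₁.le hσ
      (f := fun u => ‖heatField τ x u‖) (f₁ := fun u => B * 2 ^ (d + 1) * ((1 + ‖u‖) ^ (d + 1))⁻¹)
      (continuous_heatField τ x).norm.measurable (fun _ => norm_nonneg _)
      (by fun_prop) (hi.const_mul _) (fun y w hyw => ?_)).2
    · rw [integral_const_mul] at this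
      linarith
    · have h5 : ‖w‖ ≤ ‖y‖ + 1 := by
        have := norm_le_norm_add_norm_sub' w y
        rw [dist_comm, dist_eq_norm] at hyw
        linarith
      refine (hdec τ h1 h2 x y hx).trans ?_
      rw [mul_assoc]
      refine mul_le_mul_of_nonneg_left ?_ hB.le
      rw [← div_eq_mul_inv, inv_eq_one_div, div_le_div_iff₀ (by positivity) (by positivity), one_mul]
      calc (1 + ‖w‖) ^ (d + 1) ≤ (2 * (1 + ‖y‖)) ^ (d + 1) := by
            gcongr; linarith [norm_nonneg y]
        _ = 2 ^ (d + 1) * (1 + ‖y‖) ^ (d + 1) := mul_pow _ _ _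
        _ ≤ _ := mul_le_mul_of_nonneg_left
          (pow_le_pow_right₀ (by linarith [norm_nonneg y]) (by omega)) (by positivity)

/-- One step in the choice of scales: below any scale `r` there is a much smaller one `r'` such
that closeness of the Gaussian extensions at these scales gives a small pairing. -/
theorem exists_scale_step {d : ℕ} (hd : 1 ≤ d) {c₁ C₁ C₂ M D ρ B B₁ t₁ θ η ε r : ℝ}
    (hc₁ : 0 < c₁) (hC₁ : 0 < C₁) (hC₂ : 0 < C₂) (hD : 1 ≤ D) (hρ : 0 < ρ) (hB : 0 < B)
    (hB₁ : 0 < B₁) (hθ : 0 < θ) (hη : 0 < η) (hη1 : η ≤ 1) (hε : 0 < ε) (hr : 0 < r)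
    (hr1 : r ≤ 1) :
    ∃ r' s, 0 < r' ∧ r' ≤ r ∧ 0 < s ∧ ∀ (σ : Measure (Pl d)) [IsFiniteMeasure σ] (β : ℝ), 0 < β →
      β ≤ s → PlanarData σ C₁ c₁ C₂ M D ρ β → ∀ h : Pl d → Pl d, BddLip h B B → Integrable h →
      ∫ u, h u = 0 → Integrable (rieszAvg 0 h) σ →
      ∫ u, ‖cutoff D u • h u - h u‖ ≤ t₁ → ∫ u, ‖h u‖ ∂σ ≤ B₁ →
      ∫ x, (heatConv σ r' x - heatConv σ r x) ^ 2 ≤ η ^ 2 →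
      |∫ y, rieszAvg 0 h y ∂σ| ≤
        (2 * (2 * B) * (unitVol d * 2 ^ d * θ) + (θ ^ d)⁻¹ * t₁) * (C₁ * ρ ^ d)
        + B / (c₁ * (Real.exp (-1) / √Real.pi ^ d)) *
          (η / 2 * ((M * ρ ^ d + 1) / (c₁ * (Real.exp (-1) / √Real.pi ^ d)) + 1))
        + η
        + (η + B / (c₁ * (Real.exp (-1) / √Real.pi ^ d)) *
          (η / 2 * ((2 * D) ^ d * unitVol d + 1)) + t₁) / c₁ * ((M * ρ ^ d + C₁ * ρ ^ d) / 2)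
        + (ε + C₂ * (D / ρ * (2 * (B₁ / (c₁ * (Real.exp (-1) / √Real.pi ^ d)))))) := by
  have hpi := Real.pi_pos
  obtain ⟨K, hK0, hK⟩ := exists_lipschitz_heat d hr
  set c := c₁ * (Real.exp (-1) / √Real.pi ^ d) with hc
  set m := C₁ * ρ ^ d with hm
  have hc0 : 0 < c := by positivity
  have hm0 : 0 < m := by positivity
  set Lψ := c⁻¹ * (1 * B + 1 * B) + K * m / c ^ 2 * (1 * B) with hLψ
  set Y := C₂ * D ^ d * (Lψ + c⁻¹ * B + 2 * (B₁ / (c * c₁))) with hY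
  have hY0 : 0 < Y := by positivity
  -- The truncation `δ` is fixed before `r'`: `Y` depends on `r` only, and `δ * Y` is the
  -- contribution of `δ` to the last error term. The Lipschitz bound `Λ`, and through it `r'`, may
  -- then depend on `δ`.
  set δ := min (min 1 θ) (ε / Y) with hδ
  have hδ0 : 0 < δ := by positivity
  have hδY : Y * δ ≤ ε := by
    have : δ ≤ ε / Y := min_le_right _ _
    rw [le_div_iff₀ hY0] at this
    linarith
  set Λ := Lψ + ((δ ^ d)⁻¹ * m * Lψ + (d + 2) * (δ ^ (d + 1))⁻¹ * m * (c⁻¹ * (1 * B))) +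
    2 * ((δ ^ d)⁻¹ * m * ((d + 2) * (δ ^ (d + 1))⁻¹ * m)) with hΛ
  have hLψ0 : 0 < Lψ := by positivity
  have hΛ2 : 0 ≤ (δ ^ d)⁻¹ * m * Lψ + (d + 2) * (δ ^ (d + 1))⁻¹ * m * (c⁻¹ * (1 * B)) := by
    positivity
  have hΛ3 : 0 ≤ 2 * ((δ ^ d)⁻¹ * m * ((d + 2) * (δ ^ (d + 1))⁻¹ * m)) := by positivity
  have hΛ0 : 0 < Λ := by positivity
  set q := η / (Λ * (1 + d) * m) with hq
  have hq0 : 0 < q := by positivity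
  -- The number `q` bounds `√r'` so that the mollification error is at most `η`. The second witness
  -- makes the measure regular at the scales `δ` and `√r'`.
  refine ⟨min r (q ^ 2), min δ √(min r (q ^ 2)), by positivity, min_le_left _ _, by positivity, ?_⟩
  intro σ _ β hβ hβs S h hh hi h0 hav htail hB₁' hen
  have hsq : √(min r (q ^ 2)) ≤ q := by
    rw [Real.sqrt_le_left hq0.le]
    exact min_le_right _ _
  have key := planar_estimate hd S hβ hc₁ hC₂.le hD hρ hB hh hi h0 hav htail hB₁'
    (r := r) (r' := min r (q ^ 2)) (δ := δ) (θ := θ) (η := η) (Λ := Λ) (by positivity)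
    (min_le_left _ _) hr1 (hβs.trans (min_le_right _ _)) (hβs.trans (min_le_left _ _))
    ((min_le_left _ _).trans (min_le_left _ _)) ((min_le_left _ _).trans (min_le_right _ _))
    hη hη1 hc hm hK hLψ (by linarith) (by linarith) (by linarith) ?_ hen
  · refine key.trans ?_
    rw [mul_add C₂]
    have e : C₂ * (δ * D ^ d * (Lψ + c⁻¹ * B + 2 * (B₁ / (c * c₁)))) = Y * δ := by
      rw [hY]; ring
    rw [e]
    gcongr
  · calc _ ≤ Λ * ((1 + d) * q) * m := by gcongr
      _ = η := by rw [hq]; field_simp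

theorem eventually_mul_inv_le (k : ℝ) {ε : ℝ} (hε : 0 < ε) : ∀ᶠ D : ℝ in atTop, k * D⁻¹ ≤ ε := by
  have := (tendsto_inv_atTop_zero (𝕜 := ℝ)).const_mul k
  rw [mul_zero] at this
  exact (this.eventually_lt_const hε).mono fun _ h => h.le

/-- The planar core: the antisymmetric averages of the Gaussian fields are small. -/
theorem exists_abs_integral_rieszAvg_le {d : ℕ} (hd : 1 ≤ d) {A T₀ T₁ ε c₁ C₁ C₂ M : ℝ}
    (hA : 0 ≤ A) (hT₀ : 0 < T₀) (hε : 0 < ε) (hc₁ : 0 < c₁) (hC₁ : 0 < C₁) (hC₂ : 0 < C₂)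
    (hM : 0 < M) (D₀ b : ℝ) (hb : 0 < b) :
    ∃ D ρ β, 1 ≤ D ∧ D₀ ≤ D ∧ 8 * D ≤ ρ ∧ 0 < β ∧ β ≤ b ∧
      ∀ (σ : Measure (Pl d)) [IsFiniteMeasure σ], PlanarData σ C₁ c₁ C₂ M D ρ β →
      ∀ τ, T₀ ≤ τ → τ ≤ T₁ → ∀ x : Pl d, ‖x‖ ≤ A →
      |∫ y, rieszAvg 0 (heatField τ x) y ∂σ| ≤ ε := by
  have hpi := Real.pi_pos
  have hv := unitVol_pos d
  -- The exponent balances `θ^{-d} = D^{d (d + 1)}` and `ρ^d = κ^d D^d`, with one power of `D` left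
  -- over for smallness.
  obtain ⟨B, B₁, Bt, hB, hB₁, hBt, hfield⟩ :=
    exists_heatField_bounds d (d * (d + 1) + d + 1) (T₁ := T₁) hT₀ hA hC₁
  set c := c₁ * (Real.exp (-1) / √Real.pi ^ d) with hc
  have hc0 : 0 < c := by positivity
  -- the ratio of the two radii
  set κ := max 8 (C₂ * (2 * (B₁ / c)) / (ε / 5)) with hκ
  have hκ8 : 8 ≤ κ := le_max_left _ _
  have hκ0 : 0 < κ := by linarith
  have hκ' : C₂ * (κ⁻¹ * (2 * (B₁ / c))) ≤ ε / 5 := by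
    have : C₂ * (2 * (B₁ / c)) / (ε / 5) ≤ κ := le_max_right _ _
    rw [div_le_iff₀ (by positivity)] at this
    calc _ = κ⁻¹ * (C₂ * (2 * (B₁ / c))) := by ring
      _ ≤ κ⁻¹ * (κ * (ε / 5)) := by gcongr
      _ = _ := by rw [inv_mul_cancel_left₀ hκ0.ne']
  -- the radii
  obtain ⟨D, hD₁, hD₂, hD1, hD₃⟩ := ((eventually_mul_inv_le ((2 * (2 * B) * (unitVol d * 2 ^ d) + Bt) *
    (C₁ * κ ^ d)) (ε := ε / 5) (by positivity)).and ((eventually_mul_inv_le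
    (Bt / c₁ * ((M * κ ^ d + C₁ * κ ^ d) / 2)) (ε := ε / 5) (by positivity)).and
    ((eventually_ge_atTop 1).and (eventually_ge_atTop D₀)))).exists
  have hD0 : 0 < D := by linarith
  set ρ := κ * D with hρ
  have hρ0 : 0 < ρ := by positivity
  set θ := (D ^ (d + 1))⁻¹ with hθ
  set t₁ := Bt * (D ^ (d * (d + 1) + d + 1))⁻¹ with ht₁
  have hθ0 : 0 < θ := by positivity
  have h1 : (2 * (2 * B) * (unitVol d * 2 ^ d * θ) + (θ ^ d)⁻¹ * t₁) * (C₁ * ρ ^ d) ≤ ε / 5 := by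
    refine le_trans (le_of_eq ?_) hD₁
    rw [hθ, ht₁, hρ, inv_pow, inv_inv, ← pow_mul, mul_pow]
    have e : D ^ (d * (d + 1) + d + 1) = D ^ ((d + 1) * d) * D ^ d * D := by ring
    have e' : D ^ (d + 1) = D ^ d * D := by ring
    rw [e, e']
    field_simp
  have h2 : t₁ / c₁ * ((M * ρ ^ d + C₁ * ρ ^ d) / 2) ≤ ε / 5 := by
    refine le_trans ?_ hD₂
    rw [ht₁, hρ, mul_pow]
    have e : D ^ (d * (d + 1) + d + 1) = D ^ (d * (d + 1)) * D ^ d * D := by ring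
    rw [e]
    have h3 : 1 ≤ D ^ (d * (d + 1)) := one_le_pow₀ hD1
    calc _ = (Bt / c₁ * ((M * κ ^ d + C₁ * κ ^ d) / 2)) * D⁻¹ * (D ^ (d * (d + 1)))⁻¹ := by
          field_simp
      _ ≤ (Bt / c₁ * ((M * κ ^ d + C₁ * κ ^ d) / 2)) * D⁻¹ * 1 := by
          gcongr
          exact inv_le_one_of_one_le₀ h3
      _ = _ := mul_one _
  -- the closeness of consecutive scales
  set X := B / c * (1 / 2 * ((M * ρ ^ d + 1) / c + 1)) + 1 +
    (1 + B / c * (1 / 2 * ((2 * D) ^ d * unitVol d + 1))) / c₁ * ((M * ρ ^ d + C₁ * ρ ^ d) / 2)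
    with hX
  have hX0 : 0 < X := by positivity
  set η := min 1 (ε / 5 / X) with hη
  have hη0 : 0 < η := by positivity
  have hηX : η * X ≤ ε / 5 := by
    have : η ≤ ε / 5 / X := min_le_right _ _
    rwa [le_div_iff₀ hX0] at this
  have hstep : ∀ r : Set.Ioc (0 : ℝ) 1, ∃ (r' : Set.Ioc (0 : ℝ) 1) (s : ℝ), (r' : ℝ) ≤ r ∧ 0 < s ∧
      ∀ (σ : Measure (Pl d)) [IsFiniteMeasure σ] (β : ℝ), 0 < β → β ≤ s →
      PlanarData σ C₁ c₁ C₂ M D ρ β → ∀ h : Pl d → Pl d, BddLip h B B → Integrable h →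
      ∫ u, h u = 0 → Integrable (rieszAvg 0 h) σ →
      ∫ u, ‖cutoff D u • h u - h u‖ ≤ t₁ → ∫ u, ‖h u‖ ∂σ ≤ B₁ →
      ∫ x, (heatConv σ r' x - heatConv σ r x) ^ 2 ≤ η ^ 2 →
      |∫ y, rieszAvg 0 h y ∂σ| ≤ ε := by
    rintro ⟨r, hr, hr1⟩
    obtain ⟨r', s, hr', hr'r, hs, H⟩ := exists_scale_step hd (t₁ := t₁) (M := M) hc₁ hC₁ hC₂ hD1 hρ0 hB
      hB₁ hθ0 hη0 (min_le_left _ _) (ε := ε / 5) (by positivity) hr hr1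
    refine ⟨⟨r', hr', hr'r.trans hr1⟩, s, hr'r, hs, ?_⟩
    intro σ _ β hβ hβs S h hh hi h0 hav htail hB₁' hen
    refine (H σ β hβ hβs S h hh hi h0 hav htail hB₁' hen).trans ?_
    rw [← hc]
    have e1 : D / ρ = κ⁻¹ := by rw [hρ]; field_simp
    have e2 : B / c * (η / 2 * ((M * ρ ^ d + 1) / c + 1)) + η +
        (η + B / c * (η / 2 * ((2 * D) ^ d * unitVol d + 1)) + t₁) / c₁ *
          ((M * ρ ^ d + C₁ * ρ ^ d) / 2) =
        η * X + t₁ / c₁ * ((M * ρ ^ d + C₁ * ρ ^ d) / 2) := by rw [hX]; ring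
    rw [e1]
    linarith
  choose Ψ s hΨ hs H using hstep
  -- The scales are fixed in advance, independently of `σ`, by iterating the step from `1`.
  set r : ℕ → Set.Ioc (0 : ℝ) 1 := fun j => Ψ^[j] ⟨1, one_pos, le_rfl⟩ with hr
  have hrs : ∀ j, r (j + 1) = Ψ (r j) := fun j => Function.iterate_succ_apply' _ _ _
  -- The numerator bounds the Gaussian energy, a density bound times a mass bound, at every time
  -- whose square root is at least `β`. It does not depend on `J`, so `J` can be chosen to bring the
  -- average increment below `η²`.
  obtain ⟨J, hJ⟩ := exists_nat_gt (C₁ * heatBd d * (C₁ * ρ ^ d) / η ^ 2)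
  have hbd := heatBd_pos d
  have hJ0 : 0 < J := by
    have : (0 : ℝ) < J := lt_of_le_of_lt (by positivity) hJ
    exact_mod_cast this
  have hJ' : C₁ * heatBd d * (C₁ * ρ ^ d) / J ≤ η ^ 2 := by
    have hJ1 : (0 : ℝ) < J := by exact_mod_cast hJ0
    rw [div_lt_iff₀ (by positivity)] at hJ
    rw [div_le_iff₀ hJ1]
    linarith
  have hne : (Finset.range J).Nonempty := ⟨0, Finset.mem_range.2 hJ0⟩
  have hrJ : 0 < ((r J : Set.Ioc (0 : ℝ) 1) : ℝ) := (r J).2.1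
  -- Which of the `J` scales works depends on `σ`, so `β` is taken below the thresholds of all of
  -- them, and below `√(2 * r J)` for the energy bound.
  set β := min (min ((Finset.range J).inf' hne fun j => s (r j)) √(2 * r J)) (min 1 b) with hβ
  have hβ0 : 0 < β := by
    refine lt_min (lt_min ?_ (by positivity)) (lt_min one_pos hb)
    rw [Finset.lt_inf'_iff]
    exact fun j _ => hs _
  refine ⟨D, ρ, β, hD1, hD₃, by rw [hρ]; gcongr, hβ0, (min_le_right _ _).trans (min_le_right _ _), ?_⟩
  intro σ _ S τ hτ₀ hτ₁ x hx
  have hτ : 0 < τ := hT₀.trans_le hτ₀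
  obtain ⟨hf1, hf2, hf3⟩ := hfield τ hτ₀ hτ₁ x hx
  obtain ⟨j, hj, hen⟩ := exists_integral_heatConv_sub_sq_le (σ := σ) (r := fun j => (r j : ℝ))
    (fun j => (r j).2.1) (fun j => by rw [hrs]; exact hΨ _) hJ0
    (B := C₁ * heatBd d * (C₁ * ρ ^ d)) (by
      refine (heatEnergy_le (by positivity) fun y => heatConv_le (by positivity) hC₁.le
        (S.upper _ ((min_le_left _ _).trans (min_le_right _ _))) y).trans ?_
      have := S.mass
      gcongr)
  simp only [hrs] at hen
  refine H (r j) σ β hβ0 ?_ S _ hf1 (integrable_heatField hτ x) (integral_heatField τ x)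
    (integrable_rieszAvg hd hτ x) (hf2 D hD1) (hf3 σ fun w => ?_) (hen.trans hJ')
  · exact ((min_le_left _ _).trans (min_le_left _ _)).trans
      (Finset.inf'_le _ (Finset.mem_range.2 hj))
  · simpa using S.upper 1 ((min_le_right _ _).trans (min_le_left _ _)) w

/-- The Gaussian extension of planar data is nearly constant. -/
theorem exists_abs_heatConv_sub_le {d : ℕ} (hd : 1 ≤ d) {A t ε c₁ C₁ C₂ M : ℝ}
    (hA : 0 ≤ A) (ht : 0 < t) (hε : 0 < ε) (hc₁ : 0 < c₁) (hC₁ : 0 < C₁) (hC₂ : 0 < C₂)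
    (hM : 0 < M) (D₀ b : ℝ) (hb : 0 < b) :
    ∃ D ρ β, 1 ≤ D ∧ D₀ ≤ D ∧ 8 * D ≤ ρ ∧ 0 < β ∧ β ≤ b ∧
      ∀ (σ : Measure (Pl d)) [IsFiniteMeasure σ], PlanarData σ C₁ c₁ C₂ M D ρ β →
      ∀ x : Pl d, ‖x‖ ≤ A → |heatConv σ t x - heatConv σ t 0| ≤ ε := by
  have hpi := Real.pi_pos
  obtain ⟨K, hK, hdot⟩ := exists_abs_heatConvDot_sub_le d
  -- The window `Z` makes the tail term of the Abel inversion at most `ε / 2`; `ε₁` makes the other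
  -- term equal to `ε / 2`, and `ε₂` is `ε₁ / 2` translated from the half-order derivative to the
  -- pairing.
  set Z := 2 * (K * C₁ * A) / (ε / 2) + 1 with hZ
  have hZ0 : 0 < Z := by positivity
  set ε₁ := ε / 2 / (4 / Real.pi * Z) with hε₁
  have hε₁0 : 0 < ε₁ := by positivity
  have hk := subConst_pos d
  set ε₂ := ε₁ / 2 * (√Real.pi ^ d * t) / subConst d with hε₂
  obtain ⟨D, ρ, β, hD1, hD₀, hρ, hβ, hβb, H⟩ := exists_abs_integral_rieszAvg_le hd (T₀ := t)
    (T₁ := t + Z ^ 2) (ε := ε₂) (M := M) hA ht (by positivity) hc₁ hC₁ hC₂ hM D₀ (min b √(2 * t))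
    (by positivity)
  refine ⟨D, ρ, β, hD1, hD₀, hρ, hβ, hβb.trans (min_le_left _ _), fun σ _ S x hx => ?_⟩
  have hhalf : ∀ τ, t ≤ τ → τ ≤ t + Z ^ 2 → ∀ y : Pl d, ‖y‖ ≤ A → |halfDeriv σ τ y| ≤ ε₁ / 2 := by
    intro τ h1 h2 y hy
    have hτ : 0 < τ := ht.trans_le h1
    have e := subConst_mul_integral_rieszAvg (σ := σ) hd hτ y
    have h3 := H σ S τ h1 h2 y hy
    have h4 : √Real.pi ^ d * τ * |halfDeriv σ τ y| ≤ subConst d * ε₂ := by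
      rw [← abs_of_pos (show 0 < √Real.pi ^ d * τ by positivity), ← abs_mul, ← e, abs_mul,
        abs_of_pos hk]
      gcongr
    have h5 : subConst d * ε₂ = √Real.pi ^ d * t * (ε₁ / 2) := by rw [hε₂]; field_simp
    have h6 : √Real.pi ^ d * t * |halfDeriv σ τ y| ≤ √Real.pi ^ d * t * (ε₁ / 2) := by
      rw [← h5]
      refine le_trans ?_ h4
      gcongr
    exact le_of_mul_le_mul_left h6 (by positivity)
  have key := abs_heatConv_sub_le_of_halfDeriv (σ := σ) hd ht hZ0 (B := K * C₁ * A) (ε := ε₁)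
    (by positivity) (x := x) (y := 0) (fun ζ h1 h2 => ?_) (fun s hs => ?_)
  · refine key.trans ?_
    have e1 : 4 / Real.pi * (ε₁ * Z) = ε / 2 := by rw [hε₁]; field_simp
    have e2 : 2 * (K * C₁ * A) / Z ≤ ε / 2 := by
      rw [div_le_iff₀ hZ0, hZ, mul_add, mul_div_cancel₀ _ (by positivity)]
      linarith
    linarith
  · have hζ : ζ ^ 2 ≤ Z ^ 2 := by gcongr
    have h3 := hhalf (t + ζ ^ 2) (by nlinarith) (by linarith) x hx
    have h4 := hhalf (t + ζ ^ 2) (by nlinarith) (by linarith) 0 (by simpa using hA)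
    refine (abs_sub _ _).trans ?_
    linarith
  · have hs0 : 0 < s := ht.trans_le hs
    refine (hdot σ C₁ s hs0 hC₁.le (S.upper _ ?_) x 0).trans ?_
    · refine (hβb.trans (min_le_right _ _)).trans (Real.sqrt_le_sqrt (by linarith))
    · rw [sub_zero]
      gcongr

/-! ### Coordinates on the hyperplane and the shadow of a flat measure -/

/-- Euclidean coordinates on a hyperplane `H`: an isometric parametrization of `H` and the
corresponding coordinates of the orthogonal projection. -/
structure PlaneCoords {d : ℕ} (H : Submodule ℝ (Sp d)) where
  param : Pl d →ₗᵢ[ℝ] Sp d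
  proj : Sp d →L[ℝ] Pl d
  param_mem : ∀ u, param u ∈ H
  param_proj : ∀ x, param (proj x) = H.starProjection x
  proj_param : ∀ u, proj (param u) = u

theorem exists_planeCoords {d : ℕ} (H : Submodule ℝ (Sp d)) (hH : Module.finrank ℝ H = d) :
    ∃ κ : PlaneCoords H, ∃ e : H ≃ₗᵢ[ℝ] Pl d, ∀ h : H, κ.param (e h) = h := by
  let e : H ≃ₗᵢ[ℝ] Pl d := ((stdOrthonormalBasis ℝ H).reindex (finCongr hH)).repr
  refine ⟨⟨H.subtypeₗᵢ.comp e.symm.toLinearIsometry,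
    (e.toContinuousLinearEquiv : H →L[ℝ] Pl d).comp H.orthogonalProjectionOnto, fun u => ?_,
    fun x => ?_, fun u => ?_⟩, e, fun h => ?_⟩
  · simp
  · change ((e.symm (e (H.orthogonalProjectionOnto x)) : H) : Sp d) = _
    rw [e.symm_apply_apply]; rfl
  · simp
  · simp

namespace PlaneCoords

variable {d : ℕ} {H : Submodule ℝ (Sp d)} (κ : PlaneCoords H)

theorem norm_proj_le (x : Sp d) : ‖κ.proj x‖ ≤ ‖x‖ := by
  rw [← κ.param.norm_map, κ.param_proj]
  exact H.norm_starProjection_apply_le x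

theorem norm_sub_param_proj_le (x y : Sp d) (hy : y ∈ H) : ‖x - κ.param (κ.proj x)‖ ≤ ‖x - y‖ := by
  rw [κ.param_proj, Submodule.starProjection_minimal]
  exact ciInf_le (f := fun w : H => ‖x - w‖) ⟨0, by rintro _ ⟨w, rfl⟩; positivity⟩ ⟨y, hy⟩

theorem norm_sub_param_proj_le_norm (x : Sp d) : ‖x - κ.param (κ.proj x)‖ ≤ ‖x‖ := by
  simpa using κ.norm_sub_param_proj_le x 0 H.zero_mem

theorem rk_param (δ : ℝ) (u : Pl d) : rk d δ (κ.param u) = κ.param (rk d δ u) := by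
  rw [rk, rk, κ.param.norm_map, map_smul]

theorem rieszKernelH_eq (δ : ℝ) (x : Sp d) :
    rieszKernelH H δ x = κ.param (κ.proj (rk d δ x)) := by
  rw [κ.param_proj, rk, map_smul]; rfl

/-- Kernel and projection commute on `H`, the parametrization being isometric; so only the kernels
at `x` and at its projection to `H` are compared. -/
theorem norm_rk_proj_sub_le {δ : ℝ} (hδ : 0 < δ) (x : Sp d) :
    ‖rk d δ (κ.proj x) - κ.proj (rk d δ x)‖ ≤
      (d + 2) * (δ ^ (d + 1))⁻¹ * ‖x - κ.param (κ.proj x)‖ := by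
  have e : rk d δ (κ.proj x) = κ.proj (rk d δ (κ.param (κ.proj x))) := by
    rw [rk_param, κ.proj_param]
  rw [e, ← map_sub, norm_sub_rev x]
  exact (κ.norm_proj_le _).trans (norm_rk_sub_le' hδ _ _)

end PlaneCoords

/-- The hypotheses of the flattening lemma at the origin and at unit scale. -/
structure FlatData {d : ℕ} (H : Submodule ℝ (Sp d)) (μ : Measure (Sp d)) (C c R a : ℝ) : Prop where
  nice : IsNice C μ
  sq_bound : ∀ δ, 0 < δ → ∀ r, 0 < r →
    ∫ x in ball 0 r, ‖∫ y in ball 0 r, rk d δ (x - y) ∂μ‖ ^ 2 ∂μ ≤ C ^ 2 * μ.real (ball 0 r)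
  lower : ∀ x ∈ μ.support, ∀ r, 0 < r → ball x r ⊆ ball 0 R →
    ENNReal.ofReal (c * r ^ d) ≤ μ (ball x r)
  near : ∀ x ∈ μ.support, ‖x‖ < R → ∃ y ∈ H, ‖x - y‖ ≤ a
  dense : ∀ x ∈ H, ‖x‖ < R → ∃ y ∈ μ.support, ‖x - y‖ ≤ a
  pairing : ∀ g : Sp d → Sp d, LipschitzWith 1 g → tsupport g ⊆ ball 0 R → ∫ x, g x ∂μ = 0 →
    ∀ δ > 0, ∃ δ' > 0, δ' ≤ δ ∧
      |∫ x, (inner ℝ (rieszRegH H μ δ' (fun _ => 1) x) (g x) : ℝ) ∂μ| ≤ 2 * a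

namespace PlaneCoords

variable {d : ℕ} {H : Submodule ℝ (Sp d)} (κ : PlaneCoords H) {μ : Measure (Sp d)}

/-- The projection to `H` of the part of `μ` in a ball. -/
def shadow (μ : Measure (Sp d)) (ρ : ℝ) : Measure (Pl d) := (μ.restrict (ball 0 ρ)).map κ.proj

instance [IsFiniteMeasure μ] (ρ : ℝ) : IsFiniteMeasure (κ.shadow μ ρ) := by
  unfold shadow; infer_instance

theorem shadow_apply (ρ : ℝ) {s : Set (Pl d)} (hs : MeasurableSet s) :
    κ.shadow μ ρ s = μ (κ.proj ⁻¹' s ∩ ball 0 ρ) := by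
  rw [shadow, Measure.map_apply κ.proj.continuous.measurable hs,
    Measure.restrict_apply (κ.proj.continuous.measurable hs)]

theorem integral_shadow {F : Type*} [NormedAddCommGroup F] [NormedSpace ℝ F] (ρ : ℝ)
    {f : Pl d → F} (hf : Continuous f)
    [SecondCountableTopology F] :
    ∫ u, f u ∂(κ.shadow μ ρ) = ∫ x in ball 0 ρ, f (κ.proj x) ∂μ :=
  integral_map κ.proj.continuous.aemeasurable hf.aestronglyMeasurable

end PlaneCoords

namespace FlatData

variable {d : ℕ} {H : Submodule ℝ (Sp d)} (κ : PlaneCoords H) {μ : Measure (Sp d)} {C c R a : ℝ}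

theorem norm_sub_param_proj_le (F : FlatData H μ C c R a) {x : Sp d} (hx : x ∈ μ.support)
    (hxR : ‖x‖ < R) : ‖x - κ.param (κ.proj x)‖ ≤ a := by
  obtain ⟨y, hy, h⟩ := F.near x hx hxR
  exact (κ.norm_sub_param_proj_le x y hy).trans h

theorem ae_near (F : FlatData H μ C c R a) {ρ : ℝ} (hρ : ρ ≤ R) :
    ∀ᵐ x ∂(μ.restrict (ball 0 ρ)), ‖x‖ < ρ ∧ ‖x - κ.param (κ.proj x)‖ ≤ a := by
  rw [ae_restrict_iff' measurableSet_ball]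
  filter_upwards [Measure.support_mem_ae (μ := μ)] with x hx hxρ
  rw [mem_ball, dist_zero_right] at hxρ
  exact ⟨hxρ, F.norm_sub_param_proj_le κ hx (hxρ.trans_le hρ)⟩

theorem shadow_upper (F : FlatData H μ C c R a) {ρ s : ℝ} (hρ : ρ ≤ R) (hs : 0 < s)
    (has : a ≤ s) (u : Pl d) :
    κ.shadow μ ρ (ball u s) ≤ ENNReal.ofReal (C * 2 ^ d * s ^ d) := by
  rw [κ.shadow_apply ρ measurableSet_ball, ← Measure.restrict_apply
    (κ.proj.continuous.measurable measurableSet_ball)]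
  calc _ ≤ (μ.restrict (ball 0 ρ)) (ball (κ.param u) (2 * s)) := by
        refine measure_mono_ae ?_
        filter_upwards [F.ae_near κ hρ] with x hx hxu
        have h1 : dist (κ.proj x) u < s := hxu
        have h2 : dist x (κ.param (κ.proj x)) ≤ a := by rw [dist_eq_norm]; exact hx.2
        have h3 : dist (κ.param (κ.proj x)) (κ.param u) < s := by rwa [κ.param.dist_map]
        change dist x (κ.param u) < 2 * s
        have h4 := dist_triangle x (κ.param (κ.proj x)) (κ.param u)
        linarith
    _ ≤ μ (ball (κ.param u) (2 * s)) := Measure.restrict_apply_le _ _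
    _ ≤ ENNReal.ofReal (C * (2 * s) ^ d) := F.nice _ _ (by positivity)
    _ = _ := by rw [mul_pow, mul_assoc]

/-- By flatness there is a support point within `s / 2` of `param u`, and its ball of radius `s / 2`
projects into `ball u s`. -/
theorem shadow_lower (F : FlatData H μ C c R a) {ρ s : ℝ} (hρ : ρ ≤ R) (hs : 0 < s)
    (has : a ≤ s / 2) {u : Pl d} (hu : ‖u‖ + s ≤ ρ) :
    ENNReal.ofReal (c / 2 ^ d * s ^ d) ≤ κ.shadow μ ρ (ball u s) := by
  obtain ⟨y, hy, hya⟩ := F.dense (κ.param u) (κ.param_mem u) (by rw [κ.param.norm_map]; linarith)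
  have hsub : ball y (s / 2) ⊆ κ.proj ⁻¹' ball u s ∩ ball 0 ρ := by
    intro x hx
    rw [mem_ball, dist_eq_norm] at hx
    have h1 : ‖x - κ.param u‖ < s := by
      have e : x - κ.param u = (x - y) - (κ.param u - y) := by abel
      rw [e]
      refine (norm_sub_le _ _).trans_lt ?_
      linarith
    constructor
    · rw [Set.mem_preimage, mem_ball, dist_eq_norm, ← κ.proj_param u, ← map_sub]
      exact (κ.norm_proj_le _).trans_lt h1
    · rw [mem_ball, dist_zero_right]
      have e : x = (x - κ.param u) + κ.param u := by abel
      rw [e]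
      refine (norm_add_le _ _).trans_lt ?_
      rw [κ.param.norm_map]
      linarith
  rw [κ.shadow_apply ρ measurableSet_ball]
  calc _ = ENNReal.ofReal (c * (s / 2) ^ d) := by rw [div_pow]; congr 1; ring
    _ ≤ μ (ball y (s / 2)) := F.lower y hy _ (by positivity)
        ((hsub.trans Set.inter_subset_right).trans (ball_subset_ball hρ))
    _ ≤ _ := measure_mono hsub

theorem measureReal_ball_le (F : FlatData H μ C c R a) (hC : 0 < C) {r : ℝ} (hr : 0 < r)
    (x : Sp d) : μ.real (ball x r) ≤ C * r ^ d := by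
  rw [measureReal_def]
  exact ENNReal.toReal_le_of_le_ofReal (by positivity) (F.nice x r hr)

theorem shadow_mass (F : FlatData H μ C c R a) (hC : 0 < C) {ρ : ℝ} (hρ : 0 < ρ) :
    (κ.shadow μ ρ).real Set.univ ≤ C * 2 ^ d * ρ ^ d := by
  rw [measureReal_def, κ.shadow_apply ρ MeasurableSet.univ, Set.preimage_univ, Set.univ_inter,
    ← measureReal_def]
  refine (F.measureReal_ball_le hC hρ 0).trans ?_
  have : (1 : ℝ) ≤ 2 ^ d := one_le_pow₀ (by norm_num)
  gcongr
  nlinarith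

theorem rpot_shadow {δ : ℝ} (hδ : 0 < δ) (ρ : ℝ) (u : Pl d) :
    rpot (κ.shadow μ ρ) δ u = ∫ y in ball 0 ρ, rk d δ (u - κ.proj y) ∂μ := by
  have hc : Continuous fun w => rk d δ (u - w) := (continuous_rk hδ).comp (by fun_prop)
  rw [rpot, κ.integral_shadow ρ hc]

variable [IsFiniteMeasure μ]

theorem integrable_rk_sub {δ : ℝ} (hδ : 0 < δ) (ν : Measure (Sp d)) [IsFiniteMeasure ν]
    (x : Sp d) : Integrable (fun y => rk d δ (x - y)) ν :=
  Integrable.of_bound ((continuous_rk hδ).comp (by fun_prop)).aestronglyMeasurable _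
    (Eventually.of_forall fun _ => norm_rk_le hδ _)

/-- The Riesz potential of the shadow is close to the projected Riesz potential of `μ`. -/
theorem norm_rpot_shadow_sub_le (F : FlatData H μ C c R a) (hC : 0 < C) (ha : 0 ≤ a) {δ ρ : ℝ}
    (hδ : 0 < δ) (hρ0 : 0 < ρ) (hρ : ρ ≤ R) {x : Sp d} (hx : ‖x - κ.param (κ.proj x)‖ ≤ a) :
    ‖rpot (κ.shadow μ ρ) δ (κ.proj x) - κ.proj (∫ y in ball 0 ρ, rk d δ (x - y) ∂μ)‖ ≤
      (d + 2) * (δ ^ (d + 1))⁻¹ * (2 * a) * (C * ρ ^ d) := by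
  rw [rpot_shadow κ hδ, ← ContinuousLinearMap.integral_comp_comm _ (integrable_rk_sub hδ _ x),
    ← integral_sub]
  · refine (norm_integral_le_of_norm_le_const
      (C := (d + 2) * (δ ^ (d + 1))⁻¹ * (2 * a)) ?_).trans ?_
    · filter_upwards [F.ae_near κ hρ] with y hy
      rw [← map_sub]
      refine (κ.norm_rk_proj_sub_le hδ _).trans ?_
      gcongr
      have e : x - y - κ.param (κ.proj (x - y)) =
          (x - κ.param (κ.proj x)) - (y - κ.param (κ.proj y)) := by
        rw [map_sub, map_sub]; abel
      rw [e]
      refine (norm_sub_le _ _).trans ?_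
      linarith [hy.2]
    · rw [measureReal_restrict_apply_univ]
      have := F.measureReal_ball_le hC hρ0 0
      gcongr
  · exact Integrable.of_bound ((continuous_rk hδ).comp (by fun_prop)).aestronglyMeasurable _
      (Eventually.of_forall fun _ => norm_rk_le hδ _)
  · exact κ.proj.integrable_comp (integrable_rk_sub hδ _ x)

theorem continuous_integral_rk_sub {δ : ℝ} (hδ : 0 < δ) (ν : Measure (Sp d)) [IsFiniteMeasure ν] :
    Continuous fun x => ∫ y, rk d δ (x - y) ∂ν :=
  continuous_of_dominated (fun x => (integrable_rk_sub hδ ν x).aestronglyMeasurable)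
    (fun x => Eventually.of_forall fun y => norm_rk_le hδ _) (integrable_const _)
    (Eventually.of_forall fun y => (continuous_rk hδ).comp (by fun_prop))

/-- The potential of the shadow differs from the projected potential of `μ` by at most `1`, and `(s
+ 1)² ≤ 2 s² + 2`. -/
theorem shadow_sq_bound (F : FlatData H μ C c R a) (hC : 0 < C) (ha : 0 ≤ a) {δ ρ : ℝ}
    (hδ : 0 < δ) (hρ0 : 0 < ρ) (hρ : ρ ≤ R)
    (hsmall : (d + 2) * (δ ^ (d + 1))⁻¹ * (2 * a) * (C * ρ ^ d) ≤ 1) :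
    ∫ u, ‖rpot (κ.shadow μ ρ) δ u‖ ^ 2 ∂(κ.shadow μ ρ) ≤ (2 * C ^ 3 + 2 * C) * ρ ^ d := by
  have hv : Continuous (rpot (κ.shadow μ ρ) δ) := (bddLip_rpot hδ le_rfl).continuous
  have hv2 : Continuous fun u => ‖rpot (κ.shadow μ ρ) δ u‖ ^ 2 := hv.norm.pow 2
  rw [κ.integral_shadow ρ hv2]
  have hw := continuous_integral_rk_sub hδ (μ.restrict (ball 0 ρ))
  have hwi : Integrable (fun x => ‖∫ y in ball 0 ρ, rk d δ (x - y) ∂μ‖ ^ 2)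
      (μ.restrict (ball 0 ρ)) := by
    refine Integrable.of_bound (hw.norm.pow 2).aestronglyMeasurable
      (((δ ^ d)⁻¹ * (μ.restrict (ball 0 ρ)).real Set.univ) ^ 2) (Eventually.of_forall fun x => ?_)
    rw [Real.norm_of_nonneg (by positivity)]
    gcongr
    exact norm_integral_le_of_norm_le_const (Eventually.of_forall fun _ => norm_rk_le hδ _)
  have hb := F.measureReal_ball_le hC hρ0 0
  calc _ ≤ ∫ x in ball 0 ρ, (2 * ‖∫ y in ball 0 ρ, rk d δ (x - y) ∂μ‖ ^ 2 + 2) ∂μ := by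
        refine integral_mono_of_nonneg (Eventually.of_forall fun x => sq_nonneg _)
          ((hwi.const_mul 2).add (integrable_const _)) ?_
        filter_upwards [F.ae_near κ hρ] with x hx
        have h1 := (F.norm_rpot_shadow_sub_le κ hC ha hδ hρ0 hρ hx.2).trans hsmall
        have h2 := κ.norm_proj_le (∫ y in ball 0 ρ, rk d δ (x - y) ∂μ)
        have h3 := norm_le_norm_add_norm_sub' (rpot (κ.shadow μ ρ) δ (κ.proj x))
          (κ.proj (∫ y in ball 0 ρ, rk d δ (x - y) ∂μ))
        have h4 : ‖rpot (κ.shadow μ ρ) δ (κ.proj x)‖ ≤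
          ‖∫ y in ball 0 ρ, rk d δ (x - y) ∂μ‖ + 1 := by linarith
        have h5 := pow_le_pow_left₀ (norm_nonneg _) h4 2
        nlinarith [sq_nonneg (‖∫ y in ball 0 ρ, rk d δ (x - y) ∂μ‖ - 1)]
    _ = 2 * (∫ x in ball 0 ρ, ‖∫ y in ball 0 ρ, rk d δ (x - y) ∂μ‖ ^ 2 ∂μ) +
          2 * μ.real (ball 0 ρ) := by
        rw [integral_add (hwi.const_mul 2) (integrable_const _), integral_const_mul,
          integral_const, measureReal_restrict_apply_univ, smul_eq_mul, mul_comm _ (2 : ℝ)]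
    _ ≤ 2 * (C ^ 2 * (C * ρ ^ d)) + 2 * (C * ρ ^ d) := by
        have := F.sq_bound δ hδ ρ hρ0
        have : C ^ 2 * μ.real (ball 0 ρ) ≤ C ^ 2 * (C * ρ ^ d) := by gcongr
        linarith
    _ = _ := by ring

end FlatData

/-! ### Dependence of the pairing on the truncation -/

section Antisymmetrization

variable {d : ℕ} (H : Submodule ℝ (Sp d)) {μ : Measure (Sp d)} [IsFiniteMeasure μ]
  {g : Sp d → Sp d} {M L : ℝ}

theorem norm_rieszKernelH_le {δ : ℝ} (hδ : 0 < δ) (x : Sp d) :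
    ‖rieszKernelH H δ x‖ ≤ (δ ^ d)⁻¹ := by
  have e : rieszKernelH H δ x = H.starProjection (rk d δ x) := by rw [rk, map_smul]; rfl
  rw [e]
  exact (H.norm_starProjection_apply_le _).trans (norm_rk_le hδ x)

theorem continuous_rieszKernelH {δ : ℝ} (hδ : 0 < δ) :
    Continuous (rieszKernelH H δ : Sp d → Sp d) := by
  have e : (rieszKernelH H δ : Sp d → Sp d) = fun x => H.starProjection (rk d δ x) := by
    ext1 x; rw [rk, map_smul]; rfl
  rw [e]
  exact H.starProjection.continuous.comp (continuous_rk hδ)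

theorem integral_inner_rieszRegH (hg : BddLip g M L) {δ : ℝ} (hδ : 0 < δ) :
    Integrable (fun p : Sp d × Sp d => (inner ℝ (rieszKernelH H δ (p.1 - p.2)) (g p.1 - g p.2) : ℝ))
      (μ.prod μ) ∧
    ∫ x, (inner ℝ (rieszRegH H μ δ (fun _ => 1) x) (g x) : ℝ) ∂μ =
      (1 / 2) * ∫ p, inner ℝ (rieszKernelH H δ (p.1 - p.2)) (g p.1 - g p.2) ∂(μ.prod μ) := by
  have hc := continuous_rieszKernelH H hδ
  have hgc := hg.continuous
  have hM := hg.nonneg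
  have hc2 : Continuous fun p : Sp d × Sp d => rieszKernelH H δ (p.1 - p.2) :=
    hc.comp (continuous_fst.sub continuous_snd)
  have hint : ∀ x, Integrable (fun y => rieszKernelH H δ (x - y)) μ := fun x =>
    Integrable.of_bound (hc.comp (continuous_const.sub continuous_id)).aestronglyMeasurable
      _ (Eventually.of_forall fun y => norm_rieszKernelH_le H hδ _)
  have hi1 : Integrable (fun p : Sp d × Sp d =>
      (inner ℝ (rieszKernelH H δ (p.1 - p.2)) (g p.1) : ℝ)) (μ.prod μ) := by
    refine Integrable.of_bound (hc2.inner (hgc.comp continuous_fst)).aestronglyMeasurable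
      ((δ ^ d)⁻¹ * M) (Eventually.of_forall fun p => ?_)
    refine (norm_inner_le_norm _ _).trans ?_
    gcongr
    exacts [norm_rieszKernelH_le H hδ _, hg.bdd _]
  have hi2 : Integrable (fun p : Sp d × Sp d =>
      (inner ℝ (rieszKernelH H δ (p.1 - p.2)) (g p.2) : ℝ)) (μ.prod μ) := by
    refine Integrable.of_bound (hc2.inner (hgc.comp continuous_snd)).aestronglyMeasurable
      ((δ ^ d)⁻¹ * M) (Eventually.of_forall fun p => ?_)
    refine (norm_inner_le_norm _ _).trans ?_
    gcongr
    exacts [norm_rieszKernelH_le H hδ _, hg.bdd _]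
  have hA : ∫ x, (inner ℝ (rieszRegH H μ δ (fun _ => 1) x) (g x) : ℝ) ∂μ =
      ∫ p, inner ℝ (rieszKernelH H δ (p.1 - p.2)) (g p.1) ∂(μ.prod μ) := by
    rw [integral_prod _ hi1]
    refine integral_congr_ae (Eventually.of_forall fun x => ?_)
    simp only [rieszRegH, one_smul]
    rw [real_inner_comm, ← integral_inner (hint x)]
    simp only [real_inner_comm]
  have hB : ∫ p, (inner ℝ (rieszKernelH H δ (p.1 - p.2)) (g p.2) : ℝ) ∂(μ.prod μ) =
      - ∫ p, inner ℝ (rieszKernelH H δ (p.1 - p.2)) (g p.1) ∂(μ.prod μ) := by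
    rw [← integral_prod_swap, ← integral_neg]
    refine integral_congr_ae (Eventually.of_forall fun p => ?_)
    simp only [Prod.fst_swap, Prod.snd_swap, rieszKernelH]
    rw [← neg_sub p.1 p.2, norm_neg, map_neg, smul_neg, inner_neg_left]
  simp only [inner_sub_right]
  refine ⟨hi1.sub hi2, ?_⟩
  rw [integral_sub hi1 hi2, hB, hA]
  ring

theorem norm_rieszKernelH_sub_le {δ δ' : ℝ} (hδ' : 0 < δ') (h : δ' ≤ δ) {x : Sp d} (hx : x ≠ 0) :
    ‖rieszKernelH H δ' x - rieszKernelH H δ x‖ ≤ (‖x‖ ^ (d + 1))⁻¹ * ‖x‖ := by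
  have hx0 : 0 < ‖x‖ := norm_pos_iff.2 hx
  have hm' : 0 < max δ' ‖x‖ := lt_max_of_lt_left hδ'
  have hle : max δ' ‖x‖ ≤ max δ ‖x‖ := max_le_max h le_rfl
  have hm : 0 < max δ ‖x‖ := hm'.trans_le hle
  rw [rieszKernelH, rieszKernelH, ← sub_smul, norm_smul]
  have h1 : (max δ ‖x‖ ^ (d + 1))⁻¹ ≤ (max δ' ‖x‖ ^ (d + 1))⁻¹ := by gcongr
  have h2 : (max δ' ‖x‖ ^ (d + 1))⁻¹ ≤ (‖x‖ ^ (d + 1))⁻¹ := by gcongr; exact le_max_right _ _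
  have h3 : 0 < (max δ ‖x‖ ^ (d + 1))⁻¹ := by positivity
  rw [Real.norm_of_nonneg (by linarith)]
  gcongr
  · linarith
  · exact H.norm_starProjection_apply_le x

theorem lintegral_prod_near_le {X : Type*} [MetricSpace X] [MeasurableSpace X] [BorelSpace X]
    [SecondCountableTopology X] {ν : Measure X} [SFinite ν] {e : ℕ} {C δ : ℝ} (hC : 0 ≤ C)
    (hδ : 0 < δ) (hν : ∀ x r, 0 < r → ν (ball x r) ≤ ENNReal.ofReal (C * r ^ (e + 1))) (s : Set X)
    (hs : MeasurableSet s) :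
    ∫⁻ p : X × X, (s.indicator 1 p.1 + s.indicator 1 p.2) *
      {q : X × X | dist q.2 q.1 < δ}.indicator (fun q => ENNReal.ofReal ((dist q.2 q.1 ^ e)⁻¹)) p
        ∂(ν.prod ν) ≤ 2 * (ν s * ENNReal.ofReal (C * 2 ^ (e + 1) * δ)) := by
  set k : X × X → ENNReal :=
    {q : X × X | dist q.2 q.1 < δ}.indicator fun q => ENNReal.ofReal ((dist q.2 q.1 ^ e)⁻¹) with hk
  have hset : MeasurableSet {q : X × X | dist q.2 q.1 < δ} :=
    (isOpen_lt (continuous_snd.dist continuous_fst) continuous_const).measurableSet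
  have hdm : Measurable fun q : X × X => dist q.2 q.1 :=
    (continuous_snd.dist continuous_fst).measurable
  have hkm : Measurable k := ((hdm.pow_const e).inv.ennreal_ofReal).indicator hset
  have hsm : Measurable (s.indicator (1 : X → ENNReal)) := measurable_one.indicator hs
  have hm1 : Measurable fun p : X × X => s.indicator (1 : X → ENNReal) p.1 * k p :=
    (hsm.comp measurable_fst).mul hkm
  have hk1 : ∀ x, ∫⁻ y, k (x, y) ∂ν ≤ ENNReal.ofReal (C * 2 ^ (e + 1) * δ) := fun x => by
    refine le_trans (le_of_eq ?_) (lintegral_inv_dist_pow_near hC hδ (x := x) (hν x))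
    rw [← lintegral_indicator measurableSet_ball]
    rfl
  have hsym : ∀ x y, k (x, y) = k (y, x) := fun x y => by
    simp only [hk, Set.indicator_apply, Set.mem_ofPred_eq, dist_comm x y]
  have h1 : ∫⁻ p, s.indicator (1 : X → ENNReal) p.1 * k p ∂(ν.prod ν) ≤
      ν s * ENNReal.ofReal (C * 2 ^ (e + 1) * δ) := by
    rw [lintegral_prod _ hm1.aemeasurable]
    calc _ ≤ ∫⁻ x, s.indicator (1 : X → ENNReal) x * ENNReal.ofReal (C * 2 ^ (e + 1) * δ) ∂ν := by
          refine lintegral_mono fun x => ?_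
          simp only
          have hkx : Measurable fun y => k (x, y) := hkm.comp measurable_prodMk_left
          rw [lintegral_const_mul _ hkx]
          gcongr
          exact hk1 x
      _ = _ := by rw [lintegral_mul_const _ hsm, lintegral_indicator_one hs]
  have h2 : ∫⁻ p, s.indicator (1 : X → ENNReal) p.2 * k p ∂(ν.prod ν) =
      ∫⁻ p, s.indicator (1 : X → ENNReal) p.1 * k p ∂(ν.prod ν) := by
    rw [← lintegral_prod_swap]
    refine lintegral_congr fun p => ?_
    rw [hsym]
    rfl
  simp only [add_mul]
  rw [lintegral_add_left hm1, h2, two_mul]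
  gcongr

/-- After antisymmetrization the two integrands differ only where `‖x - y‖ < δ` and one of the
points lies in the support ball. The difference there is at most `L ‖x - y‖^{-e}`, whose integral is
`O(δ)` by the growth of `μ`. The bound is uniform in the smaller truncation `δ'`, so the hypothesis
may be used at an uncontrolled `δ'`. -/
theorem abs_integral_inner_rieszRegH_sub_le {e : ℕ} {H : Submodule ℝ (Sp (e + 1))}
    {μ : Measure (Sp (e + 1))} [IsFiniteMeasure μ] {g : Sp (e + 1) → Sp (e + 1)} {C r : ℝ}
    (hC : 0 < C) (hμ : IsNice C μ) (hg : BddLip g M L) (hL : 0 ≤ L) (hr : 0 < r)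
    (hg0 : ∀ x, r ≤ ‖x‖ → g x = 0) {δ δ' : ℝ} (hδ' : 0 < δ') (h : δ' ≤ δ) :
    |(∫ x, (inner ℝ (rieszRegH H μ δ' (fun _ => 1) x) (g x) : ℝ) ∂μ) -
      ∫ x, (inner ℝ (rieszRegH H μ δ (fun _ => 1) x) (g x) : ℝ) ∂μ| ≤
      L * (C * r ^ (e + 1)) * (C * 2 ^ (e + 1) * δ) := by
  have hδ : 0 < δ := hδ'.trans_le h
  obtain ⟨i1, e1⟩ := integral_inner_rieszRegH H (μ := μ) hg hδ'
  obtain ⟨i2, e2⟩ := integral_inner_rieszRegH H (μ := μ) hg hδ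
  rw [e1, e2, ← mul_sub, ← integral_sub i1 i2]
  have hpt : ∀ p : Sp (e + 1) × Sp (e + 1),
      ‖(inner ℝ (rieszKernelH H δ' (p.1 - p.2)) (g p.1 - g p.2) : ℝ) -
        inner ℝ (rieszKernelH H δ (p.1 - p.2)) (g p.1 - g p.2)‖ₑ ≤
      ENNReal.ofReal L * (((ball 0 r).indicator 1 p.1 + (ball 0 r).indicator 1 p.2) *
        {q : Sp (e + 1) × Sp (e + 1) | dist q.2 q.1 < δ}.indicator
          (fun q => ENNReal.ofReal ((dist q.2 q.1 ^ e)⁻¹)) p) := by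
    rintro ⟨x, y⟩
    simp only
    rw [← inner_sub_left]
    by_cases hxy : dist y x < δ
    swap
    · have hδx : δ ≤ ‖x - y‖ := by rw [← dist_eq_norm, dist_comm]; exact not_lt.1 hxy
      have : rieszKernelH H δ' (x - y) - rieszKernelH H δ (x - y) = 0 := by
        rw [rieszKernelH, rieszKernelH, max_eq_right hδx, max_eq_right (h.trans hδx), sub_self]
      rw [this, inner_zero_left, enorm_zero]
      exact zero_le
    by_cases hsupp : ‖x‖ < r ∨ ‖y‖ < r
    swap
    · push Not at hsupp
      rw [hg0 x hsupp.1, hg0 y hsupp.2, sub_self, inner_zero_right, enorm_zero]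
      exact zero_le
    rcases eq_or_ne x y with rfl | hne
    · rw [sub_self (g x), inner_zero_right, enorm_zero]
      exact zero_le
    have hne' : x - y ≠ 0 := sub_ne_zero.2 hne
    have hpos : 0 < ‖x - y‖ := norm_pos_iff.2 hne'
    have h1 : (1 : ENNReal) ≤ (ball 0 r).indicator 1 x + (ball 0 r).indicator 1 y := by
      rcases hsupp with hs | hs
      · refine le_trans ?_ le_self_add
        rw [Set.indicator_of_mem (by simpa using hs)]; rfl
      · refine le_trans ?_ le_add_self
        rw [Set.indicator_of_mem (by simpa using hs)]; rfl
    rw [Set.indicator_of_mem (show (x, y) ∈ {q : Sp (e + 1) × Sp (e + 1) | dist q.2 q.1 < δ} from hxy)]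
    calc _ ≤ ENNReal.ofReal (L * (‖x - y‖ ^ e)⁻¹) := by
          rw [← ofReal_norm]
          refine ENNReal.ofReal_le_ofReal ((norm_inner_le_norm _ _).trans ?_)
          have h3 := norm_rieszKernelH_sub_le H hδ' h hne'
          have h4 := hg.lip x y
          calc _ ≤ (‖x - y‖ ^ (e + 1 + 1))⁻¹ * ‖x - y‖ * (L * ‖x - y‖) := by gcongr
            _ = _ := by field_simp; ring
      _ = ENNReal.ofReal L * (1 * ENNReal.ofReal ((dist y x ^ e)⁻¹)) := by
          rw [ENNReal.ofReal_mul hL, one_mul, dist_comm, dist_eq_norm]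
      _ ≤ _ := by gcongr
  have hb : ‖∫ p : Sp (e + 1) × Sp (e + 1), (((inner ℝ (rieszKernelH H δ' (p.1 - p.2))
      (g p.1 - g p.2) : ℝ) - inner ℝ (rieszKernelH H δ (p.1 - p.2)) (g p.1 - g p.2))) ∂(μ.prod μ)‖ₑ ≤
      ENNReal.ofReal (2 * (L * (C * r ^ (e + 1)) * (C * 2 ^ (e + 1) * δ))) := by
    refine (enorm_integral_le_lintegral_enorm _).trans ((lintegral_mono hpt).trans ?_)
    rw [lintegral_const_mul' _ _ ENNReal.ofReal_ne_top]
    calc _ ≤ ENNReal.ofReal L * (2 * (μ (ball 0 r) * ENNReal.ofReal (C * 2 ^ (e + 1) * δ))) := by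
          gcongr
          exact lintegral_prod_near_le hC.le hδ (fun x s hs => hμ x s hs) _ measurableSet_ball
      _ ≤ ENNReal.ofReal L * (2 * (ENNReal.ofReal (C * r ^ (e + 1)) *
            ENNReal.ofReal (C * 2 ^ (e + 1) * δ))) := by
          gcongr
          exact hμ 0 r hr
      _ = _ := by
          rw [← ENNReal.ofReal_mul (by positivity), show (2 : ENNReal) = ENNReal.ofReal 2 by simp,
            ← ENNReal.ofReal_mul (by norm_num), ← ENNReal.ofReal_mul hL]
          congr 1; ring
  rw [← ofReal_norm, ENNReal.ofReal_le_ofReal_iff (by positivity), Real.norm_eq_abs] at hb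
  rw [abs_mul, abs_of_pos (by norm_num : (0 : ℝ) < 1 / 2)]
  linarith

end Antisymmetrization

/-! ### The far field -/

section Far

variable {d : ℕ} {μ : Measure (Sp d)} [IsFiniteMeasure μ]

/-- The gradient of the kernel is `O(‖y‖^{-d-1})`, which integrates to `O(1 / ρ)` off the ball. One
factor `2^{d+1}` comes from `‖x - y‖ ≥ ‖y‖ / 2` and the other from the dyadic sum. -/
theorem norm_integral_rk_far_sub_le {C ρ δ : ℝ} (hC : 0 < C) (hμ : IsNice C μ) (hρ : 0 < ρ)
    (hδ : 0 < δ) {x : Sp d} (hx : 2 * ‖x‖ ≤ ρ) :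
    ‖(∫ y in (ball 0 ρ)ᶜ, rk d δ (x - y) ∂μ) - ∫ y in (ball 0 ρ)ᶜ, rk d δ (0 - y) ∂μ‖ ≤
      (d + 2) * 4 ^ (d + 1) * C * (‖x‖ / ρ) := by
  have hm : Measurable fun y : Sp d => (dist y 0 ^ (d + 1))⁻¹ := by fun_prop
  have hbd : ∀ᵐ y ∂(μ.restrict (ball 0 ρ)ᶜ), ρ ≤ dist y 0 := by
    rw [ae_restrict_iff' measurableSet_ball.compl]
    refine Eventually.of_forall fun y hy => ?_
    rwa [Set.mem_compl_iff, mem_ball, not_lt] at hy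
  have hi : Integrable (fun y : Sp d => (dist y 0 ^ (d + 1))⁻¹) (μ.restrict (ball 0 ρ)ᶜ) := by
    refine Integrable.of_bound hm.aestronglyMeasurable (ρ ^ (d + 1))⁻¹ ?_
    filter_upwards [hbd] with y hy
    rw [Real.norm_of_nonneg (by positivity)]
    gcongr
  have hI : ∫ y in (ball (0 : Sp d) ρ)ᶜ, (dist y 0 ^ (d + 1))⁻¹ ∂μ ≤ C * 2 ^ (d + 1) / ρ := by
    rw [integral_eq_lintegral_of_nonneg_ae (Eventually.of_forall fun y => by positivity)
      hm.aestronglyMeasurable]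
    exact ENNReal.toReal_le_of_le_ofReal (by positivity)
      (lintegral_inv_dist_pow_far hC.le hρ fun r hr => hμ 0 r hr)
  rw [← integral_sub (FlatData.integrable_rk_sub hδ _ x) (FlatData.integrable_rk_sub hδ _ 0)]
  calc _ ≤ ∫ y in (ball (0 : Sp d) ρ)ᶜ, (d + 2) * 2 ^ (d + 1) * ‖x‖ * (dist y 0 ^ (d + 1))⁻¹ ∂μ := by
        refine norm_integral_le_of_norm_le (hi.const_mul _) ?_
        filter_upwards [hbd] with y hy
        have hy0 : 0 < dist y 0 := hρ.trans_le hy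
        have h1 : dist y 0 / 2 ≤ ‖x - y‖ := by
          have := norm_sub_norm_le y x
          rw [norm_sub_rev] at this
          rw [dist_zero_right] at hy ⊢
          linarith
        have h2 : dist y 0 / 2 ≤ ‖(0 : Sp d) - y‖ := by
          rw [zero_sub, norm_neg, dist_zero_right]
          linarith [norm_nonneg y]
        refine (norm_rk_sub_le (m := dist y 0 / 2) (by positivity)
          (h1.trans (le_max_right _ _)) (h2.trans (le_max_right _ _))).trans (le_of_eq ?_)
        rw [div_pow, sub_sub_sub_cancel_right, sub_zero, inv_div]
        ring
    _ = (d + 2) * 2 ^ (d + 1) * ‖x‖ * ∫ y in (ball (0 : Sp d) ρ)ᶜ, (dist y 0 ^ (d + 1))⁻¹ ∂μ :=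
        integral_const_mul _ _
    _ ≤ (d + 2) * 2 ^ (d + 1) * ‖x‖ * (C * 2 ^ (d + 1) / ρ) := by gcongr
    _ = _ := by
      rw [show (4 : ℝ) = 2 * 2 by norm_num, mul_pow]; ring

end Far

/-! ### Transferring the pairing hypothesis to the shadow -/

namespace PlaneCoords

variable {d : ℕ} {H : Submodule ℝ (Sp d)} (κ : PlaneCoords H)

/-- The extension of a field on the hyperplane to a thin neighbourhood. -/
def extend (g : Pl d → Pl d) (x : Sp d) : Sp d :=
  cutoff 1 (x - κ.param (κ.proj x)) • κ.param (g (κ.proj x))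

theorem bddLip_extend {g : Pl d → Pl d} {M L : ℝ} (hL : 0 ≤ L) (hg : BddLip g M L) :
    BddLip (κ.extend g) M (L + M) := by
  have h1 : BddLip (fun x => cutoff 1 (x - κ.param (κ.proj x))) 1 1 := by
    have hc := bddLip_cutoff (X := Sp d) le_rfl
    refine ⟨fun x => hc.bdd _, fun x y => (hc.lip _ _).trans ?_⟩
    rw [one_mul, one_mul]
    have e : x - κ.param (κ.proj x) - (y - κ.param (κ.proj y)) =
        (x - y) - κ.param (κ.proj (x - y)) := by rw [map_sub, map_sub]; abel
    rw [e]
    exact κ.norm_sub_param_proj_le_norm _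
  have h2 : BddLip (fun x => κ.param (g (κ.proj x))) M L := by
    refine ⟨fun x => by rw [κ.param.norm_map]; exact hg.bdd _, fun x y => ?_⟩
    rw [← map_sub, κ.param.norm_map]
    refine (hg.lip _ _).trans ?_
    rw [← map_sub]
    gcongr
    exact κ.norm_proj_le _
  exact (h1.smul h2).mono (by linarith) (by linarith)

theorem extend_eq_zero {g : Pl d → Pl d} {D : ℝ} (hD : 1 ≤ D) (hg : ∀ u, 2 * D ≤ ‖u‖ → g u = 0)
    {x : Sp d} (hx : 4 * D ≤ ‖x‖) : κ.extend g x = 0 := by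
  rw [extend]
  rcases le_total (2 * D) ‖κ.proj x‖ with h | h
  · rw [hg _ h, map_zero, smul_zero]
  · have h1 := norm_le_norm_add_norm_sub' x (κ.param (κ.proj x))
    rw [κ.param.norm_map] at h1
    rw [cutoff_eq_zero one_pos (by linarith), zero_smul]

theorem extend_eq {g : Pl d → Pl d} {x : Sp d} (hx : ‖x - κ.param (κ.proj x)‖ ≤ 1) :
    κ.extend g x = κ.param (g (κ.proj x)) := by
  rw [extend, cutoff_eq_one one_pos hx, one_smul]

end PlaneCoords

namespace FlatData

variable {d : ℕ} {H : Submodule ℝ (Sp d)} (κ : PlaneCoords H) {μ : Measure (Sp d)} {C c R a : ℝ}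

theorem setIntegral_extend (F : FlatData H μ C c R a) (ha1 : a ≤ 1) {ρ : ℝ} (hρR : ρ ≤ R)
    {E : Type*} [NormedAddCommGroup E] [NormedSpace ℝ E] {g : Pl d → Pl d}
    (T : Sp d → Sp d → E) :
    ∫ x in ball 0 ρ, T x (κ.extend g x) ∂μ =
      ∫ x in ball 0 ρ, T x (κ.param (g (κ.proj x))) ∂μ := by
  refine integral_congr_ae ?_
  filter_upwards [F.ae_near κ hρR] with x hx
  rw [κ.extend_eq (hx.2.trans ha1)]

variable [IsFiniteMeasure μ]

theorem integral_extend (F : FlatData H μ C c R a) (ha1 : a ≤ 1) {D ρ : ℝ} (hD : 1 ≤ D)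
    (hDρ : 8 * D ≤ ρ) (hρR : ρ ≤ R) {g : Pl d → Pl d} {M L : ℝ} (hg : BddLip g M L)
    (hg0 : ∀ u, 2 * D ≤ ‖u‖ → g u = 0) :
    ∫ x, κ.extend g x ∂μ = κ.param (∫ u, g u ∂(κ.shadow μ ρ)) := by
  rw [← setIntegral_eq_integral_of_forall_compl_eq_zero (s := ball 0 ρ),
    F.setIntegral_extend κ ha1 hρR fun _ v => v, κ.integral_shadow ρ hg.continuous]
  · exact κ.param.toContinuousLinearMap.integral_comp_comm
      (Integrable.of_bound (hg.continuous.comp κ.proj.continuous).aestronglyMeasurable M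
        (Eventually.of_forall fun x => hg.bdd _))
  · intro x hx
    rw [mem_ball, dist_zero_right, not_lt] at hx
    exact κ.extend_eq_zero hD hg0 (by linarith)

theorem rieszRegH_eq {δ : ℝ} (hδ : 0 < δ) (ρ : ℝ) (x : Sp d) :
    rieszRegH H μ δ (fun _ => 1) x = κ.param (κ.proj (∫ y in ball 0 ρ, rk d δ (x - y) ∂μ)) +
      κ.param (κ.proj (∫ y in (ball 0 ρ)ᶜ, rk d δ (x - y) ∂μ)) := by
  have hi := integrable_rk_sub hδ μ x
  rw [← map_add, ← map_add, integral_add_compl measurableSet_ball hi, rieszRegH]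
  simp only [one_smul, κ.rieszKernelH_eq]
  exact (κ.param.toContinuousLinearMap.comp κ.proj).integral_comp_comm hi

/-- The potential of `μ` is split at radius `ρ`. The inner part is the potential of the shadow up to
the flatness error. The outer part is nearly constant on the support of the field, and the mean zero
condition removes the constant. -/
theorem abs_integral_inner_shadow_sub_le (F : FlatData H μ C c R a) (hC : 0 < C) (ha : 0 ≤ a)
    (ha1 : a ≤ 1) {D ρ δ : ℝ} (hD : 1 ≤ D) (hDρ : 8 * D ≤ ρ) (hρR : ρ ≤ R) (hδ : 0 < δ)
    {g : Pl d → Pl d} {M L : ℝ} (hL : 0 ≤ L) (hg : BddLip g M L)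
    (hg0 : ∀ u, 2 * D ≤ ‖u‖ → g u = 0) (hgi : ∫ u, g u ∂(κ.shadow μ ρ) = 0) :
    |(∫ u, (inner ℝ (rpot (κ.shadow μ ρ) δ u) (g u) : ℝ) ∂(κ.shadow μ ρ)) -
      ∫ x, (inner ℝ (rieszRegH H μ δ (fun _ => 1) x) (κ.extend g x) : ℝ) ∂μ| ≤
      (d + 2) * (δ ^ (d + 1))⁻¹ * (2 * a) * (C * ρ ^ d) * M * (C * ρ ^ d) +
      (d + 2) * 4 ^ (d + 1) * C * (4 * D / ρ) * ∫ u, ‖g u‖ ∂(κ.shadow μ ρ) := by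
  have hρ0 : 0 < ρ := by linarith
  have hD0 : 0 < D := by linarith
  have hGL := κ.bddLip_extend hL hg
  have hM := hg.nonneg
  set σ := κ.shadow μ ρ with hσ
  set W : Sp d → Sp d := fun x => ∫ y in ball 0 ρ, rk d δ (x - y) ∂μ with hW
  set V : Sp d → Sp d := fun x => ∫ y in (ball 0 ρ)ᶜ, rk d δ (x - y) ∂μ with hV
  have hWc : Continuous W := continuous_integral_rk_sub hδ _
  have hVc : Continuous V := continuous_integral_rk_sub hδ _
  have hvc : Continuous (rpot σ δ) := (bddLip_rpot hδ le_rfl).continuous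
  have hgc : Continuous fun x => g (κ.proj x) := hg.continuous.comp κ.proj.continuous
  have hbdW : ∀ ν : Measure (Sp d), ∀ [IsFiniteMeasure ν], ∀ x, ‖∫ y, rk d δ (x - y) ∂ν‖ ≤
      (δ ^ d)⁻¹ * ν.real Set.univ := fun ν _ x =>
    norm_integral_le_of_norm_le_const (Eventually.of_forall fun _ => norm_rk_le hδ _)
  have e1 : ∫ u, (inner ℝ (rpot σ δ u) (g u) : ℝ) ∂σ =
      ∫ x in ball 0 ρ, inner ℝ (rpot σ δ (κ.proj x)) (g (κ.proj x)) ∂μ :=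
    κ.integral_shadow ρ (f := fun u => (inner ℝ (rpot σ δ u) (g u) : ℝ))
      (hvc.inner hg.continuous)
  have e2 : ∫ x, (inner ℝ (rieszRegH H μ δ (fun _ => 1) x) (κ.extend g x) : ℝ) ∂μ =
      ∫ x in ball 0 ρ, ((inner ℝ (κ.proj (W x)) (g (κ.proj x)) : ℝ) +
        inner ℝ (κ.proj (V x)) (g (κ.proj x))) ∂μ := by
    rw [← setIntegral_eq_integral_of_forall_compl_eq_zero (s := ball 0 ρ),
      F.setIntegral_extend κ ha1 hρR
        fun x v => (inner ℝ (rieszRegH H μ δ (fun _ => 1) x) v : ℝ)]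
    · refine integral_congr_ae (Eventually.of_forall fun x => ?_)
      simp only
      rw [rieszRegH_eq κ hδ ρ x, inner_add_left, κ.param.inner_map_map, κ.param.inner_map_map]
    · intro x hx
      rw [mem_ball, dist_zero_right, not_lt] at hx
      rw [κ.extend_eq_zero hD hg0 (by linarith), inner_zero_right]
  have hgint : Integrable (fun x => g (κ.proj x)) (μ.restrict (ball 0 ρ)) :=
    Integrable.of_bound hgc.aestronglyMeasurable M (Eventually.of_forall fun x => hg.bdd _)
  have iW : Integrable (fun x => (inner ℝ (κ.proj (W x)) (g (κ.proj x)) : ℝ))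
      (μ.restrict (ball 0 ρ)) := by
    refine Integrable.of_bound ((κ.proj.continuous.comp hWc).inner hgc).aestronglyMeasurable
      ((δ ^ d)⁻¹ * (μ.restrict (ball 0 ρ)).real Set.univ * M) (Eventually.of_forall fun x => ?_)
    refine (norm_inner_le_norm _ _).trans ?_
    exact mul_le_mul ((κ.norm_proj_le _).trans (hbdW _ x)) (hg.bdd _) (norm_nonneg _)
      (by positivity)
  have iV : ∀ z, Integrable (fun x => (inner ℝ (κ.proj (V x) - κ.proj z) (g (κ.proj x)) : ℝ))
      (μ.restrict (ball 0 ρ)) := fun z => by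
    refine Integrable.of_bound (((κ.proj.continuous.comp hVc).sub
      continuous_const).inner hgc).aestronglyMeasurable
      (((δ ^ d)⁻¹ * (μ.restrict (ball 0 ρ)ᶜ).real Set.univ + ‖κ.proj z‖) * M)
      (Eventually.of_forall fun x => ?_)
    refine (norm_inner_le_norm _ _).trans ?_
    refine mul_le_mul ((norm_sub_le _ _).trans ?_) (hg.bdd _) (norm_nonneg _) (by positivity)
    gcongr
    exact (κ.norm_proj_le _).trans (hbdW _ x)
  have ir : Integrable (fun x => (inner ℝ (rpot σ δ (κ.proj x)) (g (κ.proj x)) : ℝ))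
      (μ.restrict (ball 0 ρ)) := by
    have hb : BddLip (rpot σ δ) _ _ := bddLip_rpot hδ le_rfl
    refine Integrable.of_bound ((hvc.comp κ.proj.continuous).inner hgc).aestronglyMeasurable
      ((δ ^ d)⁻¹ * σ.real Set.univ * M) (Eventually.of_forall fun x => ?_)
    refine (norm_inner_le_norm _ _).trans ?_
    exact mul_le_mul (hb.bdd _) (hg.bdd _) (norm_nonneg _) (by positivity)
  have hgz : ∫ x in ball 0 ρ, g (κ.proj x) ∂μ = 0 := by
    rw [← κ.integral_shadow ρ hg.continuous]; exact hgi
  -- The mean zero condition on `g` permits subtracting the value of the far field at the origin.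
  have e3 : ∫ x in ball 0 ρ, (inner ℝ (κ.proj (V x)) (g (κ.proj x)) : ℝ) ∂μ =
      ∫ x in ball 0 ρ, (inner ℝ (κ.proj (V x) - κ.proj (V 0)) (g (κ.proj x)) : ℝ) ∂μ := by
    have h0 : ∫ x in ball 0 ρ, (inner ℝ (κ.proj (V 0)) (g (κ.proj x)) : ℝ) ∂μ = 0 := by
      rw [integral_inner hgint, hgz, inner_zero_right]
    have hi0 : Integrable (fun x => (inner ℝ (κ.proj (V 0)) (g (κ.proj x)) : ℝ))
      (μ.restrict (ball 0 ρ)) := hgint.const_inner _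
    simp only [inner_sub_left]
    rw [integral_sub (by simpa using iV 0) hi0, h0, sub_zero]
  have hb := F.measureReal_ball_le hC hρ0 0
  have near : |∫ x in ball 0 ρ, ((inner ℝ (rpot σ δ (κ.proj x)) (g (κ.proj x)) : ℝ) -
      inner ℝ (κ.proj (W x)) (g (κ.proj x))) ∂μ| ≤
      (d + 2) * (δ ^ (d + 1))⁻¹ * (2 * a) * (C * ρ ^ d) * M * (C * ρ ^ d) := by
    rw [← Real.norm_eq_abs]
    refine (norm_integral_le_of_norm_le_const
      (C := (d + 2) * (δ ^ (d + 1))⁻¹ * (2 * a) * (C * ρ ^ d) * M) ?_).trans ?_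
    · filter_upwards [F.ae_near κ hρR] with x hx
      rw [← inner_sub_left]
      refine (norm_inner_le_norm _ _).trans ?_
      exact mul_le_mul (F.norm_rpot_shadow_sub_le κ hC ha hδ hρ0 hρR hx.2) (hg.bdd _)
        (norm_nonneg _) (by positivity)
    · rw [measureReal_restrict_apply_univ]
      gcongr
  have far : |∫ x in ball 0 ρ, (inner ℝ (κ.proj (V x) - κ.proj (V 0)) (g (κ.proj x)) : ℝ) ∂μ| ≤
      (d + 2) * 4 ^ (d + 1) * C * (4 * D / ρ) * ∫ u, ‖g u‖ ∂σ := by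
    rw [hσ, κ.integral_shadow ρ hg.continuous.norm, ← integral_const_mul, ← Real.norm_eq_abs]
    refine norm_integral_le_of_norm_le (hgint.norm.const_mul _) ?_
    filter_upwards [F.ae_near κ hρR] with x hx
    refine (norm_inner_le_norm _ _).trans ?_
    rcases le_total (2 * D) ‖κ.proj x‖ with h | h
    · rw [hg0 _ h, norm_zero, mul_zero, mul_zero]
    · have h1 := norm_le_norm_add_norm_sub' x (κ.param (κ.proj x))
      rw [κ.param.norm_map] at h1
      have h2 : ‖x‖ ≤ 4 * D := by linarith [hx.2]
      rw [← map_sub]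
      gcongr
      refine (κ.norm_proj_le _).trans ((norm_integral_rk_far_sub_le hC F.nice hρ0 hδ
        (by linarith)).trans ?_)
      gcongr
  have e4 : (∫ u, (inner ℝ (rpot σ δ u) (g u) : ℝ) ∂σ) -
      ∫ x, (inner ℝ (rieszRegH H μ δ (fun _ => 1) x) (κ.extend g x) : ℝ) ∂μ =
      (∫ x in ball 0 ρ, ((inner ℝ (rpot σ δ (κ.proj x)) (g (κ.proj x)) : ℝ) -
        inner ℝ (κ.proj (W x)) (g (κ.proj x))) ∂μ) -
      ∫ x in ball 0 ρ, (inner ℝ (κ.proj (V x) - κ.proj (V 0)) (g (κ.proj x)) : ℝ) ∂μ := by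
    rw [e1, e2, integral_add iW (by simpa using iV 0), e3, integral_sub ir iW]
    ring
  rw [e4]
  exact (abs_sub _ _).trans (add_le_add near far)

theorem shadow_pairing (hd : 1 ≤ d) (F : FlatData H μ C c R a) (hC : 0 < C) (ha : 0 < a)
    (ha1 : a ≤ 1) {D ρ δ : ℝ} (hD : 1 ≤ D) (hDρ : 8 * D ≤ ρ) (hρR : ρ ≤ R) (haδ : a ≤ δ)
    (hsmall : (d + 2) * (δ ^ (d + 1))⁻¹ * (2 * a) * (C * ρ ^ d) * (C * ρ ^ d) ≤ δ)
    {g : Pl d → Pl d} {M L : ℝ} (hM : 0 < M) (hL : 0 ≤ L) (hg : BddLip g M L)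
    (hg0 : ∀ u, 2 * D ≤ ‖u‖ → g u = 0) (hgi : ∫ u, g u ∂(κ.shadow μ ρ) = 0) :
    |∫ u, (inner ℝ (rpot (κ.shadow μ ρ) δ u) (g u) : ℝ) ∂(κ.shadow μ ρ)| ≤
      (C ^ 2 * 8 ^ d + 3 + (d + 2) * 4 ^ (d + 2) * C) *
        (δ * D ^ d * (L + M) + D / ρ * ∫ u, ‖g u‖ ∂(κ.shadow μ ρ)) := by
  obtain ⟨e, rfl⟩ : ∃ e, d = e + 1 := ⟨d - 1, by omega⟩
  have hρ0 : 0 < ρ := by linarith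
  have hD0 : 0 < D := by linarith
  have hδ : 0 < δ := ha.trans_le haδ
  have hLM : 0 < L + M := by linarith
  have hGL := κ.bddLip_extend hL hg
  set G := κ.extend g with hG
  have hG0 : ∀ x, 4 * D ≤ ‖x‖ → G x = 0 := fun x hx => κ.extend_eq_zero hD hg0 hx
  have hGi : ∫ x, G x ∂μ = 0 := by
    rw [hG, F.integral_extend κ ha1 hD hDρ hρR hg hg0, hgi, map_zero]
  -- The extended field has Lipschitz constant `L + M` and is normalized to meet the hypothesis. The
  -- truncation `δ'` obtained is then traded for `δ`.
  obtain ⟨δ', hδ', hle, hp⟩ := F.pairing (fun x => (L + M)⁻¹ • G x) (by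
      refine LipschitzWith.of_dist_le_mul fun x y => ?_
      rw [dist_eq_norm, dist_eq_norm, ← smul_sub, norm_smul, Real.norm_of_nonneg (by positivity),
        NNReal.coe_one, one_mul]
      calc _ ≤ (L + M)⁻¹ * ((L + M) * ‖x - y‖) := by gcongr; exact hGL.lip x y
        _ = _ := inv_mul_cancel_left₀ hLM.ne' _) (by
      refine (closure_minimal (t := closedBall 0 (4 * D)) (fun x hx => ?_)
        isClosed_closedBall).trans (closedBall_subset_ball (by linarith))
      rw [mem_closedBall, dist_zero_right]
      by_contra! h
      exact hx (by simp only [hG0 x h.le, smul_zero])) (by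
      rw [integral_smul, hGi, smul_zero]) δ hδ
  simp only [real_inner_smul_right] at hp
  rw [integral_const_mul, abs_mul, abs_of_pos (by positivity : 0 < (L + M)⁻¹),
    inv_mul_le_iff₀ hLM] at hp
  have h1 := abs_integral_inner_rieszRegH_sub_le (H := H) hC F.nice hGL hLM.le (r := 4 * D) (by positivity)
    hG0 hδ' hle
  have h2 := F.abs_integral_inner_shadow_sub_le κ hC ha.le ha1 hD hDρ hρR hδ hL hg hg0 hgi
  rw [← hG] at h2
  have hDd : 1 ≤ D ^ (e + 1) := one_le_pow₀ hD
  have hI : 0 ≤ ∫ u, ‖g u‖ ∂(κ.shadow μ ρ) := integral_nonneg fun _ => norm_nonneg _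
  set I := ∫ u, ‖g u‖ ∂(κ.shadow μ ρ)
  have hδD : δ ≤ δ * D ^ (e + 1) := le_mul_of_one_le_right hδ.le hDd
  have b1 : (L + M) * (2 * a) ≤ 2 * (δ * D ^ (e + 1) * (L + M)) := by nlinarith
  have b2 : (L + M) * (C * (4 * D) ^ (e + 1)) * (C * 2 ^ (e + 1) * δ) =
      C ^ 2 * 8 ^ (e + 1) * (δ * D ^ (e + 1) * (L + M)) := by
    rw [show (8 : ℝ) = 4 * 2 by norm_num, mul_pow, mul_pow]; ring
  have b3 : ((e + 1 : ℕ) + 2) * (δ ^ (e + 1 + 1))⁻¹ * (2 * a) * (C * ρ ^ (e + 1)) * M *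
      (C * ρ ^ (e + 1)) ≤ δ * D ^ (e + 1) * (L + M) := by
    calc _ = ((e + 1 : ℕ) + 2) * (δ ^ (e + 1 + 1))⁻¹ * (2 * a) * (C * ρ ^ (e + 1)) *
          (C * ρ ^ (e + 1)) * M := by ring
      _ ≤ δ * D ^ (e + 1) * (L + M) := by
        refine mul_le_mul (hsmall.trans hδD) (by linarith) hM.le (by positivity)
  have b4 : ((e + 1 : ℕ) + 2) * 4 ^ (e + 1 + 1) * C * (4 * D / ρ) * I =
      ((e + 1 : ℕ) + 2) * 4 ^ (e + 1 + 2) * C * (D / ρ * I) := by ring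
  have hX : 0 ≤ δ * D ^ (e + 1) * (L + M) := by positivity
  have hY : 0 ≤ D / ρ * I := by positivity
  have hk1 : 0 ≤ C ^ 2 * 8 ^ (e + 1) := by positivity
  have hk2 : (0 : ℝ) ≤ ((e + 1 : ℕ) + 2) * 4 ^ (e + 1 + 2) * C := by positivity
  rw [b4] at h2
  rw [b2] at h1
  have f1 := abs_le.1 h1
  have f2 := abs_le.1 h2
  have f3 := abs_le.1 (hp.trans b1)
  have t1 := mul_nonneg hk1 hY
  have t2 := mul_nonneg hk2 hX
  rw [add_mul, add_mul, mul_add, mul_add, mul_add, abs_le]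
  constructor <;> linarith [f1.1, f1.2, f2.1, f2.2, f3.1, f3.2]

/-- The shadow of a sufficiently flat measure satisfies the planar hypotheses. -/
theorem planarData (hd : 1 ≤ d) (F : FlatData H μ C c R a) (hC : 0 < C) (ha : 0 < a)
    {D ρ β : ℝ} (hD : 1 ≤ D) (hDρ : 8 * D ≤ ρ) (hρR : ρ ≤ R) (hβ : 0 < β) (hβ1 : β ≤ 1)
    (haβ : a ≤ β / 2) (h1 : (d + 2) * (β ^ (d + 1))⁻¹ * (2 * a) * (C * ρ ^ d) ≤ 1)
    (h2 : (d + 2) * (β ^ (d + 1))⁻¹ * (2 * a) * (C * ρ ^ d) * (C * ρ ^ d) ≤ β) :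
    PlanarData (κ.shadow μ ρ) (C * 2 ^ d) (c / 2 ^ d)
      (C ^ 2 * 8 ^ d + 3 + (d + 2) * 4 ^ (d + 2) * C) (2 * C ^ 3 + 2 * C) D ρ β := by
  have hρ0 : 0 < ρ := by linarith
  have hmono : ∀ δ, β ≤ δ → (δ ^ (d + 1))⁻¹ ≤ (β ^ (d + 1))⁻¹ := fun δ h => by gcongr
  refine ⟨fun s hs u => F.shadow_upper κ hρR (by linarith) (by linarith) u,
    fun s hs hs1 u hu => F.shadow_lower κ hρR (by linarith) (by linarith) (by linarith),
    F.shadow_mass κ hC hρ0, fun δ hδ _ => F.shadow_sq_bound κ hC ha.le (hβ.trans_le hδ) hρ0 hρR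
      (le_trans ?_ h1), fun δ hδ hδ1 g M L hM hL hg hg0 hgi => ?_⟩
  · have := hmono δ hδ
    gcongr
  · refine F.shadow_pairing κ hd hC ha (by linarith) hD hDρ hρR (by linarith) ?_ hM hL hg hg0 hgi
    refine le_trans ?_ (h2.trans hδ)
    have := hmono δ hδ
    gcongr

end FlatData

/-! ### Testing against Lipschitz functions at unit scale -/

theorem exists_norm_mul_heat_le (d : ℕ) : ∃ K : ℝ, 0 < K ∧ ∀ (τ : ℝ), 0 < τ → ∀ x : Pl d,
    ‖x‖ * heat τ x ≤ K * √τ * heat (2 * τ) x := by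
  obtain ⟨K, hK, h⟩ := exists_pow_mul_exp_neg_le 1 (show (0 : ℝ) < 1 / 2 by norm_num)
  refine ⟨K * √2 ^ d, by positivity, fun τ hτ x => ?_⟩
  have hpi := Real.pi_pos
  have hs : 0 < √τ := by positivity
  have h1 := h (‖x‖ / √τ) (by positivity)
  rw [pow_one] at h1
  have e1 : K * √2 ^ d * √τ * heat (2 * τ) x = K * √τ * (√2 ^ d * heat (2 * τ) x) := by ring
  have e2 : Real.exp (-(‖x‖ / √τ) ^ 2) = Real.exp (-(1 / 2 * (‖x‖ / √τ) ^ 2)) *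
      Real.exp (-((‖x‖ / √τ) ^ 2 / 2)) := by rw [← Real.exp_add]; congr 1; ring
  have e3 : ‖x‖ = √τ * (‖x‖ / √τ) := by field_simp
  rw [e1, ← exp_half_eq_heat hτ, heat_eq_profile hτ, e2]
  calc _ = √τ * (√(Real.pi * τ) ^ d)⁻¹ * (‖x‖ / √τ * Real.exp (-(1 / 2 * (‖x‖ / √τ) ^ 2))) *
        Real.exp (-((‖x‖ / √τ) ^ 2 / 2)) := by nth_rewrite 1 [e3]; ring
    _ ≤ √τ * (√(Real.pi * τ) ^ d)⁻¹ * K * Real.exp (-((‖x‖ / √τ) ^ 2 / 2)) := by gcongr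
    _ = _ := by ring

theorem integral_abs_le_of_support {d : ℕ} {A M : ℝ} (hA : 0 < A) {f : Pl d → ℝ}
    (hf : Continuous f) (hM : ∀ x, |f x| ≤ M) (hf0 : ∀ x, A ≤ ‖x‖ → f x = 0) :
    Integrable f ∧ ∫ x, |f x| ≤ M * (A ^ d * unitVol d) := by
  have hv := unitVol_pos d
  have hi : IntegrableOn f (ball 0 A) := Measure.integrableOn_of_bounded (M := M)
    measure_ball_lt_top.ne hf.aestronglyMeasurable (Eventually.of_forall hM)
  have hsupp : ∀ x ∉ ball (0 : Pl d) A, f x = 0 := fun x hx => hf0 x (by simpa using hx)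
  refine ⟨(integrableOn_iff_integrable_of_support_subset fun x hx => by
    by_contra h; exact hx (hsupp x h)).1 hi, ?_⟩
  rw [← setIntegral_eq_integral_of_forall_compl_eq_zero (s := ball 0 A)
    fun x hx => by rw [hsupp x hx, abs_zero]]
  calc _ ≤ ∫ x in ball (0 : Pl d) A, M := by
        refine integral_mono_of_nonneg (Eventually.of_forall fun x => abs_nonneg _) ?_
          (Eventually.of_forall hM)
        exact integrableOn_const measure_ball_lt_top.ne
    _ = _ := by
        rw [setIntegral_const, smul_eq_mul, mul_comm, measureReal_def,
          volume_ball_eq_ofReal hA, ENNReal.toReal_ofReal (by positivity)]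

/-- A local form of the mollification error, that does not involve the total mass. -/
theorem exists_abs_integral_heatConv_mul_sub_le (d : ℕ) {A : ℝ} (hA : 0 < A) :
    ∃ K : ℝ, 0 < K ∧ ∀ (σ : Measure (Pl d)) [IsFiniteMeasure σ] (C₁ t : ℝ), 0 < t → 0 ≤ C₁ →
      (∀ w, σ (ball w √(2 * t)) ≤ ENNReal.ofReal (C₁ * √(2 * t) ^ d)) →
      σ (ball 0 (2 * A)) ≤ ENNReal.ofReal (C₁ * (2 * A) ^ d) →
      ∀ f : Pl d → ℝ, BddLip f (2 * A) 1 → (∀ x, A ≤ ‖x‖ → f x = 0) →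
      |(∫ x, heatConv σ t x * f x) - ∫ y, f y ∂σ| ≤ K * C₁ * √t := by
  obtain ⟨K₁, hK₁, h₁⟩ := exists_norm_mul_heat_le d
  have hB := heatBd_pos d
  have hv := unitVol_pos d
  -- The first summand is the mollification error of the part of `σ` in the ball of radius `2A`. The
  -- second is the leakage from outside: at distance at least `A` the kernel at time `t` is at most
  -- `K₁ √t / A` times the kernel at time `2t`.
  refine ⟨(1 + d) * (2 * A) ^ d + K₁ / A * heatBd d * (2 * A * (A ^ d * unitVol d)),
    by positivity, fun σ _ C₁ t ht hC₁ hσ hσA f hf hf0 => ?_⟩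
  have h2t : 0 < 2 * t := by positivity
  obtain ⟨hfi, hfI⟩ := integral_abs_le_of_support hA hf.continuous hf.bdd hf0
  have hmass : (σ.restrict (ball 0 (2 * A))).real Set.univ ≤ C₁ * (2 * A) ^ d := by
    rw [measureReal_restrict_apply_univ, measureReal_def]
    exact ENNReal.toReal_le_of_le_ofReal (by positivity) hσA
  have hsplit : ∀ x, heatConv σ t x = heatConv (σ.restrict (ball 0 (2 * A))) t x +
      heatConv (σ.restrict (ball 0 (2 * A))ᶜ) t x := fun x =>
    (integral_add_compl measurableSet_ball (integrable_heat_sub ht x)).symm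
  have hmoll := norm_integral_heatConv_smul_sub_le (σ := σ.restrict (ball 0 (2 * A))) ht
    zero_le_one hf.continuous hf.bdd hf.lip (hf.integrable _)
  simp only [smul_eq_mul] at hmoll
  rw [setIntegral_eq_integral_of_forall_compl_eq_zero (s := ball 0 (2 * A)) (fun x hx => hf0 x (by
    rw [mem_ball, dist_zero_right, not_lt] at hx; linarith))] at hmoll
  have hfar : ∀ x, ‖x‖ < A → heatConv (σ.restrict (ball 0 (2 * A))ᶜ) t x ≤
      K₁ / A * √t * (C₁ * heatBd d) := by
    intro x hx
    have h3 := heatConv_le h2t hC₁ hσ x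
    calc _ ≤ ∫ y in (ball 0 (2 * A))ᶜ, K₁ / A * √t * heat (2 * t) (x - y) ∂σ := by
          refine integral_mono_of_nonneg (Eventually.of_forall fun y => (heat_pos ht _).le)
            ((integrable_heat_sub h2t x).const_mul _).integrableOn ?_
          refine (ae_restrict_iff' measurableSet_ball.compl).2 (Eventually.of_forall fun y hy => ?_)
          rw [Set.mem_compl_iff, mem_ball, dist_zero_right, not_lt] at hy
          have h4 : A ≤ ‖x - y‖ := by
            have := norm_sub_norm_le y x
            rw [norm_sub_rev] at this
            linarith
          have h5 := h₁ t ht (x - y)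
          have h6 := (heat_pos ht (x - y)).le
          have h7 : A * heat t (x - y) ≤ K₁ * √t * heat (2 * t) (x - y) := by
            refine le_trans ?_ h5
            gcongr
          calc _ ≤ K₁ * √t * heat (2 * t) (x - y) / A := by rw [le_div_iff₀ hA]; linarith
            _ = _ := by ring
      _ ≤ ∫ y, K₁ / A * √t * heat (2 * t) (x - y) ∂σ :=
          setIntegral_le_integral ((integrable_heat_sub h2t x).const_mul _)
            (Eventually.of_forall fun y => by
              have := heat_pos h2t (x - y)
              simp only [Pi.zero_apply]; positivity)
      _ = K₁ / A * √t * heatConv σ (2 * t) x := integral_const_mul _ _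
      _ ≤ _ := by gcongr
  have hprod : ∀ ν : Measure (Pl d), ∀ [IsFiniteMeasure ν],
      Integrable fun x => heatConv ν t x * f x := fun ν _ =>
    ((integrable_heatConv (σ := ν) ht).mul_const (2 * A)).mono'
      ((continuous_heatConv ht).mul hf.continuous).aestronglyMeasurable
      (Eventually.of_forall fun x => by
        have := heatConv_nonneg (σ := ν) ht x
        rw [norm_mul, Real.norm_of_nonneg this]
        have := hf.bdd x
        gcongr)
  have hrest : |∫ x, heatConv (σ.restrict (ball 0 (2 * A))ᶜ) t x * f x| ≤
      K₁ / A * √t * (C₁ * heatBd d) * (2 * A * (A ^ d * unitVol d)) := by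
    rw [← Real.norm_eq_abs]
    calc _ ≤ ∫ x, K₁ / A * √t * (C₁ * heatBd d) * |f x| := by
          refine norm_integral_le_of_norm_le (hfi.abs.const_mul _) (Eventually.of_forall fun x => ?_)
          have h0 := heatConv_nonneg (σ := σ.restrict (ball 0 (2 * A))ᶜ) ht x
          rw [norm_mul, Real.norm_of_nonneg h0, Real.norm_eq_abs]
          rcases lt_or_ge ‖x‖ A with hx | hx
          · have := hfar x hx
            gcongr
          · rw [hf0 x hx, abs_zero, mul_zero, mul_zero]
      _ = K₁ / A * √t * (C₁ * heatBd d) * ∫ x, |f x| := integral_const_mul _ _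
      _ ≤ _ := by gcongr
  simp only [hsplit, add_mul]
  rw [integral_add (hprod _) (hprod _)]
  rw [Real.norm_eq_abs] at hmoll
  have hm2 : 1 * ((1 + d) * √t) * (σ.restrict (ball 0 (2 * A))).real Set.univ ≤
      1 * ((1 + d) * √t) * (C₁ * (2 * A) ^ d) := by gcongr
  have f1 := abs_le.1 (hmoll.trans hm2)
  have f2 := abs_le.1 hrest
  rw [abs_le]
  constructor <;> linarith [f1.1, f1.2, f2.1, f2.2]

theorem integral_planeMeasure {d : ℕ} {H : Submodule ℝ (Sp d)} {κ : PlaneCoords H}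
    {e : H ≃ₗᵢ[ℝ] Pl d} (he : ∀ h : H, κ.param (e h) = h) {f : Sp d → ℝ} (hf : Continuous f) :
    ∫ x, f x ∂(planeMeasure H 0) = ∫ u, f (κ.param u) := by
  rw [planeMeasure, integral_map (by fun_prop) hf.aestronglyMeasurable,
    ← e.measurePreserving.integral_comp e.toHomeomorph.measurableEmbedding]
  simp only [zero_add, he]

/-- The flattening lemma at the origin and at unit scale. -/
theorem exists_abs_integral_le_of_flatData {d : ℕ} (hd : 1 ≤ d) {A α c C : ℝ} (hA : 0 < A)
    (hα : 0 < α) (hc : 0 < c) (hC : 0 < C) :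
    ∃ R a, A ≤ R ∧ 0 < a ∧ a ≤ α ∧ ∀ H : Submodule ℝ (Sp d), Module.finrank ℝ H = d →
      ∀ (μ : Measure (Sp d)) [IsFiniteMeasure μ], FlatData H μ C c R a →
      ∀ f : Sp d → ℝ, LipschitzWith 1 f → (∀ x, A ≤ ‖x‖ → f x = 0) →
      ∫ x, f x ∂(planeMeasure H 0) = 0 → |∫ x, f x ∂μ| ≤ α := by
  have hv := unitVol_pos d
  obtain ⟨K, hK, hmoll⟩ := exists_abs_integral_heatConv_mul_sub_le d hA
  -- This makes the mollification error exactly `α / 3`. The other two thirds go to the oscillation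
  -- of the mollified density and to the projection of `μ` onto the plane.
  set t := (α / 3 / (K * (C * 2 ^ d))) ^ 2 with ht
  have ht0 : 0 < t := by positivity
  have hKt : K * (C * 2 ^ d) * √t = α / 3 := by
    rw [ht, Real.sqrt_sq (by positivity)]; field_simp
  set V := 2 * A * (A ^ d * unitVol d) with hV
  have hV0 : 0 < V := by positivity
  obtain ⟨D, ρ, β, hD1, hDA, hDρ, hβ, hβb, hcore⟩ := exists_abs_heatConv_sub_le hd hA.le ht0
    (ε := α / 3 / V) (by positivity) (c₁ := c / 2 ^ d) (C₁ := C * 2 ^ d)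
    (C₂ := C ^ 2 * 8 ^ d + 3 + (d + 2) * 4 ^ (d + 2) * C) (M := 2 * C ^ 3 + 2 * C) (by positivity)
    (by positivity) (by positivity) (by positivity) A (min 1 (min √(2 * t) (2 * A)))
    (by positivity)
  have hρ0 : 0 < ρ := by linarith
  set X := (d + 2) * (β ^ (d + 1))⁻¹ * 2 * (C * ρ ^ d) with hX
  have hX0 : 0 < X := by positivity
  -- The flatness is chosen last. In order, the entries serve the final geometric flatness, the
  -- regularity of the shadow from scale `β` on, its `L²` bound, its pairing bound, and the cost of
  -- moving the mass in the ball of radius `ρ` to the plane.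
  set a := min (min α (β / 2)) (min (1 / X) (min (β / (X * (C * ρ ^ d))) (α / 3 / (C * ρ ^ d))))
    with ha
  have ha0 : 0 < a := by positivity
  have haα : a ≤ α := (min_le_left _ _).trans (min_le_left _ _)
  have haβ : a ≤ β / 2 := (min_le_left _ _).trans (min_le_right _ _)
  have ha1 : a * X ≤ 1 := by
    rw [← le_div_iff₀ hX0]; exact (min_le_right _ _).trans (min_le_left _ _)
  have ha2 : a * (X * (C * ρ ^ d)) ≤ β := by
    rw [← le_div_iff₀ (by positivity)]
    exact (min_le_right _ _).trans ((min_le_right _ _).trans (min_le_left _ _))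
  have ha3 : a * (C * ρ ^ d) ≤ α / 3 := by
    rw [← le_div_iff₀ (by positivity)]
    exact (min_le_right _ _).trans ((min_le_right _ _).trans (min_le_right _ _))
  have hβ1 : β ≤ 1 := hβb.trans (min_le_left _ _)
  refine ⟨ρ, a, by linarith, ha0, haα, fun H hH μ _ F f hf hf0 hfm => ?_⟩
  obtain ⟨κ, e, he⟩ := exists_planeCoords H hH
  have S := F.planarData κ hd hC ha0 hD1 hDρ le_rfl hβ hβ1 haβ (by linarith) (by linarith)
  set σ := κ.shadow μ ρ with hσ
  have hlip : ∀ x y, |f x - f y| ≤ ‖x - y‖ := fun x y => by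
    have := hf.dist_le_mul x y
    rwa [NNReal.coe_one, one_mul, dist_eq_norm, dist_eq_norm] at this
  have hbd : ∀ x, |f x| ≤ 2 * A := by
    intro x
    rcases lt_or_ge ‖x‖ A with hx | hx
    · obtain ⟨y, hy⟩ := exists_norm_eq (Sp d) hA.le
      have h1 := hlip x y
      rw [hf0 y hy.ge, sub_zero] at h1
      have := norm_sub_le x y
      linarith
    · rw [hf0 x hx, abs_zero]; positivity
  set f₀ : Pl d → ℝ := fun u => f (κ.param u) with hf₀
  have hf₀B : BddLip f₀ (2 * A) 1 := ⟨fun u => hbd _, fun u v => by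
    rw [one_mul, ← κ.param.norm_map, map_sub]; exact hlip _ _⟩
  have hf₀0 : ∀ u, A ≤ ‖u‖ → f₀ u = 0 := fun u hu => hf0 _ (by rwa [κ.param.norm_map])
  have hf₀m : ∫ u, f₀ u = 0 := by rw [← integral_planeMeasure he hf.continuous]; exact hfm
  obtain ⟨hfi, hfI⟩ := integral_abs_le_of_support hA hf₀B.continuous hf₀B.bdd hf₀0
  have b1 : |(∫ x, f x ∂μ) - ∫ u, f₀ u ∂σ| ≤ α / 3 := by
    have hi2 : Integrable (fun x => f₀ (κ.proj x)) (μ.restrict (ball 0 ρ)) :=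
      Integrable.of_bound (hf₀B.continuous.comp κ.proj.continuous).aestronglyMeasurable (2 * A)
        (Eventually.of_forall fun x => hf₀B.bdd _)
    rw [← setIntegral_eq_integral_of_forall_compl_eq_zero (s := ball 0 ρ) (fun x hx => hf0 x (by
      rw [mem_ball, dist_zero_right, not_lt] at hx; linarith)),
      κ.integral_shadow ρ hf₀B.continuous, ← integral_sub
      (Integrable.of_bound hf.continuous.aestronglyMeasurable (2 * A) (Eventually.of_forall hbd)) hi2, ← Real.norm_eq_abs]
    refine (norm_integral_le_of_norm_le_const (C := a) ?_).trans (le_trans ?_ ha3)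
    · filter_upwards [F.ae_near κ le_rfl] with x hx
      exact (hlip _ _).trans hx.2
    · rw [measureReal_restrict_apply_univ]
      have := F.measureReal_ball_le hC hρ0 0
      gcongr
  have b2 := hmoll σ (C * 2 ^ d) t ht0 (by positivity)
    (S.upper _ (hβb.trans ((min_le_right _ _).trans (min_le_left _ _))))
    (S.upper _ (hβb.trans ((min_le_right _ _).trans (min_le_right _ _))) 0) f₀ hf₀B hf₀0
  rw [hKt] at b2
  have b3 : |∫ u, heatConv σ t u * f₀ u| ≤ α / 3 := by
    have hi1 : Integrable fun u => heatConv σ t u * f₀ u :=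
      ((integrable_heatConv (σ := σ) ht0).mul_const (2 * A)).mono'
        ((continuous_heatConv ht0).mul hf₀B.continuous).aestronglyMeasurable
        (Eventually.of_forall fun x => by
          have := heatConv_nonneg (σ := σ) ht0 x
          rw [norm_mul, Real.norm_of_nonneg this]
          have := hf₀B.bdd x
          gcongr)
    -- Since `f₀` has zero Lebesgue integral, only the oscillation of the mollified density is seen.
    have e1 : ∫ u, heatConv σ t u * f₀ u =
        ∫ u, (heatConv σ t u - heatConv σ t 0) * f₀ u := by
      simp only [sub_mul]
      rw [integral_sub hi1 (hfi.const_mul _), integral_const_mul, hf₀m, mul_zero, sub_zero]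
    rw [e1, ← Real.norm_eq_abs]
    calc _ ≤ ∫ u, α / 3 / V * |f₀ u| := by
          refine norm_integral_le_of_norm_le (hfi.abs.const_mul _) (Eventually.of_forall fun u => ?_)
          rw [norm_mul, Real.norm_eq_abs, Real.norm_eq_abs]
          rcases lt_or_ge ‖u‖ A with hu | hu
          · have := hcore σ S u hu.le
            gcongr
          · rw [hf₀0 u hu, abs_zero, mul_zero, mul_zero]
      _ = α / 3 / V * ∫ u, |f₀ u| := integral_const_mul _ _
      _ ≤ α / 3 / V * V := by gcongr
      _ = α / 3 := by field_simp
  have f1 := abs_le.1 b1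
  have f2 := abs_le.1 b2
  have f3 := abs_le.1 b3
  rw [abs_le]
  constructor <;> linarith [f1.1, f1.2, f2.1, f2.2, f3.1, f3.2]

/-! ### Localized square function bound for good measures -/

section Good

variable {d : ℕ} {μ : Measure (Sp d)} [IsFiniteMeasure μ] {C : ℝ}

/-- The operator bound is tested on the indicator of the ball; the rest converts extended norms into
integrals. -/
theorem IsGood.setIntegral_sq_le (hC : 0 < C) (hμ : IsGood C μ) {δ : ℝ} (hδ : 0 < δ) (z : Sp d)
    (r : ℝ) : ∫ x in ball z r, ‖∫ y in ball z r, rk d δ (x - y) ∂μ‖ ^ 2 ∂μ ≤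
      C ^ 2 * μ.real (ball z r) := by
  set f : Sp d → ℝ := (ball z r).indicator fun _ => 1 with hf
  have hfm : MemLp f 2 μ :=
    memLp_indicator_const 2 measurableSet_ball 1 (Or.inr (measure_ne_top _ _))
  have e : ∀ x, rieszReg μ δ f x = ∫ y in ball z r, rk d δ (x - y) ∂μ := fun x => by
    rw [rieszReg, ← integral_indicator measurableSet_ball]
    refine integral_congr_ae (Eventually.of_forall fun y => ?_)
    by_cases hy : y ∈ ball z r
    · simp only [hf, Set.indicator_of_mem hy, one_smul]; rfl
    · simp only [hf, Set.indicator_of_notMem hy, zero_smul]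
  have hc : Continuous (rieszReg μ δ f) := by
    rw [funext e]; exact FlatData.continuous_integral_rk_sub hδ _
  have hvm : MemLp (rieszReg μ δ f) 2 μ := by
    refine MemLp.of_bound hc.aestronglyMeasurable
      ((δ ^ d)⁻¹ * (μ.restrict (ball z r)).real Set.univ) (Eventually.of_forall fun x => ?_)
    rw [e]
    exact norm_integral_le_of_norm_le_const (Eventually.of_forall fun _ => norm_rk_le hδ _)
  have key := hμ.2 δ hδ f hfm
  rw [hvm.eLpNorm_eq_integral_rpow_norm two_ne_zero ENNReal.ofNat_ne_top,
    hfm.eLpNorm_eq_integral_rpow_norm two_ne_zero ENNReal.ofNat_ne_top,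
    ← ENNReal.ofReal_mul hC.le, ENNReal.ofReal_le_ofReal_iff (by positivity)] at key
  simp only [ENNReal.toReal_ofNat, Real.rpow_ofNat] at key
  rw [← one_div, ← Real.sqrt_eq_rpow, ← Real.sqrt_eq_rpow] at key
  have hf2 : ∫ x, ‖f x‖ ^ 2 ∂μ = μ.real (ball z r) := by
    rw [← integral_indicator_one measurableSet_ball]
    refine integral_congr_ae (Eventually.of_forall fun y => ?_)
    by_cases hy : y ∈ ball z r
    · simp [hf, Set.indicator_of_mem hy]
    · simp [hf, Set.indicator_of_notMem hy]
  have hsq := pow_le_pow_left₀ (Real.sqrt_nonneg _) key 2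
  rw [Real.sq_sqrt (integral_nonneg fun _ => sq_nonneg _), mul_pow,
    Real.sq_sqrt (integral_nonneg fun _ => sq_nonneg _), hf2] at hsq
  simp only [e] at hsq
  refine (setIntegral_le_integral ?_ (Eventually.of_forall fun x => sq_nonneg _)).trans hsq
  have := hvm.integrable_norm_pow two_ne_zero
  simpa only [e] using this

end Good

/-! ### Reduction to the origin and unit scale -/

section Scaling

variable {d : ℕ}

theorem rk_inv_smul {ℓ : ℝ} (hℓ : 0 < ℓ) (δ : ℝ) (x : Sp d) :
    rk d δ (ℓ⁻¹ • x) = ℓ ^ d • rk d (ℓ * δ) x := by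
  have e : max δ ‖ℓ⁻¹ • x‖ = ℓ⁻¹ * max (ℓ * δ) ‖x‖ := by
    rw [mul_max_of_nonneg _ _ (by positivity), inv_mul_cancel_left₀ hℓ.ne', norm_smul,
      Real.norm_of_nonneg (by positivity)]
  rw [rk, rk, e, smul_smul, smul_smul, mul_pow, mul_inv, inv_pow, inv_inv, pow_succ ℓ]
  congr 1
  field_simp

/-- The map `x ↦ ℓ⁻¹ (x - z)`. -/
def rescale (z : Sp d) {ℓ : ℝ} (hℓ : 0 < ℓ) : Sp d ≃ₜ Sp d :=
  (Homeomorph.subRight z).trans (Homeomorph.smulOfNeZero ℓ⁻¹ (inv_ne_zero hℓ.ne'))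

/-- The image of `μ` under the rescaling that keeps `d`-dimensional densities. -/
def rescaleMeasure (z : Sp d) {ℓ : ℝ} (hℓ : 0 < ℓ) (μ : Measure (Sp d)) : Measure (Sp d) :=
  ENNReal.ofReal (ℓ ^ d)⁻¹ • μ.map (rescale z hℓ)

variable (z : Sp d) {ℓ : ℝ} (hℓ : 0 < ℓ) {μ : Measure (Sp d)}

theorem rescale_apply (x : Sp d) : rescale z hℓ x = ℓ⁻¹ • (x - z) := rfl

theorem rescale_sub_rescale (x y : Sp d) : rescale z hℓ x - rescale z hℓ y = ℓ⁻¹ • (x - y) := by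
  rw [rescale_apply, rescale_apply, ← smul_sub, sub_sub_sub_cancel_right]

theorem norm_rescale_sub (x y : Sp d) : ‖rescale z hℓ x - rescale z hℓ y‖ = ℓ⁻¹ * ‖x - y‖ := by
  rw [rescale_sub_rescale, norm_smul, Real.norm_of_nonneg (by positivity)]

theorem norm_rescale (x : Sp d) : ‖rescale z hℓ x‖ = ℓ⁻¹ * ‖x - z‖ := by
  rw [rescale_apply, norm_smul, Real.norm_of_nonneg (by positivity)]

theorem preimage_rescale_ball (x : Sp d) (r : ℝ) :
    rescale z hℓ ⁻¹' ball (rescale z hℓ x) r = ball x (ℓ * r) := by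
  ext y
  rw [Set.mem_preimage, mem_ball, mem_ball, dist_eq_norm, dist_eq_norm, norm_rescale_sub,
    inv_mul_lt_iff₀ hℓ]

theorem preimage_rescale_ball_zero (r : ℝ) : rescale z hℓ ⁻¹' ball 0 r = ball z (ℓ * r) := by
  rw [← preimage_rescale_ball z hℓ z r, rescale_apply, sub_self, smul_zero]

theorem rescaleMeasure_apply (s : Set (Sp d)) :
    rescaleMeasure z hℓ μ s = ENNReal.ofReal (ℓ ^ d)⁻¹ * μ (rescale z hℓ ⁻¹' s) := by
  rw [rescaleMeasure, Measure.smul_apply, (rescale z hℓ).measurableEmbedding.map_apply, smul_eq_mul]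

instance [IsFiniteMeasure μ] : IsFiniteMeasure (rescaleMeasure z hℓ μ) := by
  refine ⟨?_⟩
  rw [rescaleMeasure_apply]
  exact ENNReal.mul_lt_top ENNReal.ofReal_lt_top (measure_lt_top _ _)

theorem mem_support_rescaleMeasure (x : Sp d) :
    rescale z hℓ x ∈ (rescaleMeasure z hℓ μ).support ↔ x ∈ μ.support := by
  rw [nhds_basis_ball.mem_measureSupport, nhds_basis_ball.mem_measureSupport]
  have hk : ENNReal.ofReal (ℓ ^ d)⁻¹ ≠ 0 := (ENNReal.ofReal_pos.2 (by positivity)).ne'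
  simp only [rescaleMeasure_apply, preimage_rescale_ball, pos_iff_ne_zero, mul_ne_zero_iff, hk,
    ne_eq, not_false_eq_true, true_and]
  constructor
  · intro h r hr
    have := h (ℓ⁻¹ * r) (mul_pos (inv_pos.2 hℓ) hr)
    rwa [mul_inv_cancel_left₀ hℓ.ne'] at this
  · intro h r hr
    exact h (ℓ * r) (by positivity)

theorem integral_rescaleMeasure {F : Type*} [NormedAddCommGroup F] [NormedSpace ℝ F]
    (f : Sp d → F) :
    ∫ y, f y ∂(rescaleMeasure z hℓ μ) = (ℓ ^ d)⁻¹ • ∫ x, f (rescale z hℓ x) ∂μ := by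
  rw [rescaleMeasure, integral_smul_measure, (rescale z hℓ).measurableEmbedding.integral_map,
    ENNReal.toReal_ofReal (by positivity)]

theorem setIntegral_rescaleMeasure {F : Type*} [NormedAddCommGroup F] [NormedSpace ℝ F]
    (f : Sp d → F) (r : ℝ) :
    ∫ y in ball 0 r, f y ∂(rescaleMeasure z hℓ μ) =
      (ℓ ^ d)⁻¹ • ∫ x in ball z (ℓ * r), f (rescale z hℓ x) ∂μ := by
  rw [rescaleMeasure, Measure.restrict_smul, integral_smul_measure,
    (rescale z hℓ).measurableEmbedding.setIntegral_map, ENNReal.toReal_ofReal (by positivity),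
    preimage_rescale_ball_zero]

theorem rieszRegH_rescaleMeasure (H : Submodule ℝ (Sp d)) (δ : ℝ) (x : Sp d) :
    rieszRegH H (rescaleMeasure z hℓ μ) δ (fun _ => 1) (rescale z hℓ x) =
      rieszRegH H μ (ℓ * δ) (fun _ => 1) x := by
  have e : ∀ y : Sp d, rieszKernelH H δ (ℓ⁻¹ • y) = ℓ ^ d • rieszKernelH H (ℓ * δ) y := fun y => by
    have h1 : ∀ (δ : ℝ) (y : Sp d), rieszKernelH H δ y = H.starProjection (rk d δ y) :=
      fun δ y => by rw [rk, map_smul]; rfl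
    rw [h1, h1, rk_inv_smul hℓ, map_smul]
  rw [rieszRegH, rieszRegH, integral_rescaleMeasure]
  simp only [rescale_sub_rescale, e, one_smul]
  rw [integral_smul, inv_smul_smul₀ (by positivity)]

/-- Every hypothesis is invariant under the rescaling, because the factor `ℓ^{-d}` of the measure
cancels the homogeneity of the kernel. The limit defining the coupling is weakened to a bound at
arbitrarily small truncations. -/
theorem flatData_rescaleMeasure (hd : 1 ≤ d) [IsFiniteMeasure μ] {H : Submodule ℝ (Sp d)}
    {C c R a : ℝ} (hC : 0 < C) (ha : 0 < a) (hgood : IsGood C μ)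
    (hreg : IsADRegularIn (ball z (R * ℓ)) c μ) (hflat : IsGeomFlat H R a z ℓ μ)
    (hpair : ∀ g : Sp d → Sp d, LipschitzWith (Real.toNNReal ℓ⁻¹) g →
      tsupport g ⊆ ball z (R * ℓ) → ∫ x, g x ∂μ = 0 →
      |rieszPairingH H μ (fun _ => 1) g| ≤ a * ℓ ^ d) :
    FlatData H (rescaleMeasure z hℓ μ) C c R a := by
  have hsurj : Function.Surjective (rescale z hℓ) := (rescale z hℓ).surjective
  refine ⟨?_, ?_, ?_, ?_, ?_, ?_⟩
  · intro y r hr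
    obtain ⟨x, rfl⟩ := hsurj y
    rw [rescaleMeasure_apply, preimage_rescale_ball]
    calc _ ≤ ENNReal.ofReal (ℓ ^ d)⁻¹ * ENNReal.ofReal (C * (ℓ * r) ^ d) := by
          gcongr
          exact hgood.1 x _ (by positivity)
      _ = _ := by
          rw [← ENNReal.ofReal_mul (by positivity)]
          congr 1
          rw [mul_pow]; field_simp
  · intro δ hδ r hr
    rw [setIntegral_rescaleMeasure]
    have e : ∀ x, ∫ y in ball 0 r, rk d δ (rescale z hℓ x - y) ∂(rescaleMeasure z hℓ μ) =
        ∫ y in ball z (ℓ * r), rk d (ℓ * δ) (x - y) ∂μ := fun x => by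
      rw [setIntegral_rescaleMeasure]
      simp only [rescale_sub_rescale, rk_inv_smul hℓ]
      rw [integral_smul, inv_smul_smul₀ (by positivity)]
    simp only [e]
    rw [measureReal_def, rescaleMeasure_apply, preimage_rescale_ball_zero, ENNReal.toReal_mul,
      ENNReal.toReal_ofReal (by positivity), ← measureReal_def, smul_eq_mul, mul_left_comm]
    gcongr
    exact hgood.setIntegral_sq_le hC (by positivity) z _
  · intro y hy r hr hsub
    obtain ⟨x, rfl⟩ := hsurj y
    rw [mem_support_rescaleMeasure] at hy
    have hsub' : ball x (ℓ * r) ⊆ ball z (R * ℓ) := by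
      rw [← preimage_rescale_ball z hℓ, mul_comm R, ← preimage_rescale_ball_zero z hℓ]
      exact Set.preimage_mono hsub
    have h := hreg.2 x ⟨hy, hsub' (mem_ball_self (by positivity))⟩ (ℓ * r) (by positivity) hsub'
    rw [rescaleMeasure_apply, preimage_rescale_ball]
    calc _ = ENNReal.ofReal (ℓ ^ d)⁻¹ * ENNReal.ofReal (c * (ℓ * r) ^ d) := by
          rw [← ENNReal.ofReal_mul (by positivity)]
          congr 1
          rw [mul_pow]; field_simp
      _ ≤ _ := by gcongr
  · intro y hy hyR
    obtain ⟨x, rfl⟩ := hsurj y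
    rw [mem_support_rescaleMeasure] at hy
    rw [norm_rescale, inv_mul_lt_iff₀ hℓ] at hyR
    obtain ⟨w, hw, hxw⟩ := hflat.1 x ⟨hy, by rw [mem_ball, dist_eq_norm]; linarith⟩
    refine ⟨rescale z hℓ w, H.smul_mem _ hw, ?_⟩
    rw [norm_rescale_sub, inv_mul_le_iff₀ hℓ, ← dist_eq_norm]
    linarith
  · intro y hy hyR
    obtain ⟨x, rfl⟩ := hsurj y
    have hx : x ∈ parallelThrough H z := by
      have := H.smul_mem ℓ hy
      rwa [rescale_apply, smul_inv_smul₀ hℓ.ne'] at this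
    rw [norm_rescale, inv_mul_lt_iff₀ hℓ] at hyR
    obtain ⟨w, hw, hxw⟩ := hflat.2 x ⟨hx, by rw [mem_ball, dist_eq_norm]; linarith⟩
    refine ⟨rescale z hℓ w, (mem_support_rescaleMeasure z hℓ w).2 hw, ?_⟩
    rw [norm_rescale_sub, inv_mul_le_iff₀ hℓ, ← dist_eq_norm]
    linarith
  · intro g hg hsupp hgi δ hδ
    have hg0 : ∀ y, R ≤ ‖y‖ → g y = 0 := fun y hy => by
      refine image_eq_zero_of_notMem_tsupport fun h => ?_
      have := hsupp h
      rw [mem_ball, dist_zero_right] at this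
      linarith
    have hlip : ∀ x y, ‖g x - g y‖ ≤ ‖x - y‖ := fun x y => by
      have := hg.dist_le_mul x y
      rwa [NNReal.coe_one, one_mul, dist_eq_norm, dist_eq_norm] at this
    have hbd : ∀ y, ‖g y‖ ≤ 2 * |R| := by
      intro y
      rcases lt_or_ge ‖y‖ |R| with hy | hy
      · obtain ⟨w, hw⟩ := exists_norm_eq (Sp d) (abs_nonneg R)
        have h1 := hlip y w
        rw [hg0 w (by rw [hw]; exact le_abs_self R), sub_zero] at h1
        have := norm_sub_le y w
        linarith
      · rw [hg0 y ((le_abs_self R).trans hy), norm_zero]; positivity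
    have hGL : LipschitzWith (Real.toNNReal ℓ⁻¹) fun x => g (rescale z hℓ x) := by
      refine LipschitzWith.of_dist_le_mul fun x y => ?_
      rw [dist_eq_norm, dist_eq_norm, Real.coe_toNNReal _ (by positivity), ← norm_rescale_sub z hℓ]
      exact hlip _ _
    have hGi : ∫ x, g (rescale z hℓ x) ∂μ = 0 := by
      rw [integral_rescaleMeasure] at hgi
      exact (smul_eq_zero.1 hgi).resolve_left (by positivity)
    have hGs : tsupport (fun x => g (rescale z hℓ x)) ⊆ ball z (R * ℓ) := by
      rw [mul_comm R, ← preimage_rescale_ball_zero z hℓ]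
      exact (tsupport_comp_subset_preimage g (rescale z hℓ).continuous).trans
        (Set.preimage_mono hsupp)
    have hp := hpair _ hGL hGs hGi
    have hlim := (tendsto_rieszPairingH hd H hgood.1 hGL fun x => hbd _).abs
    -- Doubling `a` gives the strict inequality needed to pass from the limit to truncations close
    -- to zero.
    have hev := hlim.eventually_lt_const (u := 2 * a * ℓ ^ d) (by
      have : 0 < a * ℓ ^ d := by positivity
      linarith)
    obtain ⟨η, h1, h2, h3⟩ := ((hev.and (Ioo_mem_nhdsGT (show 0 < ℓ * δ by positivity))).exists)
    refine ⟨ℓ⁻¹ * η, by positivity, ?_, ?_⟩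
    · rw [inv_mul_le_iff₀ hℓ]; exact h3.le
    · rw [integral_rescaleMeasure]
      simp only [rieszRegH_rescaleMeasure, mul_inv_cancel_left₀ hℓ.ne']
      rw [smul_eq_mul, abs_mul, abs_of_pos (by positivity : 0 < (ℓ ^ d)⁻¹),
        inv_mul_le_iff₀ (by positivity)]
      linarith

theorem integral_planeMeasure_comp {H : Submodule ℝ (Sp d)} (hH : Module.finrank ℝ H = d)
    {f : Sp d → ℝ} (hf : Continuous f) :
    ∫ y, f ((rescale z hℓ).symm y) ∂(planeMeasure H 0) =
      (ℓ ^ d)⁻¹ * ∫ x, f x ∂(planeMeasure H z) := by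
  rw [planeMeasure, planeMeasure, integral_map (f := fun y => f ((rescale z hℓ).symm y))
    (by fun_prop) (hf.comp (rescale z hℓ).symm.continuous).aestronglyMeasurable,
    integral_map (by fun_prop) hf.aestronglyMeasurable]
  have e : ∀ h : H, (rescale z hℓ).symm (0 + (h : Sp d)) = z + ((ℓ • h : H) : Sp d) := fun h => by
    rw [Homeomorph.symm_apply_eq, rescale_apply, add_sub_cancel_left, Submodule.coe_smul,
      inv_smul_smul₀ hℓ.ne', zero_add]
  simp only [e]
  rw [Measure.integral_comp_smul volume (fun h : H => f (z + (h : Sp d))), hH, smul_eq_mul,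
    abs_of_pos (by positivity)]

end Scaling

end

theorem mainTheorem2 (d : ℕ) (hd : 1 ≤ d) (A α c C : ℝ)
    (hA : 0 < A) (hα : 0 < α) (hc : 0 < c) (hC : 0 < C) :
    ∃ A' α' : ℝ, 0 < A' ∧ 0 < α' ∧
      ∀ (H : Submodule ℝ (Sp d)), Module.finrank ℝ H = d →
      ∀ (z : Sp d) (ℓ : ℝ), 0 < ℓ →
      ∀ (μ : Measure (Sp d)), IsFiniteMeasure μ →
        IsGood C μ →
        IsADRegularIn (ball z (5 * A' * ℓ)) c μ →
        IsGeomFlat H (5 * A') α' z ℓ μ →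
        (∀ g : Sp d → Sp d, LipschitzWith (Real.toNNReal ℓ⁻¹) g →
          tsupport g ⊆ ball z (5 * A' * ℓ) → ∫ x, g x ∂μ = 0 →
          |rieszPairingH H μ (fun _ => 1) g| ≤ α' * ℓ ^ d) →
        IsFlat H A α z ℓ μ := by
  obtain ⟨R, a, hAR, ha, haα, key⟩ := exists_abs_integral_le_of_flatData hd hA hα hc hC
  -- The hypotheses concern the radius `5 * A'`, which is thereby the radius `R` of the normalized
  -- statement.
  refine ⟨R / 5, a, by linarith, ha, fun H hH z ℓ hℓ μ hμ hgood hreg hflat hpair => ?_⟩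
  rw [show 5 * (R / 5) = R by ring] at hreg hflat hpair
  have F := flatData_rescaleMeasure z hℓ hd hC ha hgood hreg hflat hpair
  have hball : ball z (A * ℓ) ⊆ ball z (R * ℓ) := ball_subset_ball (by gcongr)
  refine ⟨⟨fun x hx => ?_, fun x hx => ?_⟩, fun f hf hsupp hfi => ?_⟩
  · obtain ⟨y, hy, h⟩ := hflat.1 x ⟨hx.1, hball hx.2⟩
    exact ⟨y, hy, h.trans (by gcongr)⟩
  · obtain ⟨y, hy, h⟩ := hflat.2 x ⟨hx.1, hball hx.2⟩
    exact ⟨y, hy, h.trans (by gcongr)⟩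
  · have h := key H hH _ F (fun y => f ((rescale z hℓ).symm y)) ?_ ?_ ?_
    · rw [integral_rescaleMeasure] at h
      simp only [Homeomorph.symm_apply_apply] at h
      rwa [smul_eq_mul, abs_mul, abs_of_pos (by positivity : 0 < (ℓ ^ d)⁻¹),
        inv_mul_le_iff₀ (by positivity), mul_comm] at h
    · refine LipschitzWith.of_dist_le_mul fun x y => ?_
      refine (hf.dist_le_mul _ _).trans (le_of_eq ?_)
      rw [Real.coe_toNNReal _ (by positivity), dist_eq_norm, ← norm_rescale_sub z hℓ,
        Homeomorph.apply_symm_apply, Homeomorph.apply_symm_apply, NNReal.coe_one, one_mul,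
        dist_eq_norm]
    · intro y hy
      obtain ⟨x, rfl⟩ := (rescale z hℓ).surjective y
      rw [norm_rescale, le_inv_mul_iff₀ hℓ] at hy
      rw [Homeomorph.symm_apply_apply]
      refine image_eq_zero_of_notMem_tsupport fun h => ?_
      have := hsupp h
      rw [mem_ball, dist_eq_norm] at this
      linarith
    · rw [integral_planeMeasure_comp z hℓ hH hf.continuous, hfi, mul_zero]
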